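/- Let $q,z\in\mathbb C$ with $0<|q|<1$ and $0<|z|<1$, and let $a,b,c,h\in\mathbb C\setminus\{0\}$. Write $(x;q)_n=\prod_{i=0}^{n-1}(1-xq^i)$, $(x;q)_\infty=\prod_{n\ge0}(1-xq^n)$, $(x_1,\dots,x_k;q)_n=\prod_j(x_j;q)_n$ for $n\in\{0,1,2,\dots\}\cup\{\infty\}$, $\vartheta(x;q)=(x,q/x;q)_\infty$, $\vartheta(x_1,\dots,x_k;q)=\prod_j\vartheta(x_j;q)$, $${}_{s+1}\phi_s\left({a_1,\dots,a_{s+1}\atop b_1,\dots,b_s};q,x\right)=\sum_{k=0}^\infty\frac{(a_1,\dots,a_{s+1};q)_k}{(q,b_1,\dots,b_s;q)_k}\,x^k ,$$ $\Omega_q=\{q^{-k}:k=0,1,2,\dots\}$, $\Upsilon_q=\{q^k:k\in\mathbb Z\}$; in a list, $\pm x$ stands for the two entries $x,-x$. Fix arbitrary square roots of $q,a,b,c$; the square root of a monomial in $q,a,b,c$ means the corresponding monomial in these fixed roots (for example $\sqrt{ac/b}=\sqrt a\sqrt c/\sqrt b$), and $q^{3/2}=(\sqrt q)^3$. Assume that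 no denominator below vanishes, that is, $h,\ hc/(bz)\notin\Upsilon_q$; $c,\ qa/b\notin\Omega_q$; $ab/c\notin\Upsilon_q$; $\pm\sqrt{qac/b}\notin\Omega_q$; $\pm z\sqrt{qab/c}\notin\Omega_q$. Then $${}_2\phi_1\left({a,b\atop c};q,z\right){}_2\phi_1\left({a,qa/c\atop qa/b};q,z\right)=\frac{1}{\vartheta(h,\frac{hc}{bz};q)}\bigl(T_1+T_2+T_3^{+}+T_3^{-}+T_4^{+}+T_4^{-}\bigr),$$ where $$T_1=\frac{\vartheta(ha,\frac{hc}{abz};q)\,(\frac qb,\frac ca,\frac cb,\frac cb;q)_\infty}{(c,\frac c{ab},\frac c{ab},\frac{qa}b;q)_\infty}\ {}_6\phi_5\left({a,b,\frac{qa}c,\frac{qb}c,\frac{abz}c,\frac qz\atop \frac{qab}c,\pm\sqrt{\frac{qab}c},\pm q\sqrt{\frac{ab}c}};q,q\right),$$ $$T_2=\frac{\vartheta(\frac{hc}b,\frac hz;q)\,(a,a,b,\frac{qa}c,\frac{abz}c,\frac{abz}c;q)_\infty}{(z,z,c,\frac{qa}b,\frac{ab}c,\frac{ab}c;q)_\infty}\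 {}_6\phi_5\left({\frac qa,\frac qb,\frac ca,\frac cb,z,\frac{qc}{abz}\atop \frac{qc}{ab},\pm\sqrt{\frac{qc}{ab}},\pm q\sqrt{\frac c{ab}}};q,q\right),$$ and, for $\epsilon=\pm1$, $$T_3^{\epsilon}=\frac{\vartheta\bigl(\epsilon h\sqrt{\frac{ac}b},\frac{\epsilon h}z\sqrt{\frac c{ab}},\epsilon\sqrt{\frac{bc}a};q\bigr)\,(a,\frac cb,\frac{abz}c;q)_\infty}{\bigl(-1,\pm\sqrt q,z,c,\frac{qa}b,\epsilon\sqrt{\frac c{ab}},\epsilon\sqrt{\frac{ab}c};q\bigr)_\infty}\ {}_6\phi_5\left({\epsilon\sqrt{\frac{ac}b},\epsilon\sqrt{\frac{bc}a},\epsilon q\sqrt{\frac a{bc}},\epsilon q\sqrt{\frac b{ac}},\epsilon z\sqrt{\frac{ab}c},\frac{\epsilon q}z\sqrt{\frac c{ab}}\atop -q,\pm\sqrt q,\epsilon q\sqrt{\frac{ab}c},\epsilon q\sqrt{\frac c{ab}}};q,q\right),$$ $$T_4^{\epsilon}=\frac{\vartheta\bigl(\epsilon h\sqrt{\frac{qac}b},\frac{\epsilon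 h}z\sqrt{\frac c{qab}};q\bigr)\,\bigl(a,\frac cb,\frac{abz}c,\epsilon\sqrt{\frac{ac}{qb}},\epsilon\sqrt{\frac{bc}{qa}},\epsilon\sqrt{\frac{qa}{bc}},\epsilon z\sqrt{\frac{ab}{qc}};q\bigr)_\infty}{\bigl(-1,\pm\frac1{\sqrt q},z,c,\frac{qa}b,\epsilon\sqrt{\frac{qac}b},\epsilon\sqrt{\frac c{qab}},\epsilon\sqrt{\frac{ab}{qc}},\epsilon z\sqrt{\frac{qab}c};q\bigr)_\infty}\ {}_6\phi_5\left({\epsilon\sqrt{\frac{qac}b},\epsilon\sqrt{\frac{qbc}a},\epsilon\sqrt{\frac{q^3a}{bc}},\epsilon\sqrt{\frac{q^3b}{ac}},\epsilon z\sqrt{\frac{qab}c},\frac\epsilon z\sqrt{\frac{q^3c}{ab}}\atop -q,\pm q^{3/2},\epsilon\sqrt{\frac{q^3ab}c},\epsilon\sqrt{\frac{q^3c}{ab}}};q,q\right).$$ -/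

import Mathlib

/-- The set `Ω_q = {q^{-k} : k = 0, 1, 2, …}`. -/
def qOmega (q : ℂ) : Set ℂ := {x | ∃ k : ℕ, x = q ^ (-(k : ℤ))}

/-- The set `Υ_q = {q^k : k ∈ ℤ}`. -/
def qUpsilon (q : ℂ) : Set ℂ := {x | ∃ k : ℤ, x = q ^ k}

/-- The finite `q`-shifted factorial `(a;q)_n = (1 - a)(1 - aq) ⋯ (1 - aq^{n-1})`. -/
noncomputable def qFac (a q : ℂ) (n : ℕ) : ℂ := ∏ i ∈ Finset.range n, (1 - a * q ^ i)

/-- The product `(a₁, …, a_k; q)_n = (a₁;q)_n ⋯ (a_k;q)_n`. -/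
noncomputable def qFacs (l : List ℂ) (q : ℂ) (n : ℕ) : ℂ := (l.map fun a => qFac a q n).prod

/-- The infinite `q`-shifted factorial `(a;q)_∞ = ∏_{n ≥ 0} (1 - aq^n)`, for `|q| < 1`. -/
noncomputable def qInf (a q : ℂ) : ℂ := ∏' n : ℕ, (1 - a * q ^ n)

/-- The product `(a₁, …, a_k; q)_∞ = (a₁;q)_∞ ⋯ (a_k;q)_∞`. -/
noncomputable def qInfs (l : List ℂ) (q : ℂ) : ℂ := (l.map fun a => qInf a q).prod

/-- The theta function `ϑ(x;q) = (x, q/x; q)_∞`, for `x ≠ 0`. -/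
noncomputable def qTheta (x q : ℂ) : ℂ := qInfs [x, q / x] q

/-- The product `ϑ(x₁, …, x_k; q) = ϑ(x₁;q) ⋯ ϑ(x_k;q)`. -/
noncomputable def qThetas (l : List ℂ) (q : ℂ) : ℂ := (l.map fun x => qTheta x q).prod

/-- The `k`-th term of the basic hypergeometric series `_{r+1}φ_s` with the list `as` of `r + 1`
numerator parameters and the list `bs` of `s` denominator parameters:
`(as;q)_k / (q, bs;q)_k * ((-1)^k q^{k choose 2})^{s - r} * z^k`. -/
noncomputable def qHypTerm (as bs : List ℂ) (q z : ℂ) (k : ℕ) : ℂ :=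
  qFacs as q k / qFacs (q :: bs) q k
    * ((-1) ^ k * q ^ k.choose 2) ^ ((bs.length : ℤ) + 1 - as.length) * z ^ k

/-- The basic hypergeometric series `_{r+1}φ_s(as; bs; q, z)`. -/
noncomputable def qHyp (as bs : List ℂ) (q z : ℂ) : ℂ := ∑' k : ℕ, qHypTerm as bs q z k

/-- The infinite product defining `(a;q)_∞` converges when `|q| < 1`. -/
theorem qInf_multipliable (a q : ℂ) (hq : ‖q‖ < 1) :
    Multipliable fun n : ℕ => 1 - a * q ^ n := by
  have h : Summable fun n : ℕ => ‖-(a * q ^ n)‖ := by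
    simp only [norm_neg, norm_mul, norm_pow]
    exact (summable_geometric_of_lt_one (norm_nonneg q) hq).mul_left _
  simpa [sub_eq_add_neg] using multipliable_one_add_of_summable h

theorem qFacs_succ (l : List ℂ) (q : ℂ) (n : ℕ) :
    qFacs l q (n + 1) = qFacs l q n * (l.map fun a => 1 - a * q ^ n).prod := by
  induction l with
  | nil => simp [qFacs]
  | cons a l ih =>
    simp only [qFacs, List.map_cons, List.prod_cons, qFac, Finset.prod_range_succ] at ih ⊢
    rw [ih]
    ring

/-- A series `_{s+1}φ_s` converges when `|q| < 1` and `|z| < 1`. -/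
theorem qHypTerm_summable (as bs : List ℂ) (q z : ℂ) (hl : as.length = bs.length + 1)
    (hq : ‖q‖ < 1) (hz : ‖z‖ < 1) : Summable (qHypTerm as bs q z) := by
  have hf : ∀ k, qHypTerm as bs q z k = qFacs as q k / qFacs (q :: bs) q k * z ^ k := by
    intro k
    simp [qHypTerm, hl]
  have hlim : ∀ l : List ℂ, Filter.Tendsto (fun n : ℕ => (l.map fun a => 1 - a * q ^ n).prod)
      Filter.atTop (nhds 1) := by
    intro l
    induction l with
    | nil => simp
    | cons a l ih =>
      have h1 : Filter.Tendsto (fun n : ℕ => 1 - a * q ^ n) Filter.atTop (nhds (1 - a * 0)) :=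
        ((tendsto_pow_atTop_nhds_zero_of_norm_lt_one hq).const_mul a).const_sub 1
      simpa using h1.mul ih
  have hrat : Filter.Tendsto (fun n : ℕ => ‖(as.map fun a => 1 - a * q ^ n).prod
      / ((q :: bs).map fun a => 1 - a * q ^ n).prod * z‖) Filter.atTop (nhds ‖z‖) := by
    have h := (((hlim as).div (hlim (q :: bs)) one_ne_zero).mul_const z).norm
    simpa using h
  obtain ⟨ρ, h1, h2⟩ := exists_between hz
  refine summable_of_ratio_norm_eventually_le (r := ρ) h2 ?_
  filter_upwards [hrat.eventually (gt_mem_nhds h1)] with n hn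
  have : qHypTerm as bs q z (n + 1) = ((as.map fun a => 1 - a * q ^ n).prod
      / ((q :: bs).map fun a => 1 - a * q ^ n).prod * z) * qHypTerm as bs q z n := by
    rw [hf, hf, qFacs_succ, qFacs_succ, mul_div_mul_comm, pow_succ]
    ring
  rw [this, norm_mul]
  exact mul_le_mul_of_nonneg_right hn.le (norm_nonneg _)

/-! Put α = a, β = c/b, w = bz/c, A² = αβ, s² = q. The identity comes from evaluating one contour
integral in two ways. The integral is the average over a circle |t| = ρ of f(t) (αβwt;q)_∞ K(t),
where K(t) = ϑ(h/t, ht/w;q) / (1/t, w/t;q)_∞ and f(t) = (βbt, qαt/b, αβt;q)_∞ / (αt, βt, αβt²;q)_∞.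
The radius satisfies ρ > 1 and ρ > |w|, while all poles of f lie outside the circle. Everything
rests on the relation (t-1)(t-w) K(t) = qw K(t/q) (`qKernel_shift`), from which h has dropped out;
this is why h is a free parameter.

Evaluation by power series. The relation determines all moments of K from the zeroth one: ∏_{i<n}(t
- q^i) has moment w^n times the zeroth moment (`qMoment_qNode`), so t^J gives a polynomial in w with
q-binomial coefficients (`qMoment_pow`). The zeroth moment is ϑ(h, h/w;q)/(q;q)_∞ (`qMoment_one`).
Expanding f and (αβwt;q)_∞ turns the integral into a power series in w whose coefficients are finite
sums over the values f(q^r) (`hasSum_qMoment_mul_qInf`). A terminating Sears transformation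
(`qSears`), itself two applications of the q-Saalschütz sum, recognises these coefficients as those
of ₂φ₁(α, b; βb; βw) ₂φ₁(β, q/b; qα/b; αw) (`qMoment_eq`). Euler's transformation turns the second
factor into ₂φ₁(a, qa/c; qa/b; z), up to infinite products.

Evaluation by residues. Since (αβt²;q)_∞ = (At, -At, sAt, -sAt;q)_∞, the poles outside the circle
form six families t = 1/(x_i q^k) with x_i among α, β, ±A, ±sA. Moving the circle outwards, the
integral tends to 0 because the integrand is multiplied by a factor tending to q from one circle to
the next (`tendsto_circleIntegral_qIntegrand`). The residues of each family add up to a multiple of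
a ₆φ₅ at argument q (`circleIntegral_qIntegrand`, `qResidue_eq`). The families of α and β give T₁
and T₂, those of ±A give T₃^±, those of ±sA give T₄^±.

Both evaluations need |a|, |c/b| and |abz/c| to be less than 1. The general case follows by analytic
continuation along (√a, √c) ↦ (x²√a, x√c), from small x to x = 1 (`qHyp_mul_qHyp_eq`). -/

/-! ### Finite and infinite shifted factorials: bounds, splitting, zeros. -/

theorem one_add_norm_prod_le_exp {q : ℂ} (hq : ‖q‖ < 1) (r : ℝ) (hr : 0 ≤ r) (n : ℕ) :
    ∏ i ∈ Finset.range n, (1 + r * ‖q‖ ^ i) ≤ Real.exp (r / (1 - ‖q‖)) := by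
  have h1 : ∀ i ∈ Finset.range n, 1 + r * ‖q‖ ^ i ≤ Real.exp (r * ‖q‖ ^ i) := fun i _ => by
    linarith [Real.add_one_le_exp (r * ‖q‖ ^ i)]
  refine (Finset.prod_le_prod (fun i _ => by positivity) h1).trans ?_
  rw [← Real.exp_sum, Real.exp_le_exp, ← Finset.mul_sum, div_eq_mul_inv,
    ← tsum_geometric_of_lt_one (norm_nonneg q) hq]
  gcongr
  exact (summable_geometric_of_lt_one (norm_nonneg q) hq).sum_le_tsum _ fun _ _ => by positivity

@[simp] theorem qFac_zero (a q : ℂ) : qFac a q 0 = 1 := by simp [qFac]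

theorem qFac_succ (a q : ℂ) (n : ℕ) : qFac a q (n + 1) = qFac a q n * (1 - a * q ^ n) := by
  simp [qFac, Finset.prod_range_succ]

theorem qFac_add (a q : ℂ) (m n : ℕ) :
    qFac a q (m + n) = qFac a q m * qFac (a * q ^ m) q n := by
  simp only [qFac, Finset.prod_range_add, pow_add, mul_assoc]

theorem qFac_succ_left (a q : ℂ) (n : ℕ) : qFac a q (n + 1) = (1 - a) * qFac (a * q) q n := by
  rw [add_comm, qFac_add]
  simp [qFac]

theorem qFac_ne_zero {a q : ℂ} (h : ∀ k : ℕ, a * q ^ k ≠ 1) (n : ℕ) : qFac a q n ≠ 0 :=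
  Finset.prod_ne_zero_iff.2 fun k _ => sub_ne_zero.2 (h k).symm

theorem mul_pow_ne_one {a q : ℂ} (ha : ‖a‖ < 1) (hq : ‖q‖ < 1) (k : ℕ) : a * q ^ k ≠ 1 := by
  intro h
  have h1 : ‖a * q ^ k‖ = 1 := by rw [h]; simp
  rw [norm_mul, norm_pow] at h1
  nlinarith [pow_le_one₀ (n := k) (norm_nonneg q) hq.le, norm_nonneg a, norm_nonneg q,
    pow_nonneg (norm_nonneg q) k]

theorem qFac_self_ne_zero {q : ℂ} (hq : ‖q‖ < 1) (n : ℕ) : qFac q q n ≠ 0 :=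
  qFac_ne_zero (mul_pow_ne_one hq hq) n

/-- The bound is independent of n and explicit in ‖a‖, so it can dominate series whose parameters
vary over a bounded set. -/
theorem norm_qFac_le {q : ℂ} (hq : ‖q‖ < 1) (a : ℂ) (n : ℕ) :
    ‖qFac a q n‖ ≤ Real.exp (‖a‖ / (1 - ‖q‖)) := by
  refine le_trans ?_ (one_add_norm_prod_le_exp hq ‖a‖ (norm_nonneg a) n)
  rw [qFac, norm_prod]
  refine Finset.prod_le_prod (fun i _ => norm_nonneg _) fun i _ => ?_
  refine (norm_sub_le _ _).trans ?_
  simp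

theorem qInf_tendsto {q : ℂ} (hq : ‖q‖ < 1) (a : ℂ) :
    Filter.Tendsto (qFac a q) Filter.atTop (nhds (qInf a q)) :=
  (qInf_multipliable a q hq).hasProd.tendsto_prod_nat

theorem norm_qInf_le {q : ℂ} (hq : ‖q‖ < 1) (a : ℂ) :
    ‖qInf a q‖ ≤ Real.exp (‖a‖ / (1 - ‖q‖)) :=
  le_of_tendsto (qInf_tendsto hq a).norm (Filter.Eventually.of_forall (norm_qFac_le hq a))

theorem qInf_eq_qFac_mul {q : ℂ} (hq : ‖q‖ < 1) (a : ℂ) (n : ℕ) :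
    qInf a q = qFac a q n * qInf (a * q ^ n) q := by
  refine tendsto_nhds_unique ((Filter.tendsto_add_atTop_iff_nat n).2 (qInf_tendsto hq a)) ?_
  simp_rw [add_comm _ n, qFac_add]
  exact (qInf_tendsto hq _).const_mul _

theorem qInf_eq_one_sub_mul {q : ℂ} (hq : ‖q‖ < 1) (a : ℂ) :
    qInf a q = (1 - a) * qInf (a * q) q := by
  simpa [qFac] using qInf_eq_qFac_mul hq a 1

theorem qInf_ne_zero {a q : ℂ} (hq : ‖q‖ < 1) (h : ∀ k : ℕ, a * q ^ k ≠ 1) : qInf a q ≠ 0 := by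
  have := tprod_one_add_ne_zero_of_summable (f := fun n : ℕ => -(a * q ^ n))
    (fun n => by rw [← sub_eq_add_neg]; exact sub_ne_zero.2 (h n).symm)
    (by simpa [norm_mul] using (summable_geometric_of_lt_one (norm_nonneg q) hq).mul_left ‖a‖)
  simpa [qInf, sub_eq_add_neg] using this

theorem qInf_ne_zero_iff {a q : ℂ} (hq : ‖q‖ < 1) :
    qInf a q ≠ 0 ↔ ∀ k : ℕ, a * q ^ k ≠ 1 := by
  refine ⟨fun h k hk => h ?_, qInf_ne_zero hq⟩
  rw [qInf_eq_qFac_mul hq a (k + 1), qFac_succ, hk]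
  simp

theorem qInf_self_ne_zero {q : ℂ} (hq : ‖q‖ < 1) : qInf q q ≠ 0 :=
  qInf_ne_zero hq (mul_pow_ne_one hq hq)

@[simp] theorem qInf_zero (q : ℂ) : qInf 0 q = 1 := by simp [qInf]

/-- A function which is continuous at `0`, takes the value `1` there and satisfies
`G z * F z = H z * F (q z)` iterates to infinite products. -/
theorem qInf_mul_eq_of_functional_equation {q : ℂ} (hq : ‖q‖ < 1) {F : ℂ → ℂ} {a z : ℂ}
    (hF : ContinuousAt F 0) (h0 : F 0 = 1)
    (h : ∀ n : ℕ, (1 - z * q ^ n) * F (z * q ^ n) = (1 - a * z * q ^ n) * F (z * q ^ (n + 1))) :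
    qInf z q * F z = qInf (a * z) q := by
  have key : ∀ n : ℕ, qFac z q n * F z = qFac (a * z) q n * F (z * q ^ n) := by
    intro n
    induction n with
    | zero => simp
    | succ n ih =>
      rw [qFac_succ, qFac_succ, mul_right_comm, ih, mul_right_comm, mul_assoc (qFac _ _ _), h n]
      ring
  have hz : Filter.Tendsto (fun n : ℕ => z * q ^ n) Filter.atTop (nhds 0) := by
    simpa using (tendsto_pow_atTop_nhds_zero_of_norm_lt_one hq).const_mul z
  have h1 := (qInf_tendsto hq (a * z)).mul (hF.tendsto.comp hz)
  rw [h0, mul_one] at h1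
  refine tendsto_nhds_unique ((qInf_tendsto hq z).mul_const (F z)) ?_
  simp_rw [key]
  exact h1

theorem exists_norm_qFac_self_inv_le {q : ℂ} (hq : ‖q‖ < 1) :
    ∃ C : ℝ, 0 < C ∧ ∀ n, ‖(qFac q q n)⁻¹‖ ≤ C := by
  have h := ((qInf_tendsto hq q).inv₀ (qInf_self_ne_zero hq)).norm.bddAbove_range
  obtain ⟨C, hC⟩ := h
  exact ⟨max C 1, by positivity, fun n => (hC ⟨n, rfl⟩).trans (le_max_left _ _)⟩

/-! ### Euler's expansion, the q-binomial theorem and q-binomial coefficients. -/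

/-- The coefficients of Euler's expansion of `(x;q)_∞`. -/
noncomputable def qExpCoeff (q : ℂ) (m : ℕ) : ℂ := (-1) ^ m * q ^ m.choose 2 / qFac q q m

/-- Consecutive terms have ratio |q^m / (1 - q^{m+1})| r, which tends to 0, so the series has
infinite radius of convergence. -/
theorem qExpCoeff_summable {q : ℂ} (hq : ‖q‖ < 1) (r : ℝ) (hr : 0 ≤ r) :
    Summable fun m => ‖qExpCoeff q m‖ * r ^ m := by
  have ht : Filter.Tendsto (fun m : ℕ => ‖q ^ m / (1 - q * q ^ m)‖ * r) Filter.atTop (nhds 0) := by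
    have h1 := tendsto_pow_atTop_nhds_zero_of_norm_lt_one hq
    have h2 := (h1.div ((h1.const_mul q).const_sub 1) (by simp)).norm.mul_const r
    simpa using h2
  refine summable_of_ratio_norm_eventually_le (r := 1 / 2) (by norm_num) ?_
  filter_upwards [ht.eventually (gt_mem_nhds (show (0 : ℝ) < 1 / 2 by norm_num))] with m hm
  have : ‖qExpCoeff q (m + 1)‖ * r ^ (m + 1)
      = ‖q ^ m / (1 - q * q ^ m)‖ * r * (‖qExpCoeff q m‖ * r ^ m) := by
    have : qExpCoeff q (m + 1) = - (q ^ m / (1 - q * q ^ m)) * qExpCoeff q m := by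
      rw [qExpCoeff, qExpCoeff, qFac_succ, Nat.choose_succ_succ' m 1, Nat.choose_one_right,
        pow_add, pow_succ (-1 : ℂ), neg_mul, div_mul_div_comm, ← neg_div]
      congr 1 <;> ring
    rw [this, norm_mul, norm_neg]
    ring
  rw [this, Real.norm_of_nonneg (by positivity), Real.norm_of_nonneg (by positivity)]
  gcongr

theorem differentiable_tsum_mul_pow {c : ℕ → ℂ}
    (hc : ∀ r : ℝ, 0 ≤ r → Summable fun m => ‖c m‖ * r ^ m) :
    Differentiable ℂ fun z : ℂ => ∑' m, c m * z ^ m := by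
  intro z
  have hd : DifferentiableOn ℂ (fun z : ℂ => ∑' m, c m * z ^ m) (Metric.ball 0 (‖z‖ + 1)) := by
    refine Complex.differentiableOn_tsum_of_summable_norm (hc (‖z‖ + 1) (by positivity))
      (fun m => by fun_prop) Metric.isOpen_ball fun m w hw => ?_
    rw [norm_mul, norm_pow]
    gcongr
    exact (mem_ball_zero_iff.1 hw).le
  exact hd.differentiableAt (Metric.isOpen_ball.mem_nhds (by simp))

/-- Euler's expansion of `(x;q)_∞`. -/
theorem hasSum_qInf {q : ℂ} (hq : ‖q‖ < 1) (x : ℂ) :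
    HasSum (fun m => qExpCoeff q m * x ^ m) (qInf x q) := by
  have hs : ∀ z : ℂ, Summable fun m => qExpCoeff q m * z ^ m := fun z =>
    Summable.of_norm (by simpa [norm_mul] using qExpCoeff_summable hq ‖z‖ (norm_nonneg z))
  set F : ℂ → ℂ := fun z => ∑' m, qExpCoeff q m * z ^ m with hF
  have hc : Continuous F := (differentiable_tsum_mul_pow (qExpCoeff_summable hq)).continuous
  have h0 : F 0 = 1 := by
    rw [hF]
    simp only
    rw [tsum_eq_single 0 (fun m hm => by simp [hm])]
    simp [qExpCoeff]
  -- This functional equation, with continuity at 0 and F 0 = 1, characterises (z;q)_∞. It is read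
  -- off from coefficients after splitting 1 = q^m + (1 - q^m).
  have hfe : ∀ z, F z = (1 - z) * F (z * q) := by
    intro z
    have e1 : F z = F (z * q) + ∑' m, qExpCoeff q m * z ^ m * (1 - q ^ m) := by
      rw [hF]
      simp only
      rw [← Summable.tsum_add (hs (z * q))]
      · congr 1; ext m; ring
      · refine ((hs z).sub (hs (z * q))).congr fun m => ?_
        ring
    have e2 : ∑' m, qExpCoeff q m * z ^ m * (1 - q ^ m) = -z * F (z * q) := by
      rw [Summable.tsum_eq_zero_add (((hs z).sub (hs (z * q))).congr fun m => by ring)]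
      simp only [pow_zero, sub_self, mul_zero, zero_add]
      rw [hF]
      simp only
      rw [← tsum_mul_left]
      congr 1; ext m
      have hm := qFac_self_ne_zero hq m
      have hm1 := qFac_self_ne_zero hq (m + 1)
      rw [qExpCoeff, qExpCoeff, Nat.choose_succ_succ' m 1, Nat.choose_one_right]
      rw [qFac_succ] at hm1 ⊢
      have := (mul_ne_zero_iff.1 hm1).2
      rw [show 1 - q * q ^ m = 1 - q ^ (m + 1) by ring] at this ⊢
      field_simp
      ring
    rw [e1, e2]; ring
  have key : ∀ n : ℕ, F x = qFac x q n * F (x * q ^ n) := by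
    intro n
    induction n with
    | zero => simp
    | succ n ih => rw [ih, qFac_succ, hfe (x * q ^ n)]; ring_nf
  have hz : Filter.Tendsto (fun n : ℕ => x * q ^ n) Filter.atTop (nhds 0) := by
    simpa using (tendsto_pow_atTop_nhds_zero_of_norm_lt_one hq).const_mul x
  have h1 := (qInf_tendsto hq x).mul ((hc.tendsto 0).comp hz)
  rw [h0, mul_one] at h1
  have h2 : F x = qInf x q := by
    refine tendsto_nhds_unique (tendsto_const_nhds (x := F x)) (h1.congr fun n => ?_)
    exact (key n).symm
  rw [← h2]
  exact (hs x).hasSum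

theorem differentiable_qInf {q : ℂ} (hq : ‖q‖ < 1) : Differentiable ℂ fun x => qInf x q := by
  have := differentiable_tsum_mul_pow (qExpCoeff_summable hq)
  convert this using 2 with x
  exact (hasSum_qInf hq x).tsum_eq.symm

/-- The `q`-binomial theorem. -/
theorem hasSum_qBinomial {q : ℂ} (hq : ‖q‖ < 1) (a : ℂ) {z : ℂ} (hz : ‖z‖ < 1) :
    HasSum (fun k => qFac a q k / qFac q q k * z ^ k) (qInf (a * z) q / qInf z q) := by
  have hs : ∀ z : ℂ, ‖z‖ < 1 → Summable fun k => qFac a q k / qFac q q k * z ^ k := by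
    intro z hz
    refine (qHypTerm_summable [a] [] q z rfl hq hz).congr fun k => ?_
    simp [qHypTerm, qFacs]
  set F : ℂ → ℂ := fun z => ∑' k, qFac a q k / qFac q q k * z ^ k with hF
  obtain ⟨C, hC0, hC⟩ := exists_norm_qFac_self_inv_le hq
  -- Only continuity at 0 is needed, so any disc of radius below 1 serves; 1/2 is arbitrary.
  have hc : ContinuousAt F 0 := by
    have hd : DifferentiableOn ℂ F (Metric.ball 0 (1 / 2)) := by
      refine Complex.differentiableOn_tsum_of_summable_norm (u := fun k =>
        Real.exp (‖a‖ / (1 - ‖q‖)) * C * (1 / 2) ^ k)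
        ((summable_geometric_of_lt_one (by norm_num) (by norm_num)).mul_left _)
        (fun m => by fun_prop) Metric.isOpen_ball fun m w hw => ?_
      rw [norm_mul, norm_pow, div_eq_mul_inv, norm_mul]
      gcongr
      · exact norm_qFac_le hq a m
      · exact hC m
      · exact (mem_ball_zero_iff.1 hw).le
    exact (hd.differentiableAt (Metric.isOpen_ball.mem_nhds (by simp))).continuousAt
  have h0 : F 0 = 1 := by
    rw [hF]
    simp only
    rw [tsum_eq_single 0 (fun m hm => by simp [hm])]
    simp
  have hfe : ∀ z, ‖z‖ < 1 → (1 - z) * F z = (1 - a * z) * F (z * q) := by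
    intro z hz
    have hzq : ‖z * q‖ < 1 := by
      rw [norm_mul]; nlinarith [norm_nonneg z, norm_nonneg q]
    have hd : Summable fun k => qFac a q k / qFac q q k * z ^ k * (1 - q ^ k) :=
      ((hs z hz).sub (hs _ hzq)).congr fun m => by ring
    have e1 : F z - F (z * q) = ∑' k, qFac a q k / qFac q q k * z ^ k * (1 - q ^ k) := by
      rw [hF]
      simp only
      rw [← Summable.tsum_sub (hs z hz) (hs _ hzq)]
      congr 1; ext m; ring
    have e2 : ∑' k, qFac a q k / qFac q q k * z ^ k * (1 - q ^ k)
        = z * F z - a * z * F (z * q) := by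
      rw [hd.tsum_eq_zero_add]
      simp only [pow_zero, sub_self, mul_zero, zero_add]
      rw [hF]
      simp only
      rw [← tsum_mul_left, ← tsum_mul_left, ← Summable.tsum_sub ((hs z hz).mul_left _)
        ((hs _ hzq).mul_left _)]
      congr 1; ext m
      have hm := qFac_self_ne_zero hq m
      have hm1 := qFac_self_ne_zero hq (m + 1)
      rw [qFac_succ a]
      rw [qFac_succ] at hm1 ⊢
      have := (mul_ne_zero_iff.1 hm1).2
      rw [show 1 - q * q ^ m = 1 - q ^ (m + 1) by ring] at this ⊢
      field_simp
      ring
    linear_combination e1 + e2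
  have hzn : ∀ n : ℕ, ‖z * q ^ n‖ < 1 := by
    intro n
    rw [norm_mul, norm_pow]
    nlinarith [pow_le_one₀ (n := n) (norm_nonneg q) hq.le, norm_nonneg z,
      pow_nonneg (norm_nonneg q) n]
  have h1 := qInf_mul_eq_of_functional_equation hq (a := a) (z := z) hc h0 (fun n => by
    have := hfe _ (hzn n)
    rw [this]; ring_nf)
  have h2 : F z = qInf (a * z) q / qInf z q := by
    rw [eq_div_iff (qInf_ne_zero hq (mul_pow_ne_one hz hq)), mul_comm, h1]
  rw [← h2]
  exact (hs z hz).hasSum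


theorem qExpCoeff_succ {q : ℂ} (hq : ‖q‖ < 1) (m : ℕ) :
    qExpCoeff q (m + 1) * (1 - q ^ (m + 1)) = -q ^ m * qExpCoeff q m := by
  have hm := qFac_self_ne_zero hq m
  have hm1 := qFac_self_ne_zero hq (m + 1)
  rw [qExpCoeff, qExpCoeff, Nat.choose_succ_succ' m 1, Nat.choose_one_right]
  rw [qFac_succ] at hm1 ⊢
  have := (mul_ne_zero_iff.1 hm1).2
  rw [show 1 - q * q ^ m = 1 - q ^ (m + 1) by ring] at this ⊢
  field_simp
  ring

theorem one_sub_pow_div_qFac_self {q : ℂ} (hq : ‖q‖ < 1) (m : ℕ) :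
    (1 - q ^ (m + 1)) / qFac q q (m + 1) = 1 / qFac q q m := by
  have hm1 := qFac_self_ne_zero hq (m + 1)
  rw [qFac_succ] at hm1 ⊢
  have := mul_ne_zero_iff.1 hm1
  rw [show 1 - q * q ^ m = 1 - q ^ (m + 1) by ring] at this ⊢
  field_simp [this.1, this.2]

/-- The finite `q`-binomial theorem. -/
theorem qFac_div_eq_sum {q : ℂ} (hq : ‖q‖ < 1) (x : ℂ) (n : ℕ) :
    qFac x q n / qFac q q n = ∑ p ∈ Finset.HasAntidiagonal.antidiagonal n,
      qExpCoeff q p.1 * x ^ p.1 / qFac q q p.2 := by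
  induction n with
  | zero => simp [qExpCoeff]
  | succ n ih =>
    have hn : 1 - q ^ (n + 1) ≠ 0 := by
      have := qFac_self_ne_zero hq (n + 1)
      rw [qFac_succ] at this
      rw [pow_succ']
      exact (mul_ne_zero_iff.1 this).2
    -- The weights in `e1` and `e2` add up to 1 - q^{n+1}, because (1 - q^j) + q^j (1 - q^i) = 1 -
    -- q^{i+j}. The first weight lowers the second index by one, the other lowers the first index,
    -- and both reduce to the induction hypothesis.
    have e1 : ∑ p ∈ Finset.HasAntidiagonal.antidiagonal (n + 1),
        qExpCoeff q p.1 * x ^ p.1 * ((1 - q ^ p.2) / qFac q q p.2)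
        = qFac x q n / qFac q q n := by
      rw [Finset.Nat.sum_antidiagonal_succ', ih]
      simp [one_sub_pow_div_qFac_self hq, ← div_eq_mul_inv]
    have e2 : ∑ p ∈ Finset.HasAntidiagonal.antidiagonal (n + 1),
        q ^ p.2 * (qExpCoeff q p.1 * (1 - q ^ p.1)) * x ^ p.1 / qFac q q p.2
        = - (q ^ n * x) * (qFac x q n / qFac q q n) := by
      rw [Finset.Nat.sum_antidiagonal_succ, ih, Finset.mul_sum]
      simp only [pow_zero, sub_self, mul_zero, zero_mul, zero_div, zero_add]
      refine Finset.sum_congr rfl fun p hp => ?_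
      rw [qExpCoeff_succ hq, ← Finset.HasAntidiagonal.mem_antidiagonal.1 hp]
      ring
    have e3 : (1 - q ^ (n + 1)) * ∑ p ∈ Finset.HasAntidiagonal.antidiagonal (n + 1),
        qExpCoeff q p.1 * x ^ p.1 / qFac q q p.2
        = (1 - x * q ^ n) * (qFac x q n / qFac q q n) := by
      rw [show (1 - x * q ^ n) * (qFac x q n / qFac q q n) = qFac x q n / qFac q q n
        + - (q ^ n * x) * (qFac x q n / qFac q q n) by ring, ← e2, ← e1, Finset.mul_sum,
        ← Finset.sum_add_distrib]
      refine Finset.sum_congr rfl fun p hp => ?_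
      rw [← Finset.HasAntidiagonal.mem_antidiagonal.1 hp, pow_add]
      ring
    rw [← mul_right_inj' hn, e3, qFac_succ, qFac_succ, ← pow_succ']
    field_simp [qFac_self_ne_zero hq n]

/-- The `q`-binomial coefficient. -/
noncomputable def qBinom (q : ℂ) (J n : ℕ) : ℂ := qFac (q ^ J * q / q ^ n) q n / qFac q q n

theorem qBinom_zero_right (q : ℂ) (J : ℕ) : qBinom q J 0 = 1 := by simp [qBinom]

/-- The factor of index n - 1 - J in (q^{J-n+1};q)_n is 1 - q^0. Hence sums over n ≤ J may be
extended to all n, which is what allows the later interchange of summations. -/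
theorem qBinom_eq_zero {q : ℂ} (hq0 : q ≠ 0) {J n : ℕ} (h : J < n) : qBinom q J n = 0 := by
  rw [qBinom, qFac, Finset.prod_eq_zero (Finset.mem_range.2 (show n - 1 - J < n by omega))]
  · simp
  · obtain ⟨k, rfl⟩ := Nat.exists_eq_add_of_lt h
    rw [show J + k + 1 - 1 - J = k by omega, sub_eq_zero, eq_comm]
    field_simp
    ring

theorem qBinom_succ_succ {q : ℂ} (hq0 : q ≠ 0) (hq : ‖q‖ < 1) (J n : ℕ) :
    qBinom q (J + 1) (n + 1) = qBinom q J n + q ^ (n + 1) * qBinom q J (n + 1) := by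
  have hn := qFac_self_ne_zero hq (n + 1)
  rw [qFac_succ] at hn
  obtain ⟨h1, h2⟩ := mul_ne_zero_iff.1 hn
  rw [qBinom, qBinom, qBinom, qFac_succ, qFac_succ_left (q ^ J * q / q ^ (n + 1)), qFac_succ q]
  have e1 : q ^ (J + 1) * q / q ^ (n + 1) = q ^ J * q / q ^ n := by
    field_simp; ring
  have e2 : q ^ J * q / q ^ (n + 1) * q = q ^ J * q / q ^ n := by
    field_simp; ring
  rw [e1, e2]
  field_simp
  ring

/-- For n ≤ J the base q^{J-n+1} has norm at most 1, so numerator and inverse denominator are both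
uniformly bounded. -/
theorem exists_norm_qBinom_le {q : ℂ} (hq0 : q ≠ 0) (hq : ‖q‖ < 1) :
    ∃ C : ℝ, 0 < C ∧ ∀ J n, n ≤ J → ‖qBinom q J n‖ ≤ C := by
  obtain ⟨C, hC0, hC⟩ := exists_norm_qFac_self_inv_le hq
  refine ⟨Real.exp (1 / (1 - ‖q‖)) * C, by positivity, fun J n h => ?_⟩
  rw [qBinom, div_eq_mul_inv, norm_mul]
  gcongr
  · refine (norm_qFac_le hq _ _).trans ?_
    have : 0 < 1 - ‖q‖ := by linarith
    gcongr
    obtain ⟨k, rfl⟩ := Nat.exists_eq_add_of_le h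
    rw [show q ^ (n + k) * q / q ^ n = q ^ (k + 1) by field_simp; ring, norm_pow]
    exact pow_le_one₀ (norm_nonneg q) hq.le
  · exact hC n

/-! ### Finite summations: q-Saalschütz, Sears, and Euler's transformation. -/

/-- The `q`-Pfaff–Saalschütz sum, written as a convolution. -/
theorem qSaalschuetz {q : ℂ} (hq0 : q ≠ 0) (hq : ‖q‖ < 1) (X Y g : ℂ)
    (hd : ∀ k : ℕ, X * Y * g * q ^ k ≠ 1) (n : ℕ) :
    ∑ p ∈ Finset.HasAntidiagonal.antidiagonal n, qFac X q p.1 * qFac Y q p.1 * g ^ p.1 * qFac g q p.2 /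
      (qFac q q p.1 * qFac (X * Y * g) q p.1 * qFac q q p.2) =
    qFac (X * g) q n * qFac (Y * g) q n / (qFac q q n * qFac (X * Y * g) q n) := by
  set d := X * Y * g with hdd
  set u : ℕ → ℂ := fun j => qFac X q j * qFac Y q j * g ^ j / (qFac q q j * qFac d q j) with hu
  set v : ℕ → ℂ := fun j => qFac g q j / qFac q q j with hv
  have hq1 : ∀ k : ℕ, 1 - q ^ (k + 1) ≠ 0 := fun k => by
    rw [pow_succ']; exact sub_ne_zero.2 (mul_pow_ne_one hq hq k).symm
  have hd1 : ∀ k : ℕ, 1 - d * q ^ k ≠ 0 := fun k => sub_ne_zero.2 (hd k).symm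
  have hus : ∀ j, u (j + 1) * ((1 - q ^ (j + 1)) * (1 - d * q ^ j))
      = u j * (g * (1 - X * q ^ j) * (1 - Y * q ^ j)) := by
    intro j
    have h1 := qFac_self_ne_zero hq j
    have h2 := qFac_ne_zero hd j
    have h3 := hd1 j
    have h4 := hq1 j
    simp only [hu]
    rw [qFac_succ, qFac_succ, qFac_succ, qFac_succ, ← pow_succ', div_mul_eq_mul_div,
      div_mul_eq_mul_div, div_eq_div_iff (mul_ne_zero (mul_ne_zero h1 h4) (mul_ne_zero h2 h3))
      (mul_ne_zero h1 h2)]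
    ring
  have hvs : ∀ j, v (j + 1) * (1 - q ^ (j + 1)) = v j * (1 - g * q ^ j) := by
    intro j
    have h1 := qFac_self_ne_zero hq j
    have h4 := hq1 j
    simp only [hv]
    rw [qFac_succ, qFac_succ, ← pow_succ']
    field_simp
  have hsum : ∀ m, ∑ p ∈ Finset.HasAntidiagonal.antidiagonal m, qFac X q p.1 * qFac Y q p.1 * g ^ p.1 *
      qFac g q p.2 / (qFac q q p.1 * qFac d q p.1 * qFac q q p.2)
      = ∑ j ∈ Finset.range (m + 1), u j * v (m - j) := by
    intro m
    rw [Finset.Nat.sum_antidiagonal_eq_sum_range_succ (fun i j => qFac X q i * qFac Y q i * g ^ i *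
      qFac g q j / (qFac q q i * qFac d q i * qFac q q j))]
    refine Finset.sum_congr rfl fun j _ => ?_
    simp only [hu, hv]
    rw [div_mul_div_comm]
  rw [hsum]
  induction n with
  | zero => simp [hu, hv]
  | succ n ih =>
    -- Creative telescoping: the summand satisfies the first-order recurrence in n of the closed
    -- form, up to the difference of an explicit certificate. The right side is that certificate; it
    -- vanishes at m = 0 through the factor 1 - q^m.
    have tele : ∀ m, m ≤ n + 1 → ∑ j ∈ Finset.range m,
        ((1 - q ^ (n + 1)) * (1 - d * q ^ n) * (u j * v (n + 1 - j))
          - (1 - Y * g * q ^ n) * (1 - X * g * q ^ n) * (u j * v (n - j)))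
        = -(q ^ (n + 1) / q ^ m) * (1 - q ^ m) * (1 - d * q ^ m / q) * u m * v (n + 1 - m) := by
      intro m
      induction m with
      | zero => intro _; simp
      | succ m ihm =>
        intro hm
        rw [Finset.sum_range_succ, ihm (by omega)]
        obtain ⟨l, rfl⟩ := Nat.exists_eq_add_of_le (show m ≤ n by omega)
        rw [show m + l + 1 - m = l + 1 by omega, show m + l - m = l by omega,
          show m + l + 1 - (m + 1) = l by omega]
        have h1 := hvs l
        have h2 := hus m
        have h3 : v (l + 1) = v l * (1 - g * q ^ l) / (1 - q ^ (l + 1)) := by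
          rw [eq_div_iff (hq1 l), h1]
        have h4 : u (m + 1) = u m * (g * (1 - X * q ^ m) * (1 - Y * q ^ m)) /
            ((1 - q ^ (m + 1)) * (1 - d * q ^ m)) := by
          rw [eq_div_iff (mul_ne_zero (hq1 m) (hd1 m)), h2]
        have h5 := hq1 l
        have h6 := hq1 m
        have h7 := hd1 m
        have h8 : q ^ m ≠ 0 := pow_ne_zero _ hq0
        rw [h3, h4]
        have e : 1 - d * q ^ (m + 1) / q = 1 - d * q ^ m := by field_simp; ring
        rw [e]
        clear_value u v
        clear h1 h2 h3 h4 e ihm hm ih hus hvs hsum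
        generalize hP : 1 - d * q ^ m = P at *
        rw [pow_add q (m + l) 1, pow_add q m l, pow_add q m 1, pow_add q l 1, pow_one] at *
        field_simp
        rw [hdd]
        ring
    -- At m = n + 1 the certificate is exactly minus the extra term j = n + 1 of the longer sum, so
    -- the two cancel and a pure recurrence remains.
    have ht := tele (n + 1) le_rfl
    rw [Finset.sum_sub_distrib, ← Finset.mul_sum, ← Finset.mul_sum, ih] at ht
    rw [Finset.sum_range_succ]
    have e : 1 - d * q ^ (n + 1) / q = 1 - d * q ^ n := by field_simp; ring
    rw [e, div_self (pow_ne_zero _ hq0), Nat.sub_self] at ht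
    have h1 := qFac_self_ne_zero hq n
    have h2 := qFac_ne_zero hd n
    have h3 := hd1 n
    have h4 := hq1 n
    rw [← mul_right_inj' (mul_ne_zero h4 h3), mul_add, Nat.sub_self]
    rw [sub_eq_iff_eq_add] at ht
    rw [ht, qFac_succ, qFac_succ, qFac_succ, qFac_succ, ← pow_succ']
    field_simp
    ring

/-- Reversal of a finite shifted factorial. -/
theorem qFac_reverse {q : ℂ} (hq0 : q ≠ 0) {E g : ℂ} (i s : ℕ) (h : g * E * q ^ (i + s) = q) :
    qFac g q (s + i) * ((-1) ^ i * E ^ i * q ^ i.choose 2) = qFac g q s * qFac E q i := by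
  rw [qFac_add, mul_assoc]
  congr 1
  -- The condition says that the factors 1 - G q^j, in reverse order, are 1 - 1/(E q^{j'}) with j' =
  -- 0, …, i - 1; pulling out -1/(E q^{j'}) from each gives (E;q)_i.
  have key : ∀ (i : ℕ) (G : ℂ), G * E * q ^ i = q →
      qFac G q i * ((-1) ^ i * E ^ i * q ^ i.choose 2) = qFac E q i := by
    intro i
    induction i with
    | zero => intro G _; simp
    | succ i ih =>
      intro G hG
      have := ih (G * q) (by linear_combination hG)
      rw [qFac_succ_left, qFac_succ, ← this, Nat.choose_succ_succ' i 1, Nat.choose_one_right]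
      have h2 : G * E * q ^ i = 1 := by
        apply mul_right_cancel₀ hq0
        rw [one_mul, mul_assoc, ← pow_succ, hG]
      rw [pow_succ (-1 : ℂ), pow_succ E, pow_add]
      linear_combination (qFac (G * q) q i * (-1) ^ i * E ^ i * q ^ i.choose 2) * h2
  exact key i _ (by linear_combination h)


theorem sum_antidiagonal_triple {M : Type*} [AddCommMonoid M] (n : ℕ) (F : ℕ → ℕ → ℕ → M) :
    ∑ p ∈ Finset.HasAntidiagonal.antidiagonal n, ∑ r ∈ Finset.HasAntidiagonal.antidiagonal p.1, F r.1 r.2 p.2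
    = ∑ p ∈ Finset.HasAntidiagonal.antidiagonal n, ∑ r ∈ Finset.HasAntidiagonal.antidiagonal p.2, F p.1 r.1 r.2 := by
  rw [Finset.sum_sigma', Finset.sum_sigma']
  refine Finset.sum_nbij' (fun x => ⟨(x.2.1, x.2.2 + x.1.2), (x.2.2, x.1.2)⟩)
    (fun x => ⟨(x.1.1 + x.2.1, x.2.2), (x.1.1, x.2.1)⟩) ?_ ?_ ?_ ?_ ?_
  · rintro ⟨⟨i, j⟩, ⟨k, l⟩⟩ h
    simp only [Finset.mem_sigma, Finset.HasAntidiagonal.mem_antidiagonal] at h ⊢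
    obtain ⟨h1, h2⟩ := h
    exact ⟨by omega, trivial⟩
  · rintro ⟨⟨i, j⟩, ⟨k, l⟩⟩ h
    simp only [Finset.mem_sigma, Finset.HasAntidiagonal.mem_antidiagonal] at h ⊢
    obtain ⟨h1, h2⟩ := h
    exact ⟨by omega, trivial⟩
  · rintro ⟨⟨i, j⟩, ⟨k, l⟩⟩ h
    simp only [Finset.mem_sigma, Finset.HasAntidiagonal.mem_antidiagonal] at h ⊢
    obtain ⟨_, rfl⟩ := h
    rfl
  · rintro ⟨⟨i, j⟩, ⟨k, l⟩⟩ h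
    simp only [Finset.mem_sigma, Finset.HasAntidiagonal.mem_antidiagonal] at h ⊢
    obtain ⟨_, rfl⟩ := h
    rfl
  · rintro ⟨⟨i, j⟩, ⟨k, l⟩⟩ h
    rfl

theorem qFac_self_mul_qExpCoeff {q : ℂ} (hq : ‖q‖ < 1) (m : ℕ) :
    qFac q q m * qExpCoeff q m = (-1) ^ m * q ^ m.choose 2 := by
  rw [qExpCoeff, mul_div_cancel₀ _ (qFac_self_ne_zero hq m)]

theorem choose_two_add (k i : ℕ) : (k + i).choose 2 = k.choose 2 + i.choose 2 + k * i := by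
  induction i with
  | zero => simp
  | succ i ih =>
    rw [← add_assoc, Nat.choose_succ_succ' (k + i) 1, Nat.choose_succ_succ' i 1, ih,
      Nat.choose_one_right, Nat.choose_one_right]
    ring

/-- A terminating case of Sears' transformation. -/
theorem qSears {q : ℂ} (hq0 : q ≠ 0) (hq : ‖q‖ < 1) {α β b : ℂ} (hα : α ≠ 0) (hb : b ≠ 0)
    (h1 : ∀ k : ℕ, β * b * q ^ k ≠ 1) (h2 : ∀ k : ℕ, q * α / b * q ^ k ≠ 1)
    (h3 : ∀ k : ℕ, α * β * q ^ k ≠ 1) (n : ℕ) :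
    ∑ p ∈ Finset.HasAntidiagonal.antidiagonal n, qExpCoeff q p.1 * (q / q ^ n) ^ p.1 / qFac q q p.2 *
      (qFac (α * β * q ^ p.1) q n * (qFac α q p.1 * qFac β q p.1) /
        (qFac (β * b) q p.1 * qFac (q * α / b) q p.1)) =
    ∑ p ∈ Finset.HasAntidiagonal.antidiagonal n,
      (qFac α q p.1 * qFac b q p.1 / (qFac q q p.1 * qFac (β * b) q p.1) * β ^ p.1) *
      (qFac β q p.2 * qFac (q / b) q p.2 / (qFac q q p.2 * qFac (q * α / b) q p.2) * α ^ p.2) := by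
  set D := α * β with hD
  set E₀ := q * α / b with hE₀
  have hqn : ∀ n : ℕ, q ^ n ≠ 0 := fun n => pow_ne_zero n hq0
  have hE₀0 : E₀ ≠ 0 := div_ne_zero (mul_ne_zero hq0 hα) hb
  -- X and g are chosen so that Xg = β, bg = Dq^n and Xbg = βb. Then (β, Dq^n;q)_r / (q, βb;q)_r is
  -- the closed side of `qSaalschuetz`, and replacing it by the convolution introduces a second
  -- summation.
  set X := b / (q ^ n * α) with hX
  set g := D * q ^ n / b with hg
  have hXg : X * g = β := by
    rw [hX, hg, hD]; field_simp [hqn n]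
  have hbg : b * g = D * q ^ n := by rw [hg]; field_simp
  have hXbg : X * b * g = β * b := by rw [mul_right_comm, hXg]
  -- expand the pair `(β, D q^n)`
  have qFac_pair : ∀ r, qFac β q r * qFac (D * q ^ n) q r / (qFac q q r * qFac (β * b) q r)
      = ∑ p ∈ Finset.HasAntidiagonal.antidiagonal r, qFac X q p.1 * qFac b q p.1 * g ^ p.1 *
        qFac g q p.2 / (qFac q q p.1 * qFac (β * b) q p.1 * qFac q q p.2) := by
    intro r
    have := qSaalschuetz hq0 hq X b g (by rw [hXbg]; exact h1) r
    rw [hXg, hbg, hXbg] at this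
    exact this.symm
  have hDr : ∀ r, qFac (D * q ^ r) q n = qFac D q n * qFac (D * q ^ n) q r / qFac D q r := by
    intro r
    rw [eq_div_iff (qFac_ne_zero h3 r), mul_comm, ← qFac_add, ← qFac_add, add_comm]
  set W : ℕ → ℕ → ℕ → ℂ := fun k i s =>
    ((-1) ^ (k + i) * q ^ (k + i).choose 2 * (q / q ^ n) ^ (k + i) / qFac q q s) *
      (qFac D q n * qFac α q (k + i) / (qFac D q (k + i) * qFac E₀ q (k + i))) *
      (qFac X q k * qFac b q k * g ^ k * qFac g q i /
        (qFac q q k * qFac (β * b) q k * qFac q q i)) with hW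
  have expand_pair : ∑ p ∈ Finset.HasAntidiagonal.antidiagonal n,
      qExpCoeff q p.1 * (q / q ^ n) ^ p.1 / qFac q q p.2 *
      (qFac (D * q ^ p.1) q n * (qFac α q p.1 * qFac β q p.1) /
        (qFac (β * b) q p.1 * qFac E₀ q p.1)) =
      ∑ p ∈ Finset.HasAntidiagonal.antidiagonal n,
        ∑ r ∈ Finset.HasAntidiagonal.antidiagonal p.1, W r.1 r.2 p.2 := by
    refine Finset.sum_congr rfl fun p _ => ?_
    have e : ∀ r ∈ Finset.HasAntidiagonal.antidiagonal p.1, W r.1 r.2 p.2 =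
        ((-1) ^ p.1 * q ^ p.1.choose 2 * (q / q ^ n) ^ p.1 / qFac q q p.2) *
        (qFac D q n * qFac α q p.1 / (qFac D q p.1 * qFac E₀ q p.1)) *
        (qFac X q r.1 * qFac b q r.1 * g ^ r.1 *
        qFac g q r.2 / (qFac q q r.1 * qFac (β * b) q r.1 * qFac q q r.2)) := by
      intro r hr
      rw [← Finset.HasAntidiagonal.mem_antidiagonal.1 hr]
    rw [Finset.sum_congr rfl e, ← Finset.mul_sum, ← qFac_pair, hDr,
      ← qFac_self_mul_qExpCoeff hq]
    have := qFac_self_ne_zero hq p.1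
    field_simp
  -- The order of summation is exchanged: k is now the outer index, matched with the index of the
  -- first series on the right, and the inner sum over (i, s) must produce the term of index N = n -
  -- k of the second.
  rw [expand_pair, sum_antidiagonal_triple n W]
  refine Finset.sum_congr rfl fun p hp => ?_
  obtain ⟨k, N⟩ := p
  obtain rfl : k + N = n := Finset.HasAntidiagonal.mem_antidiagonal.1 hp
  simp only
  set E := E₀ * q ^ k with hE
  have hE0 : E ≠ 0 := mul_ne_zero hE₀0 (hqn k)
  have hEk : ∀ j : ℕ, E * q ^ j ≠ 1 := fun j => by
    rw [hE, mul_assoc, ← pow_add]; exact h2 _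
  have hDk : ∀ j : ℕ, D * q ^ k * q ^ j ≠ 1 := fun j => by
    rw [mul_assoc, ← pow_add]; exact h3 _
  have hXE : X * E * q ^ N = q := by
    rw [hX, hE, hE₀, pow_add]; field_simp [hqn k, hqn N]
  -- reversal of `(E;q)_i`
  have hXN : qFac X q N ≠ 0 := by
    intro h0
    have := qFac_reverse hq0 N 0 (g := X) (E := E) (by simpa using hXE)
    simp only [zero_add, h0, zero_mul, qFac_zero, one_mul] at this
    exact qFac_ne_zero hEk N this.symm
  -- Since X E q^N = q, reversal moves (E;q)_i from the denominator into (X;q)_{N-i} in the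
  -- numerator, which gives the inner sum the shape of a Saalschütz convolution.
  have hrev : ∀ r ∈ Finset.HasAntidiagonal.antidiagonal N,
      (-1) ^ r.1 * q ^ r.1.choose 2 * (q / q ^ N) ^ r.1 / qFac E q r.1
        = X ^ r.1 * qFac X q r.2 / qFac X q N := by
    intro r hr
    have hrN := Finset.HasAntidiagonal.mem_antidiagonal.1 hr
    have h := qFac_reverse hq0 r.1 r.2 (g := X) (E := E) (by rw [hrN]; exact hXE)
    rw [add_comm r.2, hrN] at h
    rw [div_eq_div_iff (qFac_ne_zero hEk _) hXN]
    have hx : q / q ^ N = X * E := by rw [div_eq_iff (hqn N), hXE]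
    rw [hx, mul_pow]
    linear_combination X ^ r.1 * h
  have hC : ∀ r ∈ Finset.HasAntidiagonal.antidiagonal N, W k r.1 r.2 =
      ((-1) ^ k * q ^ k.choose 2 * (q / q ^ (k + N)) ^ k * qFac D q (k + N) * qFac α q k *
        (qFac X q k * qFac b q k * g ^ k) /
        (qFac D q k * qFac E₀ q k * (qFac q q k * qFac (β * b) q k) * qFac X q N)) *
      (qFac (α * q ^ k) q r.1 * qFac g q r.1 * X ^ r.1 * qFac X q r.2 /
        (qFac q q r.1 * qFac (D * q ^ k) q r.1 * qFac q q r.2)) := by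
    intro r hr
    have h := hrev r hr
    rw [hW]
    simp only
    rw [choose_two_add, qFac_add α q k r.1, qFac_add D q k r.1, qFac_add E₀ q k r.1, ← hE]
    have e : ((-1 : ℂ) ^ (k + r.1) * q ^ (k.choose 2 + r.1.choose 2 + k * r.1) *
        (q / q ^ (k + N)) ^ (k + r.1)) = ((-1) ^ k * q ^ k.choose 2 * (q / q ^ (k + N)) ^ k) *
        ((-1) ^ r.1 * q ^ r.1.choose 2 * (q / q ^ N) ^ r.1) := by
      have : q / q ^ (k + N) * q ^ k = q / q ^ N := by
        rw [pow_add]; field_simp [hqn k, hqn N]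
      rw [← this, mul_pow, pow_add, pow_add, pow_add, pow_add, pow_mul]
      ring
    rw [e]
    calc _ = ((-1) ^ k * q ^ k.choose 2 * (q / q ^ (k + N)) ^ k * qFac D q (k + N) * qFac α q k *
        (qFac X q k * qFac b q k * g ^ k) /
        (qFac D q k * qFac E₀ q k * (qFac q q k * qFac (β * b) q k))) *
        ((-1) ^ r.1 * q ^ r.1.choose 2 * (q / q ^ N) ^ r.1 / qFac E q r.1) *
        (qFac (α * q ^ k) q r.1 * qFac g q r.1 * (qFac q q r.2)⁻¹ /
        (qFac q q r.1 * qFac (D * q ^ k) q r.1)) := by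
          generalize (q / q ^ N) = z1
          generalize (q / q ^ (k + N)) = z2
          simp only [div_eq_mul_inv, mul_inv]
          ring
      _ = _ := by
          rw [h]
          simp only [div_eq_mul_inv, mul_inv]
          ring
  rw [Finset.sum_congr rfl hC, ← Finset.mul_sum]
  have hgX : g * X = β := by rw [mul_comm, hXg]
  -- Second use of the Saalschütz sum, now with X in the role of the convolution parameter.
  have hsum := qSaalschuetz hq0 hq (α * q ^ k) g X (by
    rw [mul_assoc (α * q ^ k), hgX, mul_right_comm, ← hD]; exact hDk) N
  have e1 : α * q ^ k * g * X = D * q ^ k := by rw [mul_assoc (α * q ^ k), hgX, hD]; ring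
  rw [e1, hgX] at hsum
  rw [hsum]
  have e2 : α * q ^ k * X = b / q ^ N := by
    rw [hX, pow_add]; field_simp [hqn k, hqn N]
  rw [e2]
  -- Three reversals remove the bases X and b/q^N, which involve negative powers of q. They produce
  -- (q/b;q)_N α^N, β^k, and (E₀;q)_N in the denominator.
  have r1 := qFac_reverse hq0 N 0 (g := X) (E := E) (by simpa using hXE)
  have r2 := qFac_reverse hq0 N 0 (g := b / q ^ N) (E := q / b)
    (by rw [add_zero]; field_simp [hqn N])
  have r3 := qFac_reverse hq0 k 0 (g := X) (E := E₀ * q ^ N)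
    (by have h := hXE; rw [hE] at h; rw [add_zero]; linear_combination h)
  simp only [zero_add, qFac_zero, one_mul] at r1 r2 r3
  have hEα : E = q / b * (α * q ^ k) := by rw [hE, hE₀]; ring
  have f1 : qFac (b / q ^ N) q N / qFac X q N = qFac (q / b) q N * (α * q ^ k) ^ N / qFac E q N := by
    rw [div_eq_div_iff hXN (qFac_ne_zero hEk N), ← r1, ← r2, hEα, mul_pow]
    ring
  have f2 : (-1) ^ k * q ^ k.choose 2 * (q / q ^ (k + N)) ^ k * qFac X q k * g ^ k * (q ^ N) ^ k
      = β ^ k * qFac (E₀ * q ^ N) q k := by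
    have : q / q ^ (k + N) * g * q ^ N = β * (E₀ * q ^ N) := by
      rw [hg, hE₀, hD, pow_add]; field_simp [hqn k, hqn N]
    rw [← r3]
    calc _ = (q / q ^ (k + N) * g * q ^ N) ^ k * ((-1) ^ k * q ^ k.choose 2 * qFac X q k) := by
          rw [mul_pow, mul_pow]; ring
      _ = _ := by rw [this, mul_pow]; ring
  have f3 : qFac (E₀ * q ^ N) q k / (qFac E₀ q k * qFac E q N) = 1 / qFac E₀ q N := by
    rw [div_eq_div_iff (mul_ne_zero (qFac_ne_zero h2 k) (qFac_ne_zero hEk N)) (qFac_ne_zero h2 N),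
      one_mul, ← qFac_add, mul_comm, ← qFac_add, add_comm]
  have hd1 := qFac_ne_zero h3 k
  have hd2 := qFac_ne_zero hDk N
  have hqk : (q ^ N) ^ k ≠ 0 := pow_ne_zero _ (hqn N)
  rw [qFac_add D]
  calc _ = ((-1) ^ k * q ^ k.choose 2 * (q / q ^ (k + N)) ^ k * qFac X q k * g ^ k)
        * (qFac (b / q ^ N) q N / qFac X q N)
        * (qFac D q k / qFac D q k * (qFac (D * q ^ k) q N / qFac (D * q ^ k) q N))
        * (qFac α q k * qFac b q k / (qFac q q k * qFac (β * b) q k))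
        * (qFac β q N / qFac q q N) / qFac E₀ q k := by
          generalize (q / q ^ (k + N)) = z2
          simp only [div_eq_mul_inv, mul_inv]
          ring
    _ = ((-1) ^ k * q ^ k.choose 2 * (q / q ^ (k + N)) ^ k * qFac X q k * g ^ k * (q ^ N) ^ k)
        * (qFac (q / b) q N * α ^ N)
        * (qFac α q k * qFac b q k / (qFac q q k * qFac (β * b) q k))
        * (qFac β q N / qFac q q N) / (qFac E₀ q k * qFac E q N) := by
          rw [f1, div_self hd1, div_self hd2, mul_pow, ← pow_mul q k N, ← pow_mul q N k,
            mul_comm k N]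
          generalize (q / q ^ (k + N)) = z2
          simp only [div_eq_mul_inv, mul_inv]
          ring
    _ = β ^ k * (qFac (q / b) q N * α ^ N)
        * (qFac α q k * qFac b q k / (qFac q q k * qFac (β * b) q k))
        * (qFac β q N / qFac q q N) *
        (qFac (E₀ * q ^ N) q k / (qFac E₀ q k * qFac E q N)) := by
          rw [f2]; ring
    _ = _ := by
          rw [f3]
          simp only [div_eq_mul_inv, mul_inv]
          ring

/-- Euler's transformation of a `₂φ₁` series. -/
theorem qEuler_transformation {q : ℂ} (hq0 : q ≠ 0) (hq : ‖q‖ < 1) (X Y g : ℂ) {z : ℂ}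
    (hz : ‖z‖ < 1) (hgz : ‖g * z‖ < 1) (hd : ∀ k : ℕ, X * Y * g * q ^ k ≠ 1) :
    qHyp [X * g, Y * g] [X * Y * g] q z =
      qInf (g * z) q / qInf z q * qHyp [X, Y] [X * Y * g] q (g * z) := by
  have h1 := hasSum_qBinomial hq g hz
  have hs1 : Summable fun k => ‖qFac g q k / qFac q q k * z ^ k‖ := h1.summable.norm
  have hs2 : Summable fun k => ‖qHypTerm [X, Y] [X * Y * g] q (g * z) k‖ :=
    (qHypTerm_summable [X, Y] [X * Y * g] q (g * z) rfl hq hgz).norm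
  rw [mul_comm (qInf (g * z) q / _), ← h1.tsum_eq, qHyp, qHyp,
    tsum_mul_tsum_eq_tsum_sum_antidiagonal_of_summable_norm hs2 hs1]
  refine tsum_congr fun n => ?_
  -- The coefficient of z^n in the Cauchy product of the ₂φ₁ with the q-binomial series is exactly
  -- the Saalschütz convolution.
  have hS := qSaalschuetz hq0 hq X Y g hd n
  have e : ∀ p ∈ Finset.HasAntidiagonal.antidiagonal n,
      qHypTerm [X, Y] [X * Y * g] q (g * z) p.1 * (qFac g q p.2 / qFac q q p.2 * z ^ p.2)
      = qFac X q p.1 * qFac Y q p.1 * g ^ p.1 * qFac g q p.2 /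
      (qFac q q p.1 * qFac (X * Y * g) q p.1 * qFac q q p.2) * z ^ n := by
    intro p hp
    rw [← Finset.HasAntidiagonal.mem_antidiagonal.1 hp]
    simp [qHypTerm, qFacs]
    ring
  rw [Finset.sum_congr rfl e, ← Finset.sum_mul, hS]
  simp [qHypTerm, qFacs]

/-- Cauchy product with the common factor w pulled out of both arguments, so that coefficients of
w^n can be compared with the moment expansion. -/
theorem hasSum_qHyp_mul {q : ℂ} (hq : ‖q‖ < 1) {a₁ a₂ c₁ b₁ b₂ d₁ x y : ℂ}
    {w : ℂ} (hx : ‖x * w‖ < 1) (hy : ‖y * w‖ < 1) :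
    HasSum (fun n => w ^ n * ∑ p ∈ Finset.HasAntidiagonal.antidiagonal n,
      (qFac a₁ q p.1 * qFac a₂ q p.1 / (qFac q q p.1 * qFac c₁ q p.1) * x ^ p.1) *
      (qFac b₁ q p.2 * qFac b₂ q p.2 / (qFac q q p.2 * qFac d₁ q p.2) * y ^ p.2))
      (qHyp [a₁, a₂] [c₁] q (x * w) * qHyp [b₁, b₂] [d₁] q (y * w)) := by
  have hs1 := (qHypTerm_summable [a₁, a₂] [c₁] q (x * w) rfl hq hx).norm
  have hs2 := (qHypTerm_summable [b₁, b₂] [d₁] q (y * w) rfl hq hy).norm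
  rw [qHyp, qHyp, tsum_mul_tsum_eq_tsum_sum_antidiagonal_of_summable_norm hs1 hs2]
  refine HasSum.congr_fun (summable_norm_sum_mul_antidiagonal_of_summable_norm hs1 hs2).of_norm.hasSum
    fun n => ?_
  rw [Finset.mul_sum]
  refine Finset.sum_congr rfl fun p hp => ?_
  rw [← Finset.HasAntidiagonal.mem_antidiagonal.1 hp]
  simp [qHypTerm, qFacs]
  ring


/-! ### Residues in an annulus. -/

open Filter Topology in
-- After its principal part is removed, F agrees near p with the divided difference `dslope g p`,
-- which is holomorphic.
theorem differentiableAt_ite_sub_div {F g : ℂ → ℂ} {p : ℂ}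
    (hg : ∀ᶠ t in 𝓝 p, DifferentiableAt ℂ g t) (hF : ∀ᶠ t in 𝓝[≠] p, F t = g t / (t - p)) :
    DifferentiableAt ℂ (fun t => if t = p then deriv g p else F t - g p / (t - p)) p := by
  obtain ⟨s, hs, hso, hps⟩ := eventually_nhds_iff.1 hg
  have h1 : DifferentiableAt ℂ (dslope g p) p := by
    refine DifferentiableOn.differentiableAt (s := s) ?_ (hso.mem_nhds hps)
    rw [Complex.differentiableOn_dslope (hso.mem_nhds hps)]
    exact fun t ht => (hs t ht).differentiableWithinAt
  refine h1.congr_of_eventuallyEq ?_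
  rw [eventually_nhdsWithin_iff] at hF
  filter_upwards [hF] with t ht
  by_cases htp : t = p
  · simp [htp]
  · simp only [htp, if_false]
    rw [dslope_of_ne _ htp, slope_def_field, ht htp]
    ring

open Filter Topology Real in
/-- The residue theorem for an annulus and finitely many simple poles. -/
theorem circleIntegral_sub_eq_sum_residues {r R : ℝ} (hr : 0 < r) (hrR : r ≤ R) (P : Finset ℂ)
    (res : ℂ → ℂ) (F : ℂ → ℂ) (hP : ∀ p ∈ P, r < ‖p‖ ∧ ‖p‖ < R)
    (hF : ∀ t, r ≤ ‖t‖ → ‖t‖ ≤ R → t ∉ P → DifferentiableAt ℂ F t)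
    (hres : ∀ p ∈ P, ∃ g : ℂ → ℂ, (∀ᶠ t in 𝓝 p, DifferentiableAt ℂ g t) ∧ g p = res p ∧
      ∀ᶠ t in 𝓝[≠] p, F t = g t / (t - p)) :
    (∮ t in C(0, R), F t) - (∮ t in C(0, r), F t) = 2 * π * Complex.I * ∑ p ∈ P, res p := by
  induction P using Finset.induction_on generalizing F with
  | empty =>
    rw [Finset.sum_empty, mul_zero, sub_eq_zero]
    refine Complex.circleIntegral_eq_of_differentiable_on_annulus_off_countable hr hrR
      Set.countable_empty (fun t ht => ?_) fun t ht => ?_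
    · refine (hF t ?_ ?_ (by simp)).continuousAt.continuousWithinAt
      · simpa using ht.2
      · simpa using ht.1
    · refine hF t ?_ ?_ (by simp)
      · simpa using (show r ≤ ‖t‖ by simpa using (not_le.1 (by simpa using ht.1.2)).le)
      · simpa using (mem_ball_zero_iff.1 ht.1.1).le
  | insert p P hpP ih =>
    obtain ⟨g, hg, hgp, hFg⟩ := hres p (Finset.mem_insert_self p P)
    obtain ⟨hp1, hp2⟩ := hP p (Finset.mem_insert_self p P)
    -- Induction on the number of poles: the principal part at p is subtracted, and the value `deriv
    -- g p` fills the removable singularity.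
    set F' : ℂ → ℂ := fun t => if t = p then deriv g p else F t - g p / (t - p) with hF'
    have hF'eq : ∀ t, t ≠ p → F' t = F t - g p / (t - p) := fun t ht => by simp [hF', ht]
    have hev : ∀ t, t ≠ p → F' =ᶠ[𝓝 t] fun t => F t - g p / (t - p) := fun t ht =>
      (eventually_ne_nhds ht).mono fun s hs => hF'eq s hs
    have h1 := ih F' (fun p' hp' => hP p' (Finset.mem_insert_of_mem hp')) (by
      intro t ht1 ht2 htP
      by_cases htp : t = p
      · rw [htp]; exact differentiableAt_ite_sub_div hg hFg
      · refine DifferentiableAt.congr_of_eventuallyEq ?_ (hev t htp)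
        have := hF t ht1 ht2 (by simp [htp, htP])
        have h0 : t - p ≠ 0 := sub_ne_zero.2 htp
        fun_prop (disch := assumption)) (by
      intro p' hp'
      obtain ⟨g', hg', hgp', hFg'⟩ := hres p' (Finset.mem_insert_of_mem hp')
      have hne : p' ≠ p := fun h => hpP (h ▸ hp')
      refine ⟨fun t => g' t - g p * (t - p') / (t - p), ?_, by simp [hgp'], ?_⟩
      · filter_upwards [hg', eventually_ne_nhds hne] with t ht htp
        have h0 : t - p ≠ 0 := sub_ne_zero.2 htp
        fun_prop (disch := assumption)
      · filter_upwards [hFg', eventually_nhdsWithin_of_eventually_nhds (eventually_ne_nhds hne),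
          self_mem_nhdsWithin] with t ht htp htp'
        have h0 : t - p ≠ 0 := sub_ne_zero.2 htp
        have h0' : t - p' ≠ 0 := sub_ne_zero.2 htp'
        rw [hF'eq t htp, ht]
        field_simp)
    have hcirc : ∀ ρ : ℝ, 0 < ρ → r ≤ ρ → ρ ≤ R → (∀ p' ∈ insert p P, ‖p'‖ ≠ ρ) →
        (∮ t in C(0, ρ), F' t) = (∮ t in C(0, ρ), F t) - g p * ∮ t in C(0, ρ), (t - p)⁻¹ := by
      intro ρ hρ h1 h2 h3
      have hne : ∀ t ∈ Metric.sphere (0 : ℂ) ρ, t ≠ p := fun t ht h =>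
        h3 p (Finset.mem_insert_self p P) (by rw [← h]; simpa using ht)
      have hi1 : CircleIntegrable F 0 ρ := by
        refine ContinuousOn.circleIntegrable hρ.le fun t ht => ?_
        have ht' : ‖t‖ = ρ := by simpa using ht
        exact (hF t (by rw [ht']; exact h1) (by rw [ht']; exact h2)
          (fun h => h3 t h ht')).continuousAt.continuousWithinAt
      have hi2 : CircleIntegrable (fun t => g p * (t - p)⁻¹) 0 ρ := by
        refine ContinuousOn.circleIntegrable hρ.le fun t ht => ?_
        have h0 : t - p ≠ 0 := sub_ne_zero.2 (hne t ht)
        have : ContinuousAt (fun t => g p * (t - p)⁻¹) t := by fun_prop (disch := assumption)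
        exact this.continuousWithinAt
      rw [← circleIntegral.integral_const_mul, ← circleIntegral.integral_sub hi1 hi2]
      refine circleIntegral.integral_congr hρ.le fun t ht => ?_
      rw [hF'eq t (hne t ht), div_eq_mul_inv]
    have hRpos : 0 < R := hr.trans_le hrR
    rw [hcirc R hRpos hrR le_rfl fun p' hp' => (hP p' hp').2.ne,
      hcirc r hr le_rfl hrR fun p' hp' => (hP p' hp').1.ne',
      circleIntegral.integral_sub_inv_of_mem_ball (by simpa using hp2)] at h1
    -- The pole p lies outside the inner circle, so the subtracted principal part contributes only
    -- through the outer one.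
    have h2 : (∮ t in C(0, r), (t - p)⁻¹) = 0 := by
      have hd : ∀ t ∈ Metric.closedBall (0 : ℂ) r, DifferentiableAt ℂ (fun t => (t - p)⁻¹) t := by
        intro t ht
        have h0 : t - p ≠ 0 := sub_ne_zero.2 fun h => by
          rw [mem_closedBall_zero_iff, h] at ht; linarith
        fun_prop (disch := assumption)
      exact Complex.circleIntegral_eq_zero_of_differentiable_on_off_countable hr.le
        Set.countable_empty (fun t ht => (hd t ht).continuousAt.continuousWithinAt)
        fun t ht => hd t (Metric.ball_subset_closedBall ht.1)
    rw [h2, hgp] at h1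
    rw [Finset.sum_insert hpP]
    linear_combination h1

/-! ### The theta function and the kernel. -/

theorem qTheta_eq (x q : ℂ) : qTheta x q = qInf x q * qInf (q / x) q := by
  simp [qTheta, qInfs]

theorem qTheta_mul_self {q x : ℂ} (hq0 : q ≠ 0) (hq : ‖q‖ < 1) (hx : x ≠ 0) :
    qTheta (x * q) q * x = -qTheta x q := by
  rw [qTheta_eq, qTheta_eq, qInf_eq_one_sub_mul hq x, qInf_eq_one_sub_mul hq (q / (x * q))]
  have e1 : q / (x * q) * q = q / x := by field_simp
  have e2 : q / (x * q) = 1 / x := by field_simp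
  rw [e1, e2]
  field_simp
  ring

theorem qTheta_mul_pow {q x : ℂ} (hq0 : q ≠ 0) (hq : ‖q‖ < 1) (hx : x ≠ 0) (k : ℕ) :
    qTheta (x * q ^ k) q * ((-1) ^ k * x ^ k * q ^ k.choose 2) = qTheta x q := by
  induction k with
  | zero => simp
  | succ k ih =>
    have h := qTheta_mul_self hq0 hq (mul_ne_zero hx (pow_ne_zero k hq0))
    rw [← ih, Nat.choose_succ_succ' k 1, Nat.choose_one_right, pow_succ q k, pow_add q,
      pow_succ (-1 : ℂ), pow_succ x, ← mul_assoc x]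
    linear_combination (-1 : ℂ) ^ k * x ^ k * q ^ k.choose 2 * (-1) * h

theorem qTheta_ne_zero_iff {q x : ℂ} (hq0 : q ≠ 0) (hq : ‖q‖ < 1) (hx : x ≠ 0) :
    qTheta x q ≠ 0 ↔ ∀ k : ℤ, x ≠ q ^ k := by
  rw [qTheta_eq, mul_ne_zero_iff, qInf_ne_zero_iff hq, qInf_ne_zero_iff hq]
  constructor
  · rintro ⟨h1, h2⟩ k rfl
    obtain ⟨n, rfl | rfl⟩ := k.eq_nat_or_neg
    · cases n with
      | zero => exact h1 0 (by simp)
      | succ n =>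
        refine h2 n ?_
        rw [zpow_natCast]
        field_simp
        ring
    · refine h1 n ?_
      rw [zpow_neg, zpow_natCast]
      field_simp
  · intro h
    refine ⟨fun k hk => h (-k) ?_, fun k hk => h (k + 1) ?_⟩
    · rw [zpow_neg, zpow_natCast]
      field_simp
      exact hk
    · rw [div_mul_eq_mul_div, div_eq_one_iff_eq hx] at hk
      rw [← hk]
      norm_cast
      rw [pow_succ']

/-- The first k factors of (y/q^k;q)_∞ are reversed. This converts the values of infinite products
at the points 1/(x_i q^k) into the k-th terms of a hypergeometric series. -/
theorem qInf_div_pow {q y : ℂ} (hq0 : q ≠ 0) (hq : ‖q‖ < 1) (hy : y ≠ 0) (k : ℕ) :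
    qInf (y / q ^ k) q * ((-1) ^ k * (q / y) ^ k * q ^ k.choose 2)
      = qInf y q * qFac (q / y) q k := by
  have hk := pow_ne_zero k hq0
  have h := qFac_reverse hq0 k 0 (g := y / q ^ k) (E := q / y)
    (by rw [add_zero]; field_simp)
  simp only [zero_add, qFac_zero, one_mul] at h
  rw [qInf_eq_qFac_mul hq (y / q ^ k) k, ← h, div_mul_cancel₀ _ hk]
  ring

theorem differentiableAt_qInf {q : ℂ} (hq : ‖q‖ < 1) {f : ℂ → ℂ} {t : ℂ}
    (hf : DifferentiableAt ℂ f t) : DifferentiableAt ℂ (fun t => qInf (f t) q) t :=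
  (differentiable_qInf hq (f t)).comp t hf

theorem differentiableAt_qTheta {q : ℂ} (hq : ‖q‖ < 1) {f : ℂ → ℂ} {t : ℂ}
    (hf : DifferentiableAt ℂ f t) (h0 : f t ≠ 0) :
    DifferentiableAt ℂ (fun t => qTheta (f t) q) t := by
  simp only [qTheta_eq]
  exact (differentiableAt_qInf hq hf).mul (differentiableAt_qInf hq ((differentiableAt_const q).div hf h0))

/-- The kernel `ϑ(h/t, ht/w;q) / (1/t, w/t;q)_∞`. -/
noncomputable def qKernel (q h w t : ℂ) : ℂ :=
  qTheta (h / t) q * qTheta (h * t / w) q / (qInf (1 / t) q * qInf (w / t) q)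

/-- Replacing t by t/q multiplies the two thetas by -t/h and -ht/(qw), in whose product h cancels;
the two denominators each lose their first factor, 1 - 1/t and 1 - w/t. This relation gives both the
moments of the kernel and the decay of the integrand on large circles. -/
theorem qKernel_shift {q h w t : ℂ} (hq0 : q ≠ 0) (hq : ‖q‖ < 1) (hh : h ≠ 0) (hw : w ≠ 0)
    (ht : t ≠ 0) (ht1 : t ≠ 1) (htw : t ≠ w) :
    (t - 1) * (t - w) * qKernel q h w t = q * w * qKernel q h w (t / q) := by
  have h1 := qTheta_mul_self hq0 hq (div_ne_zero hh ht)
  have h2 := qTheta_mul_self hq0 hq (div_ne_zero (mul_ne_zero hh (div_ne_zero ht hq0)) hw)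
  have e1 : h / (t / q) = h / t * q := by field_simp
  have e2 : h * (t / q) / w * q = h * t / w := by field_simp
  have e3 : 1 / (t / q) = 1 / t * q := by field_simp
  have e4 : w / (t / q) = w / t * q := by field_simp
  rw [e2] at h2
  have h1' : qTheta (h / t) q = -(qTheta (h / t * q) q * (h / t)) := by rw [h1]; ring
  have h2' : qTheta (h * (t / q) / w) q
      = -(qTheta (h * t / w) q * (h * (t / q) / w)) := by rw [h2]; ring
  rw [qKernel, qKernel, e1, e3, e4, qInf_eq_one_sub_mul hq (1 / t), qInf_eq_one_sub_mul hq (w / t),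
    h1', h2']
  have n1 : 1 - 1 / t = (t - 1) / t := by field_simp
  have n2 : 1 - w / t = (t - w) / t := by field_simp
  have n3 := sub_ne_zero.2 ht1
  have n4 := sub_ne_zero.2 htw
  rw [n1, n2, mul_div_assoc', mul_div_assoc']
  generalize qInf (1 / t * q) q = A
  generalize qInf (w / t * q) q = B
  rw [show (t - 1) / t * A * ((t - w) / t * B) = (t - 1) * (t - w) / t ^ 2 * (A * B) by ring,
    ← div_div, ← div_div]
  field_simp


theorem differentiableAt_qKernel {q h w t : ℂ} (hq : ‖q‖ < 1) (hh : h ≠ 0) (hw : w ≠ 0)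
    (ht0 : t ≠ 0) (h1 : qInf (1 / t) q ≠ 0) (h2 : qInf (w / t) q ≠ 0) :
    DifferentiableAt ℂ (fun t => qKernel q h w t) t := by
  unfold qKernel
  have d1 : DifferentiableAt ℂ (fun t => qInf (1 / t) q) t :=
    differentiableAt_qInf hq ((differentiableAt_const _).div differentiableAt_id ht0)
  have d2 : DifferentiableAt ℂ (fun t => qInf (w / t) q) t :=
    differentiableAt_qInf hq ((differentiableAt_const _).div differentiableAt_id ht0)
  have d3 : DifferentiableAt ℂ (fun t => qTheta (h / t) q) t :=
    differentiableAt_qTheta hq ((differentiableAt_const _).div differentiableAt_id ht0)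
      (div_ne_zero hh ht0)
  have d4 : DifferentiableAt ℂ (fun t => qTheta (h * t / w) q) t :=
    differentiableAt_qTheta hq (by fun_prop) (div_ne_zero (mul_ne_zero hh ht0) hw)
  exact (d3.mul d4).div (d1.mul d2) (mul_ne_zero h1 h2)

theorem qInf_div_ne_zero {q c t : ℂ} (hq : ‖q‖ < 1) (h : ‖c‖ < ‖t‖) : qInf (c / t) q ≠ 0 := by
  refine qInf_ne_zero hq (mul_pow_ne_one ?_ hq)
  rw [norm_div, div_lt_one ((norm_nonneg c).trans_lt h)]
  exact h

theorem differentiableAt_qKernel_of_norm_lt {q h w t : ℂ} (hq : ‖q‖ < 1) (hh : h ≠ 0)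
    (hw : w ≠ 0) (h1 : 1 < ‖t‖) (h2 : ‖w‖ < ‖t‖) :
    DifferentiableAt ℂ (fun t => qKernel q h w t) t := by
  refine differentiableAt_qKernel hq hh hw (fun h0 => ?_) (qInf_div_ne_zero hq (by simpa))
    (qInf_div_ne_zero hq h2)
  simp [h0] at h1
  linarith

/-! ### Moving the contour outwards: six families of residues. -/

/-- The quotient of infinite products `∏ (y_j t;q)_∞ / ∏ (x_i t;q)_∞` times the kernel. -/
noncomputable def qIntegrand (q h w : ℂ) (x : Fin 6 → ℂ) (y : Fin 4 → ℂ) (t : ℂ) : ℂ :=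
  qKernel q h w t * (∏ j, qInf (y j * t) q) / ∏ i, qInf (x i * t) q

/-- The negative residue of `qIntegrand / t` at `t = 1 / (x_i q^k)`. -/
noncomputable def qResidue (q h w : ℂ) (x : Fin 6 → ℂ) (y : Fin 4 → ℂ) (i : Fin 6) (k : ℕ) : ℂ :=
  qKernel q h w (1 / (x i * q ^ k)) * (∏ j, qInf (y j * (1 / (x i * q ^ k))) q) /
    ((∏ l ∈ Finset.univ.erase i, qInf (x l * (1 / (x i * q ^ k))) q) *
      qFac (1 / q ^ k) q k * qInf q q)

theorem qIntegrand_shift {q h w t : ℂ} (hq0 : q ≠ 0) (hq : ‖q‖ < 1) (hh : h ≠ 0) (hw : w ≠ 0)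
    (x : Fin 6 → ℂ) (y : Fin 4 → ℂ) (ht : t ≠ 0) (ht1 : t ≠ 1) (htw : t ≠ w) :
    qIntegrand q h w x y (t / q) = (t - 1) * (t - w) * (∏ j, (1 - y j * t / q)) /
      (q * w * ∏ i, (1 - x i * t / q)) * qIntegrand q h w x y t := by
  have e : ∀ c : ℂ, qInf (c * (t / q)) q = (1 - c * t / q) * qInf (c * t) q := by
    intro c
    rw [qInf_eq_one_sub_mul hq]
    congr 2
    · ring
    · field_simp
  have h1 := qKernel_shift hq0 hq hh hw ht ht1 htw
  have h2 : qKernel q h w (t / q) = (t - 1) * (t - w) * qKernel q h w t / (q * w) := by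
    rw [h1]; field_simp
  simp only [qIntegrand, e, Finset.prod_mul_distrib]
  rw [h2]
  generalize (∏ i, qInf (x i * t) q) = A
  generalize (∏ i, (1 - x i * t / q)) = B
  simp only [div_eq_mul_inv, mul_inv]
  ring

open Filter Topology in
-- Numerator and denominator both have degree 6 in t. The condition ∏ y_j = w ∏ x_i makes the ratio
-- of leading coefficients equal to q.
theorem tendsto_shift_factor {q w : ℂ} (hq0 : q ≠ 0) (hw : w ≠ 0)
    {x : Fin 6 → ℂ} {y : Fin 4 → ℂ} (hx : ∀ i, x i ≠ 0)
    (hxy : ∏ j, y j = w * ∏ i, x i) :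
    Tendsto (fun t : ℂ => (t - 1) * (t - w) * (∏ j, (1 - y j * t / q)) /
      (q * w * ∏ i, (1 - x i * t / q))) (Bornology.cobounded ℂ) (𝓝 q) := by
  have hi : Tendsto (fun t : ℂ => t⁻¹) (Bornology.cobounded ℂ) (𝓝 0) :=
    tendsto_inv₀_cobounded
  have hpx : ∏ i, x i ≠ 0 := Finset.prod_ne_zero_iff.2 fun i _ => hx i
  have hc : Tendsto (fun s : ℂ => (1 - s) * (1 - w * s) * (∏ j, (s - y j / q)) /
      (q * w * ∏ i, (s - x i / q))) (𝓝 0) (𝓝 ((1 - 0) * (1 - w * 0) * (∏ j, (0 - y j / q)) /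
      (q * w * ∏ i, (0 - x i / q)))) := by
    have hne : q * w * ∏ i, (0 - x i / q) ≠ 0 := by
      refine mul_ne_zero (mul_ne_zero hq0 hw) (Finset.prod_ne_zero_iff.2 fun i _ => ?_)
      rw [zero_sub]
      exact neg_ne_zero.2 (div_ne_zero (hx i) hq0)
    have : ContinuousAt (fun s : ℂ => (1 - s) * (1 - w * s) * (∏ j, (s - y j / q)) /
      (q * w * ∏ i, (s - x i / q))) 0 := by
      refine ContinuousAt.div ?_ ?_ hne <;> fun_prop
    exact this.tendsto
  have hv : (1 - 0) * (1 - w * 0) * (∏ j, (0 - y j / q)) / (q * w * ∏ i, (0 - x i / q)) = q := by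
    have e1 : ∏ j, (0 - y j / q) = (∏ j, y j) / q ^ 4 := by
      simp only [Fin.prod_univ_four]; field_simp; ring
    have e2 : ∏ i, (0 - x i / q) = (∏ i, x i) / q ^ 6 := by
      simp only [Fin.prod_univ_six]; field_simp; ring
    rw [e1, e2, hxy]
    field_simp
    ring
  rw [hv] at hc
  refine (hc.comp hi).congr' ?_
  have : ∀ᶠ t : ℂ in Bornology.cobounded ℂ, t ≠ 0 := by
    filter_upwards [tendsto_norm_cobounded_atTop.eventually (eventually_gt_atTop 0)] with t ht
    exact norm_pos_iff.1 ht
  filter_upwards [this] with t ht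
  simp only [Function.comp]
  have f1 : ∏ j, (t⁻¹ - y j / q) = (∏ j, (1 - y j * t / q)) / t ^ 4 := by
    simp only [Fin.prod_univ_four]
    have : ∀ j, t⁻¹ - y j / q = (1 - y j * t / q) / t := fun j => by field_simp
    simp only [this]; ring
  have f2 : ∏ i, (t⁻¹ - x i / q) = (∏ i, (1 - x i * t / q)) / t ^ 6 := by
    simp only [Fin.prod_univ_six]
    have : ∀ j, t⁻¹ - x j / q = (1 - x j * t / q) / t := fun j => by field_simp
    simp only [this]; ring
  rw [f1, f2]
  generalize (∏ j, (1 - y j * t / q)) = A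
  generalize (∏ i, (1 - x i * t / q)) = B
  rw [show 1 - t⁻¹ = (t - 1) / t by field_simp, show 1 - w * t⁻¹ = (t - w) / t by field_simp]
  by_cases hB : B = 0
  · simp [hB]
  · field_simp

open Filter Topology Real in
-- From the circle of radius ρ/|q|^N to the next, the integrand is multiplied by the shift factor,
-- whose norm is eventually below some r < 1. It therefore decays geometrically, while the weight
-- 1/t offsets the growing length of the circles. The hypothesis `hav` keeps the poles off all these
-- circles.
theorem tendsto_circleIntegral_qIntegrand {q h w : ℂ} (hq0 : q ≠ 0) (hq : ‖q‖ < 1) (hh : h ≠ 0)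
    (hw : w ≠ 0) {x : Fin 6 → ℂ} {y : Fin 4 → ℂ} (hx : ∀ i, x i ≠ 0)
    (hxy : ∏ j, y j = w * ∏ i, x i) {ρ : ℝ} (hρ1 : 1 < ρ) (hρw : ‖w‖ < ρ)
    (hav : ∀ i, ∀ k N : ℕ, ρ * ‖x i‖ * ‖q‖ ^ k ≠ ‖q‖ ^ N) :
    Tendsto (fun N : ℕ => ∮ t in C(0, ρ / ‖q‖ ^ N), qIntegrand q h w x y t / t)
      atTop (𝓝 0) := by
  have hρ0 : 0 < ρ := by linarith
  have hqn : 0 < ‖q‖ := norm_pos_iff.2 hq0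
  have hR : ∀ N : ℕ, ρ ≤ ρ / ‖q‖ ^ N := fun N => by
    rw [le_div_iff₀ (by positivity)]
    nlinarith [pow_le_one₀ (n := N) hqn.le hq.le]
  -- The shift factor tends to q, so any r strictly between |q| and 1 bounds it far out.
  obtain ⟨r, hr1, hr2⟩ := exists_between hq
  have hev := ((tendsto_shift_factor hq0 hw hx hxy).norm.eventually (gt_mem_nhds hr1))
  obtain ⟨T, hT⟩ : ∃ T : ℝ, ∀ t : ℂ, T ≤ ‖t‖ → ‖(t - 1) * (t - w) * (∏ j, (1 - y j * t / q)) /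
      (q * w * ∏ i, (1 - x i * t / q))‖ < r := by
    rw [← comap_norm_atTop, eventually_comap, eventually_atTop] at hev
    obtain ⟨T, hT⟩ := hev
    exact ⟨T, fun t ht => hT _ ht t rfl⟩
  obtain ⟨N0, hN0⟩ : ∃ N0 : ℕ, T ≤ ρ / ‖q‖ ^ N0 := by
    have : Tendsto (fun N : ℕ => ρ / ‖q‖ ^ N) atTop atTop := by
      have h1 := tendsto_inv_nhdsGT_zero.comp
        (tendsto_nhdsWithin_iff.2 ⟨tendsto_pow_atTop_nhds_zero_of_lt_one hqn.le hq,
          Eventually.of_forall fun n => Set.mem_Ioi.2 (pow_pos hqn n)⟩)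
      exact h1.const_mul_atTop hρ0
    exact (this.eventually_ge_atTop T).exists
  have hcont : ContinuousOn (qIntegrand q h w x y) (Metric.sphere 0 (ρ / ‖q‖ ^ N0)) := by
    intro t ht
    have ht' : ‖t‖ = ρ / ‖q‖ ^ N0 := by simpa using ht
    have hK := differentiableAt_qKernel_of_norm_lt (h := h) (w := w) (t := t) hq hh hw
      (by rw [ht']; exact hρ1.trans_le (hR N0)) (by rw [ht']; exact hρw.trans_le (hR N0))
    refine ContinuousAt.continuousWithinAt ?_
    refine ContinuousAt.div (hK.continuousAt.mul ?_) ?_ ?_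
    · refine tendsto_finsetProd _ fun j _ => ?_
      exact (differentiableAt_qInf hq (by fun_prop)).continuousAt
    · refine tendsto_finsetProd _ fun j _ => ?_
      exact (differentiableAt_qInf hq (by fun_prop)).continuousAt
    · refine Finset.prod_ne_zero_iff.2 fun i _ => qInf_ne_zero hq fun k hk => hav i k N0 ?_
      have := congrArg norm hk
      rw [norm_mul, norm_mul, norm_pow, norm_one, ht'] at this
      field_simp at this
      linarith
  obtain ⟨B, hB⟩ := (isCompact_sphere (0 : ℂ) (ρ / ‖q‖ ^ N0)).exists_bound_of_continuousOn hcont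
  have hbd : ∀ n : ℕ, ∀ t : ℂ, ‖t‖ = ρ / ‖q‖ ^ (N0 + n) →
      ‖qIntegrand q h w x y t‖ ≤ r ^ n * B := by
    intro n
    induction n with
    | zero => intro t ht; simpa using hB t (by simpa using ht)
    | succ n ih =>
      intro t ht
      have ht2 : ‖t * q‖ = ρ / ‖q‖ ^ (N0 + n) := by
        rw [norm_mul, ht, ← add_assoc, pow_succ]; field_simp
      have ht3 : ρ ≤ ‖t * q‖ := ht2 ▸ hR _
      have h0 : t * q ≠ 0 := norm_pos_iff.1 (by linarith)
      have h1 : t * q ≠ 1 := fun h => by rw [h, norm_one] at ht3; linarith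
      have h2 : t * q ≠ w := fun h => by rw [h] at ht3; linarith
      have hs := qIntegrand_shift hq0 hq hh hw x y h0 h1 h2
      rw [mul_div_cancel_right₀ _ hq0] at hs
      rw [hs, norm_mul, pow_succ', mul_assoc r]
      have hTt : T ≤ ‖t * q‖ := by
        rw [ht2, pow_add]
        refine hN0.trans ?_
        have := pow_le_one₀ (n := n) hqn.le hq.le
        gcongr
        exact mul_le_of_le_one_right (by positivity) this
      exact mul_le_mul (hT _ hTt).le (ih _ ht2) (norm_nonneg _) (hqn.trans hr1).le
  rw [← tendsto_add_atTop_iff_nat N0]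
  refine squeeze_zero_norm (a := fun n => 2 * π * B * r ^ n) (fun n => ?_) ?_
  · have hRp : 0 < ρ / ‖q‖ ^ (n + N0) := by positivity
    refine (circleIntegral.norm_integral_le_of_norm_le_const hRp.le
      (C := r ^ n * B / (ρ / ‖q‖ ^ (n + N0))) fun t ht => ?_).trans (le_of_eq ?_)
    · have ht' : ‖t‖ = ρ / ‖q‖ ^ (n + N0) := by simpa using ht
      rw [norm_div, ht']
      gcongr
      exact hbd n t (by rw [ht', add_comm])
    · field_simp
  · simpa using (tendsto_pow_atTop_nhds_zero_of_lt_one (hqn.trans hr1).le hr2).const_mul (2 * π * B)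

theorem qInf_mul_inv_ne_zero {q : ℂ} (hq0 : q ≠ 0) (hq : ‖q‖ < 1) {x : Fin 6 → ℂ}
    (hx : ∀ i, x i ≠ 0) (hxx : ∀ i l, i ≠ l → ∀ k : ℤ, x i ≠ x l * q ^ k) {i l : Fin 6}
    (hil : l ≠ i) (k : ℕ) : qInf (x l * (1 / (x i * q ^ k))) q ≠ 0 := by
  refine qInf_ne_zero hq fun m hm => hxx i l hil.symm ((m : ℤ) - k) ?_
  have h1 := hx i
  have h2 := pow_ne_zero k hq0
  rw [zpow_sub₀ hq0, zpow_natCast, zpow_natCast]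
  field_simp at hm ⊢
  exact hm.symm

theorem qFac_inv_pow_ne_zero {q : ℂ} (hq0 : q ≠ 0) (hq : ‖q‖ < 1) (k : ℕ) :
    qFac (1 / q ^ k) q k ≠ 0 := by
  refine Finset.prod_ne_zero_iff.2 fun m hm => sub_ne_zero.2 fun h => ?_
  obtain ⟨l, rfl⟩ := Nat.exists_eq_add_of_lt (Finset.mem_range.1 hm)
  have h2 := pow_ne_zero m hq0
  have h3 := pow_ne_zero l hq0
  rw [pow_add, pow_add, pow_one] at h
  field_simp at h
  exact mul_pow_ne_one hq hq l (by rw [mul_comm]; exact h)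

open Filter Topology Real in
-- By `hρx` every pole 1/(x_i q^k) lies outside the circle of radius ρ; by `hxx` these poles are
-- distinct, hence simple. Since the integrals over the growing circles tend to 0, the integral is
-- minus the sum of all residues, and `qResidue` already carries that sign.
theorem circleIntegral_qIntegrand {q h w : ℂ} (hq0 : q ≠ 0) (hq : ‖q‖ < 1) (hh : h ≠ 0)
    (hw : w ≠ 0) {x : Fin 6 → ℂ} {y : Fin 4 → ℂ} (hx : ∀ i, x i ≠ 0)
    (hxx : ∀ i l, i ≠ l → ∀ k : ℤ, x i ≠ x l * q ^ k)
    (hxy : ∏ j, y j = w * ∏ i, x i) {ρ : ℝ} (hρ1 : 1 < ρ) (hρw : ‖w‖ < ρ)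
    (hρx : ∀ i, ρ * ‖x i‖ < 1)
    (hav : ∀ i, ∀ k N : ℕ, ρ * ‖x i‖ * ‖q‖ ^ k ≠ ‖q‖ ^ N)
    (hsum : ∀ i, Summable (qResidue q h w x y i)) :
    (∮ t in C(0, ρ), qIntegrand q h w x y t / t)
      = 2 * π * Complex.I * ∑ i, ∑' k, qResidue q h w x y i k := by
  have hρ0 : 0 < ρ := by linarith
  have hqn : 0 < ‖q‖ := norm_pos_iff.2 hq0
  set p : Fin 6 × ℕ → ℂ := fun a => 1 / (x a.1 * q ^ a.2) with hp
  have hp0 : ∀ a, p a ≠ 0 := fun a =>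
    one_div_ne_zero (mul_ne_zero (hx _) (pow_ne_zero _ hq0))
  have hpn : ∀ a, ‖p a‖ = 1 / (‖x a.1‖ * ‖q‖ ^ a.2) := fun a => by simp [hp]
  have hxn : ∀ i, 0 < ‖x i‖ := fun i => norm_pos_iff.2 (hx i)
  have hpinj : Function.Injective p := by
    rintro ⟨i, k⟩ ⟨l, m⟩ hab
    simp only [hp, one_div, inv_inj] at hab
    have hil : i = l := by
      by_contra hne
      refine hxx i l hne ((m : ℤ) - k) ?_
      rw [zpow_sub₀ hq0, zpow_natCast, zpow_natCast, ← mul_div_assoc,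
        eq_div_iff (pow_ne_zero _ hq0), hab]
    subst hil
    have h2 := congrArg norm (mul_left_cancel₀ (hx i) hab)
    rw [norm_pow, norm_pow] at h2
    rw [pow_right_injective₀ hqn hq.ne h2]
  -- The poles inside the circle of radius ρ/|q|^N. The restriction k < N excludes nothing, since
  -- ρ‖x i‖ < 1; it only makes the set finite.
  set P : ℕ → Finset (Fin 6 × ℕ) := fun N =>
    (Finset.univ ×ˢ Finset.range N).filter fun a => ‖q‖ ^ N < ρ * ‖x a.1‖ * ‖q‖ ^ a.2 with hP
  have hlt : ∀ a N, ‖p a‖ < ρ / ‖q‖ ^ N ↔ ‖q‖ ^ N < ρ * ‖x a.1‖ * ‖q‖ ^ a.2 := by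
    intro a N
    have := hxn a.1
    rw [hpn, div_lt_div_iff₀ (by positivity) (by positivity), one_mul, mul_assoc]
  have hPtend : Tendsto P atTop atTop := by
    rw [tendsto_atTop]
    intro s
    have : ∀ a ∈ s, ∀ᶠ N in atTop, a ∈ P N := by
      intro a _
      have h1 : ∀ᶠ N : ℕ in atTop, ‖q‖ ^ N < ρ * ‖x a.1‖ * ‖q‖ ^ a.2 := by
        have := hxn a.1
        exact (tendsto_pow_atTop_nhds_zero_of_lt_one hqn.le hq).eventually
          (gt_mem_nhds (by positivity))
      filter_upwards [h1, eventually_gt_atTop a.2] with N h1 h2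
      simp [hP, h1, h2]
    filter_upwards [(eventually_all_finset s).2 this] with N hN a ha using hN a ha
  have hfin : ∀ N, (∮ t in C(0, ρ / ‖q‖ ^ N), qIntegrand q h w x y t / t)
      - (∮ t in C(0, ρ), qIntegrand q h w x y t / t)
      = 2 * π * Complex.I * ∑ a ∈ P N, -qResidue q h w x y a.1 a.2 := by
    intro N
    have hR : ρ ≤ ρ / ‖q‖ ^ N := by
      rw [le_div_iff₀ (by positivity)]
      nlinarith [pow_le_one₀ (n := N) hqn.le hq.le]
    have hinv : ∀ a, Function.invFun p (p a) = a := Function.leftInverse_invFun hpinj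
    rw [circleIntegral_sub_eq_sum_residues hρ0 hR ((P N).map ⟨p, hpinj⟩)
      (fun t => -qResidue q h w x y (Function.invFun p t).1 (Function.invFun p t).2)]
    · simp [hinv]
    · intro t ht
      obtain ⟨a, ha, rfl⟩ := Finset.mem_map.1 ht
      refine ⟨?_, (hlt a N).2 (Finset.mem_filter.1 ha).2⟩
      have h1 := hxn a.1
      have h2 := hρx a.1
      have h3 := pow_le_one₀ (n := a.2) hqn.le hq.le
      change ρ < ‖p a‖
      rw [hpn, lt_div_iff₀ (by positivity)]
      nlinarith [mul_pos hρ0 h1, pow_pos hqn a.2]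
    · intro t ht1 ht2 htP
      have h0 : t ≠ 0 := norm_pos_iff.1 (by linarith)
      have hK := differentiableAt_qKernel_of_norm_lt (h := h) (w := w) (t := t) hq hh hw
        (by linarith) (by linarith)
      refine DifferentiableAt.div (DifferentiableAt.div (hK.mul ?_) ?_ ?_) differentiableAt_id h0
      · exact DifferentiableAt.fun_finsetProd fun j _ => differentiableAt_qInf hq (by fun_prop)
      · exact DifferentiableAt.fun_finsetProd fun j _ => differentiableAt_qInf hq (by fun_prop)
      · refine Finset.prod_ne_zero_iff.2 fun i _ => qInf_ne_zero hq fun k hk => htP ?_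
        have hta : t = p (i, k) := by
          simp only [hp]
          rw [eq_div_iff (mul_ne_zero (hx i) (pow_ne_zero k hq0)), ← hk]
          ring
        -- The point lies in the closed disc; `hav` excludes the boundary.
        have h1 : ‖q‖ ^ N < ρ * ‖x i‖ * ‖q‖ ^ k := by
          refine lt_of_le_of_ne ?_ (hav i k N).symm
          by_contra hcon
          push Not at hcon
          have := mt (hlt (i, k) N).1 (not_lt.2 hcon.le)
          have h3 : ‖p (i, k)‖ = ρ / ‖q‖ ^ N := le_antisymm (hta ▸ ht2) (not_lt.1 this)
          rw [hpn] at h3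
          have h4 := hxn i
          refine hav i k N ?_
          field_simp at h3
          linarith
        refine Finset.mem_map.2 ⟨(i, k), ?_, hta.symm⟩
        simp only [hP, Finset.mem_filter, Finset.mem_product, Finset.mem_univ, true_and,
          Finset.mem_range]
        refine ⟨?_, h1⟩
        have h5 : ‖q‖ ^ N < ‖q‖ ^ k := h1.trans (mul_lt_of_lt_one_left (pow_pos hqn k) (hρx i))
        exact (pow_lt_pow_iff_right_of_lt_one₀ hqn hq).1 h5
    · intro t ht
      obtain ⟨⟨i, k⟩, ha, rfl⟩ := Finset.mem_map.1 ht
      change ∃ g : ℂ → ℂ, (∀ᶠ t in 𝓝 (p (i, k)), DifferentiableAt ℂ g t) ∧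
        g (p (i, k)) = -qResidue q h w x y (Function.invFun p (p (i, k))).1
          (Function.invFun p (p (i, k))).2 ∧
        ∀ᶠ t in 𝓝[≠] (p (i, k)), qIntegrand q h w x y t / t = g t / (t - p (i, k))
      rw [hinv]
      set z := p (i, k) with hz
      have hzx : x i * z = 1 / q ^ k := by
        rw [hz, hp]; field_simp [hx i]
      have hz1 : ρ < ‖z‖ := by
        have h1 := hxn i
        have h2 := hρx i
        have h3 := pow_le_one₀ (n := k) hqn.le hq.le
        rw [hz, hpn, lt_div_iff₀ (by positivity)]
        nlinarith [mul_pos hρ0 h1, pow_pos hqn k]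
      -- The denominator without its one vanishing factor 1 - x_i t q^k.
      set den : ℂ → ℂ := fun t => (∏ l ∈ Finset.univ.erase i, qInf (x l * t) q) *
        qFac (x i * t) q k * qInf (x i * t * q ^ (k + 1)) q with hden
      have hdd : Differentiable ℂ den := by
        intro t
        refine DifferentiableAt.mul (DifferentiableAt.mul ?_ ?_) ?_
        · exact DifferentiableAt.fun_finsetProd fun j _ => differentiableAt_qInf hq (by fun_prop)
        · exact DifferentiableAt.fun_finsetProd fun j _ => by fun_prop
        · exact differentiableAt_qInf hq (by fun_prop)
      have hdz : den z = (∏ l ∈ Finset.univ.erase i, qInf (x l * (1 / (x i * q ^ k))) q) *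
          qFac (1 / q ^ k) q k * qInf q q := by
        simp only [hden]
        rw [hzx, show 1 / q ^ k * q ^ (k + 1) = q by field_simp [pow_ne_zero k hq0]; ring]
      have hdz0 : den z ≠ 0 := by
        rw [hdz]
        refine mul_ne_zero (mul_ne_zero (Finset.prod_ne_zero_iff.2 fun l hl => ?_)
          (qFac_inv_pow_ne_zero hq0 hq k)) (qInf_self_ne_zero hq)
        exact qInf_mul_inv_ne_zero hq0 hq hx hxx (Finset.ne_of_mem_erase hl) k
      refine ⟨fun t => qKernel q h w t * (∏ j, qInf (y j * t) q) / (t * den t) * (-z), ?_, ?_, ?_⟩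
      · filter_upwards [hdd.continuous.continuousAt.eventually_ne hdz0,
          continuous_norm.continuousAt.eventually (lt_mem_nhds hz1)] with t h1 h2
        have h0 : t ≠ 0 := norm_pos_iff.1 (by linarith)
        have hK := differentiableAt_qKernel_of_norm_lt (h := h) (w := w) (t := t) hq hh hw
          (by linarith) (by linarith)
        refine DifferentiableAt.mul_const (DifferentiableAt.div (hK.mul ?_)
          (differentiableAt_id.mul (hdd t)) (mul_ne_zero h0 h1)) _
        exact DifferentiableAt.fun_finsetProd fun j _ => differentiableAt_qInf hq (by fun_prop)
      · have hz0 : z ≠ 0 := hp0 _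
        rw [qResidue, ← hdz]
        change qKernel q h w z * (∏ j, qInf (y j * z) q) / (z * den z) * (-z)
          = -(qKernel q h w z * (∏ j, qInf (y j * z) q) / den z)
        generalize (∏ j, qInf (y j * z) q) = A
        field_simp
      · filter_upwards [self_mem_nhdsWithin] with t ht
        have ht' : t - z ≠ 0 := sub_ne_zero.2 ht
        have hz0 : z ≠ 0 := hp0 _
        have hprod : ∏ l, qInf (x l * t) q = den t * (-(t - z) / z) := by
          rw [← Finset.mul_prod_erase Finset.univ _ (Finset.mem_univ i)]
          rw [qInf_eq_qFac_mul hq (x i * t) (k + 1), qFac_succ]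
          have : 1 - x i * t * q ^ k = -(t - z) / z := by
            have h1 : x i * q ^ k = 1 / z := by rw [hz, hp]; simp
            rw [mul_right_comm, h1]
            field_simp
            ring
          rw [this, hden]
          ring
        rw [qIntegrand, hprod]
        generalize (∏ j, qInf (y j * t) q) = A
        generalize qKernel q h w t = B
        generalize den t = C
        simp only [div_eq_mul_inv, mul_inv, inv_neg, inv_inv]
        ring
  have hS : HasSum (fun a : Fin 6 × ℕ => qResidue q h w x y a.1 a.2)
      (∑ i, ∑' k, qResidue q h w x y i k) := by
    have hs : Summable fun a : Fin 6 × ℕ => qResidue q h w x y a.1 a.2 := by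
      refine (Equiv.sigmaEquivProd (Fin 6) ℕ).summable_iff.1 ?_
      refine Summable.of_norm ?_
      refine (summable_sigma_of_nonneg fun _ => norm_nonneg _).2 ⟨fun i => ?_, ?_⟩
      · exact (hsum i).norm
      · exact (hasSum_fintype _).summable
    have := hs.tsum_prod' fun i => hsum i
    rw [← tsum_fintype (L := SummationFilter.unconditional _), ← this]
    exact hs.hasSum
  have hlim := tendsto_circleIntegral_qIntegrand hq0 hq hh hw hx hxy hρ1 hρw hav
  have h2 := (hlim.sub_const (∮ t in C(0, ρ), qIntegrand q h w x y t / t)).congr hfin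
  have h3 := (hS.neg.comp hPtend).const_mul (2 * π * Complex.I)
  have := tendsto_nhds_unique h2 h3
  rw [zero_sub, mul_neg, neg_inj] at this
  exact this


/-- The coefficient of the series attached to the pole family of `x i`. -/
noncomputable def qResCoeff (q h w : ℂ) (x : Fin 6 → ℂ) (y : Fin 4 → ℂ) (i : Fin 6) : ℂ :=
  qTheta (h * x i) q * qTheta (h / (x i * w)) q * (∏ j, qInf (y j / x i) q) /
    (qInf (x i) q * qInf (x i * w) q * ∏ l ∈ Finset.univ.erase i, qInf (x l / x i) q)

/-- Every infinite product at t = 1/(x_i q^k) is split into its value for k = 0 and a finite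
factorial. The leftover powers of h, w and the parameters cancel because ∏ y_j = w ∏ x_i; what
remains is q^k, which is why each resulting series has argument q. -/
theorem qResidue_eq {q h w : ℂ} (hq0 : q ≠ 0) (hq : ‖q‖ < 1) (hh : h ≠ 0)
    (hw : w ≠ 0) {x : Fin 6 → ℂ} {y : Fin 4 → ℂ} (hx : ∀ i, x i ≠ 0) (hy : ∀ j, y j ≠ 0)
    (hxy : ∏ j, y j = w * ∏ i, x i) (i : Fin 6) (hxi : ‖x i‖ < 1) (hxw : ‖x i * w‖ < 1) (k : ℕ) :
    qResidue q h w x y i k = qResCoeff q h w x y i / qInf q q *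
      (qFac (x i) q k * qFac (x i * w) q k * (∏ j, qFac (q * x i / y j) q k) /
        (qFac q q k * ∏ l ∈ Finset.univ.erase i, qFac (q * x i / x l) q k) * q ^ k) := by
  have hk := pow_ne_zero k hq0
  have hxi0 := hx i
  have hC := pow_ne_zero (k.choose 2) hq0
  have hm1 : ((-1 : ℂ)) ^ k ≠ 0 := pow_ne_zero k (by norm_num)
  have harg : ∀ c : ℂ, c * (1 / (x i * q ^ k)) = c / x i / q ^ k := fun c => by field_simp
  -- numerators and denominators
  have hInf : ∀ c : ℂ, c ≠ 0 → qInf (c * (1 / (x i * q ^ k))) q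
      = qInf (c / x i) q * qFac (q * x i / c) q k *
        (((-1) ^ k * q ^ k.choose 2)⁻¹ * (c / (q * x i)) ^ k) := by
    intro c hc
    have := qInf_div_pow hq0 hq (div_ne_zero hc hxi0) k
    rw [harg]
    have e : q / (c / x i) = q * x i / c := by field_simp
    rw [e] at this
    rw [← this]
    have e2 : (q * x i / c) ^ k * (c / (q * x i)) ^ k = 1 := by
      rw [← mul_pow]; rw [show q * x i / c * (c / (q * x i)) = 1 by field_simp, one_pow]
    rw [mul_inv]
    calc _ = qInf (c / x i / q ^ k) q * ((-1) ^ k * ((-1) ^ k)⁻¹)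
          * (q ^ k.choose 2 * (q ^ k.choose 2)⁻¹) * 1 := by
          rw [mul_inv_cancel₀ hm1, mul_inv_cancel₀ hC]; ring
      _ = _ := by rw [← e2]; ring
  have hself : qFac (1 / q ^ k) q k * ((-1) ^ k * q ^ k * q ^ k.choose 2) = qFac q q k := by
    have h := qFac_reverse hq0 k 0 (g := 1 / q ^ k) (E := q) (by rw [add_zero]; field_simp)
    simpa using h
  have hth1 : qTheta (h / (1 / (x i * q ^ k))) q
      = qTheta (h * x i) q * ((-1) ^ k * (h * x i) ^ k * q ^ k.choose 2)⁻¹ := by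
    have := qTheta_mul_pow hq0 hq (mul_ne_zero hh hxi0) k
    rw [← this, mul_assoc, mul_inv_cancel₀ (mul_ne_zero (mul_ne_zero hm1
      (pow_ne_zero _ (mul_ne_zero hh hxi0))) hC), mul_one]
    congr 1
    field_simp
  have hth2 : qTheta (h * (1 / (x i * q ^ k)) / w) q
      = qTheta (h / (x i * w)) q * ((-1) ^ k * (h / (x i * w * q ^ k)) ^ k * q ^ k.choose 2) := by
    have := qTheta_mul_pow hq0 hq (x := h / (x i * w * q ^ k))
      (div_ne_zero hh (mul_ne_zero (mul_ne_zero hxi0 hw) hk)) k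
    rw [show h / (x i * w * q ^ k) * q ^ k = h / (x i * w) by field_simp] at this
    rw [this]
    congr 1
    field_simp
  have hk1 : qInf (1 / (1 / (x i * q ^ k))) q = qInf (x i) q / qFac (x i) q k := by
    rw [qInf_eq_qFac_mul hq (x i) k, mul_div_cancel_left₀ _
      (qFac_ne_zero (mul_pow_ne_one hxi hq) k), one_div_one_div]
  have hk2 : qInf (w / (1 / (x i * q ^ k))) q = qInf (x i * w) q / qFac (x i * w) q k := by
    rw [qInf_eq_qFac_mul hq (x i * w) k, mul_div_cancel_left₀ _
      (qFac_ne_zero (mul_pow_ne_one hxw hq) k)]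
    congr 1
    field_simp
  have hN : ∏ j, qInf (y j * (1 / (x i * q ^ k))) q = (∏ j, qInf (y j / x i) q) *
      (∏ j, qFac (q * x i / y j) q k) * ((((-1) ^ k * q ^ k.choose 2)⁻¹) ^ 4 *
        ((∏ j, y j) / (q * x i) ^ 4) ^ k) := by
    rw [Finset.prod_congr rfl fun j _ => hInf (y j) (hy j)]
    rw [Finset.prod_mul_distrib, Finset.prod_mul_distrib, Finset.prod_mul_distrib,
      Finset.prod_pow, Finset.prod_div_distrib]
    simp
  have hD : ∏ l ∈ Finset.univ.erase i, qInf (x l * (1 / (x i * q ^ k))) q =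
      (∏ l ∈ Finset.univ.erase i, qInf (x l / x i) q) *
      (∏ l ∈ Finset.univ.erase i, qFac (q * x i / x l) q k) * ((((-1) ^ k * q ^ k.choose 2)⁻¹) ^ 5 *
        ((∏ l ∈ Finset.univ.erase i, x l) / (q * x i) ^ 5) ^ k) := by
    rw [Finset.prod_congr rfl fun j _ => hInf (x j) (hx j)]
    rw [Finset.prod_mul_distrib, Finset.prod_mul_distrib, Finset.prod_mul_distrib,
      Finset.prod_pow, Finset.prod_div_distrib]
    simp
  rw [← Finset.mul_prod_erase Finset.univ _ (Finset.mem_univ i)] at hxy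
  have hXp : ∏ l ∈ Finset.univ.erase i, x l ≠ 0 := Finset.prod_ne_zero_iff.2 fun l _ => hx l
  rw [qResidue, qResCoeff, qKernel, hth1, hth2, hk1, hk2, hN, hD, ← hself, hxy]
  generalize (∏ l ∈ Finset.univ.erase i, x l) = X at hXp
  generalize (∏ j, qInf (y j / x i) q) = A1
  generalize (∏ j, qFac (q * x i / y j) q k) = A2
  generalize (∏ l ∈ Finset.univ.erase i, qInf (x l / x i) q) = A3
  generalize (∏ l ∈ Finset.univ.erase i, qFac (q * x i / x l) q k) = A4
  generalize qInf (x i) q = A5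
  generalize qInf (x i * w) q = A6
  generalize qFac (x i) q k = A7
  generalize qFac (x i * w) q k = A8
  generalize qTheta (h * x i) q = A9
  generalize qTheta (h / (x i * w)) q = B1
  generalize qFac (1 / q ^ k) q k = B2
  generalize qInf q q = B3
  have hc2 : (q ^ k.choose 2) ^ 2 * q ^ k = q ^ k ^ 2 := by
    rw [← pow_mul, ← pow_add, Nat.choose_two_right, Nat.div_mul_cancel (Nat.even_mul_pred_self k).two_dvd]
    congr 1
    cases k with
    | zero => rfl
    | succ k => simp; ring
  have hs2 : ((-1 : ℂ) ^ k) ^ 2 = 1 := by rw [← pow_mul, mul_comm, pow_mul]; simp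
  have hk2' := pow_ne_zero (k ^ 2) hq0
  generalize q ^ k.choose 2 = c at hC hc2
  generalize (-1 : ℂ) ^ k = s at hm1 hs2
  -- All the k-th powers coming from the two thetas and the reversals, combined: only a power of q
  -- survives.
  have hpow : ((h * x i) ^ k)⁻¹ * (h / (x i * w * q ^ k)) ^ k * (w * (x i * X) / (q * x i) ^ 4) ^ k
      * ((X / (q * x i) ^ 5) ^ k)⁻¹ = q ^ k * (q ^ k ^ 2)⁻¹ := by
    rw [← inv_pow, ← inv_pow, ← mul_pow, ← mul_pow, ← mul_pow, pow_two k, pow_mul q k k,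
      ← inv_pow (q ^ k), ← mul_pow]
    congr 1
    field_simp
  have ha : (h * x i) ^ k ≠ 0 := pow_ne_zero _ (mul_ne_zero hh hxi0)
  have he : (X / (q * x i) ^ 5) ^ k ≠ 0 :=
    pow_ne_zero _ (div_ne_zero hXp (pow_ne_zero _ (mul_ne_zero hq0 hxi0)))
  generalize (h * x i) ^ k = a at hpow ha
  generalize (h / (x i * w * q ^ k)) ^ k = b at hpow
  generalize (w * (x i * X) / (q * x i) ^ 4) ^ k = d at hpow
  generalize (X / (q * x i) ^ 5) ^ k = e at hpow he
  generalize q ^ k ^ 2 = f at hpow hc2 hk2'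
  generalize q ^ k = g at hpow hc2 hk
  -- Total monomial factor, with s = (-1)^k and c = q^{k choose 2}; it is closed by s² = 1 and c²
  -- q^k = q^{k²}.
  have hM : (s * a * c)⁻¹ * (s * b * c) * ((s * c)⁻¹ ^ 4 * d) * ((s * c)⁻¹ ^ 5 * e)⁻¹
      = (s * g * c)⁻¹ * g := by
    have : (s * a * c)⁻¹ * (s * b * c) * ((s * c)⁻¹ ^ 4 * d) * ((s * c)⁻¹ ^ 5 * e)⁻¹
        = s * c * (a⁻¹ * b * d * e⁻¹) := by field_simp
    rw [this, hpow]
    field_simp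
    rw [← hc2]
    linear_combination c ^ 2 * g * hs2
  calc _ = A9 * B1 * A1 * A2 * A7 * A8 / (A5 * A6 * A3 * A4 * B2 * B3) *
        ((s * a * c)⁻¹ * (s * b * c) * ((s * c)⁻¹ ^ 4 * d) * ((s * c)⁻¹ ^ 5 * e)⁻¹) := by
        simp only [div_eq_mul_inv, mul_inv, inv_inv]
        ring
    _ = _ := by
        rw [hM]
        simp only [div_eq_mul_inv, mul_inv]
        ring


/-! ### Moments of the kernel. -/

section

open Filter Topology Real

/-- Multiplication by c is a rotation, which the average over a full circle does not see, followed
by a dilation of the radius. -/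
theorem circleAverage_comp_mul_left (F : ℂ → ℂ) (c : ℂ) (ρ : ℝ) :
    circleAverage (fun t => F (c * t)) 0 ρ = circleAverage F 0 (‖c‖ * ρ) := by
  rw [circleAverage_eq_integral_add (f := F) c.arg, circleAverage_def]
  congr 2
  funext θ
  congr 1
  simp only [circleMap, zero_add]
  push_cast
  rw [add_mul, Complex.exp_add]
  conv_lhs => rw [← Complex.norm_mul_exp_arg_mul_I c]
  ring

theorem circleAverage_eq_of_differentiableAt {F : ℂ → ℂ} {r R : ℝ} (hr : 0 < r) (hrR : r ≤ R)
    (hF : ∀ t : ℂ, r ≤ ‖t‖ → ‖t‖ ≤ R → DifferentiableAt ℂ F t) :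
    circleAverage F 0 R = circleAverage F 0 r := by
  rw [circleAverage_eq_circleIntegral hr.ne', circleAverage_eq_circleIntegral (hr.trans_le hrR).ne']
  congr 1
  have hd : ∀ t : ℂ, r ≤ ‖t‖ → ‖t‖ ≤ R → DifferentiableAt ℂ (fun z => (z - 0)⁻¹ • F z) t := by
    intro t h1 h2
    have h0 : t ≠ 0 := norm_pos_iff.1 (by linarith)
    simp only [sub_zero, smul_eq_mul]
    exact (differentiableAt_inv h0).mul (hF t h1 h2)
  refine Complex.circleIntegral_eq_of_differentiable_on_annulus_off_countable hr hrR
    Set.countable_empty (fun t ht => ?_) fun t ht => ?_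
  · refine (hd t ?_ ?_).continuousAt.continuousWithinAt
    · simpa using ht.2
    · simpa using ht.1
  · refine hd t ?_ ?_
    · simpa using (show r ≤ ‖t‖ by simpa using (not_le.1 (by simpa using ht.1.2)).le)
    · simpa using (mem_ball_zero_iff.1 ht.1.1).le

theorem circleIntegrable_of_differentiableAt {F : ℂ → ℂ} {ρ : ℝ} (hρ : 0 ≤ ρ)
    (hF : ∀ t : ℂ, ‖t‖ = ρ → DifferentiableAt ℂ F t) : CircleIntegrable F 0 ρ :=
  ContinuousOn.circleIntegrable hρ fun t ht =>
    (hF t (by simpa using ht)).continuousAt.continuousWithinAt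

/-- The average of `g` times the kernel over the circle of radius `ρ`. -/
noncomputable def qMoment (q h w : ℂ) (ρ : ℝ) (g : ℂ → ℂ) : ℂ :=
  circleAverage (fun t => g t * qKernel q h w t) 0 ρ

/-- After `qKernel_shift`, substituting t for t/q moves the circle to radius ρ/|q|. It can be moved
back, since the kernel is holomorphic for |t| > max(1, |w|). As g needs no regularity at 0, negative
powers of t are allowed. -/
theorem qMoment_shift {q h w : ℂ} (hq0 : q ≠ 0) (hq : ‖q‖ < 1) (hh : h ≠ 0) (hw : w ≠ 0)
    {ρ : ℝ} (hρ1 : 1 < ρ) (hρw : ‖w‖ < ρ) {g : ℂ → ℂ}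
    (hg : ∀ t, t ≠ 0 → DifferentiableAt ℂ g t) :
    qMoment q h w ρ (fun t => (t - 1) * (t - w) * g t)
      = q * w * qMoment q h w ρ (fun t => g (q * t)) := by
  have hρ0 : 0 < ρ := by linarith
  have hqn : 0 < ‖q‖ := norm_pos_iff.2 hq0
  have hR : ρ ≤ ‖q⁻¹‖ * ρ := by
    rw [norm_inv]
    exact le_mul_of_one_le_left hρ0.le (one_le_inv₀ hqn |>.2 hq.le)
  rw [qMoment, qMoment]
  have e1 : circleAverage (fun t => (t - 1) * (t - w) * g t * qKernel q h w t) 0 ρ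
      = circleAverage (fun t => (q * w) • (fun s => g (q * s) * qKernel q h w s) (q⁻¹ * t)) 0 ρ := by
    refine circleAverage_congr_sphere fun t ht => ?_
    have ht' : ‖t‖ = ρ := by simpa [abs_of_pos hρ0] using ht
    have h0 : t ≠ 0 := norm_pos_iff.1 (by linarith)
    have h1 : t ≠ 1 := fun h => by rw [h, norm_one] at ht'; linarith
    have h2 : t ≠ w := fun h => by rw [h] at ht'; linarith
    have := qKernel_shift hq0 hq hh hw h0 h1 h2
    have e : q⁻¹ * t = t / q := by field_simp
    have e' : q * (t / q) = t := by field_simp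
    simp only [e, e', smul_eq_mul]
    linear_combination g t * this
  rw [e1, circleAverage_fun_smul, smul_eq_mul, circleAverage_comp_mul_left
    (fun s => g (q * s) * qKernel q h w s) q⁻¹,
    circleAverage_eq_of_differentiableAt hρ0 hR]
  intro t h1 h2
  have h0 : t ≠ 0 := norm_pos_iff.1 (by linarith)
  refine DifferentiableAt.mul ?_ (differentiableAt_qKernel_of_norm_lt hq hh hw (by linarith)
    (by linarith))
  exact (hg (q * t) (mul_ne_zero hq0 h0)).comp t (by fun_prop)

theorem circleIntegrable_mul_qKernel {q h w : ℂ} (hq : ‖q‖ < 1) (hh : h ≠ 0) (hw : w ≠ 0)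
    {ρ : ℝ} (hρ1 : 1 < ρ) (hρw : ‖w‖ < ρ) {g : ℂ → ℂ}
    (hg : ∀ t, t ≠ 0 → DifferentiableAt ℂ g t) :
    CircleIntegrable (fun t => g t * qKernel q h w t) 0 ρ := by
  refine circleIntegrable_of_differentiableAt (by linarith) fun t ht => ?_
  have h0 : t ≠ 0 := norm_pos_iff.1 (by linarith)
  exact (hg t h0).mul (differentiableAt_qKernel_of_norm_lt hq hh hw (by linarith) (by linarith))

/-- The polynomial `∏_{i < n} (t - q^i)`. -/
noncomputable def qNode (q : ℂ) (n : ℕ) (t : ℂ) : ℂ := ∏ i ∈ Finset.range n, (t - q ^ i)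

theorem qNode_succ (q : ℂ) (n : ℕ) (t : ℂ) : qNode q (n + 1) t = qNode q n t * (t - q ^ n) :=
  Finset.prod_range_succ _ _

theorem differentiable_qNode (q : ℂ) (n : ℕ) : Differentiable ℂ (qNode q n) := fun t => by
  unfold qNode
  exact DifferentiableAt.fun_finsetProd fun _ _ => by fun_prop

theorem qNode_mul_left (q : ℂ) (n : ℕ) (t : ℂ) :
    ∏ i ∈ Finset.range n, (q * t - q ^ (i + 1)) = q ^ n * qNode q n t := by
  rw [qNode, Finset.pow_eq_prod_const, ← Finset.prod_mul_distrib]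
  exact Finset.prod_congr rfl fun i _ => by ring

theorem qMoment_add {q h w : ℂ} (hq : ‖q‖ < 1) (hh : h ≠ 0) (hw : w ≠ 0)
    {ρ : ℝ} (hρ1 : 1 < ρ) (hρw : ‖w‖ < ρ) {f g : ℂ → ℂ}
    (hf : ∀ t, t ≠ 0 → DifferentiableAt ℂ f t) (hg : ∀ t, t ≠ 0 → DifferentiableAt ℂ g t) (c d : ℂ) :
    qMoment q h w ρ (fun t => c * f t + d * g t)
      = c * qMoment q h w ρ f + d * qMoment q h w ρ g := by
  have hf' := circleIntegrable_mul_qKernel hq hh hw hρ1 hρw hf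
  have hg' := circleIntegrable_mul_qKernel hq hh hw hρ1 hρw hg
  simp only [qMoment]
  rw [← smul_eq_mul c, ← circleAverage_fun_smul, ← smul_eq_mul d, ← circleAverage_fun_smul,
    ← circleAverage_fun_add]
  · congr 1; funext t; simp only [smul_eq_mul]; ring
  · exact hf'.const_smul
  · exact hg'.const_smul

/-- With g = ∏_{i<n} (t - q^{i+1}) the shift relation involves only nodes of degrees n, n + 1 and n
+ 2. If M_n denotes their moments, it reads M_{n+2} - wM_{n+1} = -q^{n+1}(M_{n+1} - wM_n), so
M_{n+1} = wM_n for all n once it holds for n = 0. -/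
theorem qMoment_qNode {q h w : ℂ} (hq0 : q ≠ 0) (hq : ‖q‖ < 1) (hh : h ≠ 0) (hw : w ≠ 0)
    {ρ : ℝ} (hρ1 : 1 < ρ) (hρw : ‖w‖ < ρ) (n : ℕ) :
    qMoment q h w ρ (qNode q n) = w ^ n * qMoment q h w ρ (fun _ => 1) := by
  have hd : ∀ n, ∀ t : ℂ, t ≠ 0 → DifferentiableAt ℂ (qNode q n) t :=
    fun n t _ => differentiable_qNode q n t
  have hi : ∀ t : ℂ, t ≠ 0 → DifferentiableAt ℂ (fun t : ℂ => t⁻¹) t :=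
    fun t ht => differentiableAt_inv ht
  have h_succ : ∀ n, qMoment q h w ρ (qNode q (n + 1)) = w * qMoment q h w ρ (qNode q n) := by
    intro n
    induction n with
    | zero =>
      -- The initial case takes g = 1/t: since (t-1)(t-w)/t = (t-1) - w + w/t, the moments of 1/t on
      -- the two sides cancel and leave M₁ = wM₀.
      have h1 := qMoment_shift hq0 hq hh hw hρ1 hρw (g := fun t => t⁻¹) hi
      have h2 := qMoment_add (h := h) hq hh hw hρ1 hρw (hd 1) (hd 0) 1 (-w)
      have h3 := qMoment_add (h := h) hq hh hw hρ1 hρw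
        (f := fun t => 1 * qNode q 1 t + -w * qNode q 0 t) (g := fun t => t⁻¹)
        (fun t ht => ((hd 1 t ht).const_mul _).add ((hd 0 t ht).const_mul _)) hi 1 w
      have h4 := qMoment_add (h := h) hq hh hw hρ1 hρw (f := fun t => t⁻¹) (g := fun t => t⁻¹)
        hi hi q⁻¹ 0
      rw [h2] at h3
      have e1 : qMoment q h w ρ (fun t => (t - 1) * (t - w) * t⁻¹) = qMoment q h w ρ
          (fun t => 1 * (1 * qNode q 1 t + -w * qNode q 0 t) + w * t⁻¹) := by
        refine circleAverage_congr_sphere fun t ht => ?_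
        have ht' : ‖t‖ = ρ := by simpa [abs_of_pos (show 0 < ρ by linarith)] using ht
        have h0 : t ≠ 0 := norm_pos_iff.1 (by linarith)
        simp only [qNode, Finset.prod_range_succ, Finset.prod_range_zero]
        field_simp
        ring
      have e2 : qMoment q h w ρ (fun t => (q * t)⁻¹) = q⁻¹ * qMoment q h w ρ (fun t => t⁻¹) := by
        simp only [zero_mul, add_zero] at h4
        rw [← h4]; simp only [mul_inv]
      rw [e1, h3, e2] at h1
      have : q * q⁻¹ = 1 := mul_inv_cancel₀ hq0
      linear_combination h1 + w * qMoment q h w ρ (fun t => t⁻¹) * this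
    | succ n ih =>
      have h1 := qMoment_shift hq0 hq hh hw hρ1 hρw
        (g := fun t => ∏ i ∈ Finset.range n, (t - q ^ (i + 1)))
        (fun t _ => DifferentiableAt.fun_finsetProd fun _ _ => by fun_prop)
      have h2 := qMoment_add (h := h) hq hh hw hρ1 hρw (hd (n + 2)) (hd (n + 1)) 1 (q ^ (n + 1) - w)
      have h3 := qMoment_add (h := h) hq hh hw hρ1 hρw (hd n) (hd n) (q ^ n) 0
      have e1 : (fun t => (t - 1) * (t - w) * ∏ i ∈ Finset.range n, (t - q ^ (i + 1)))
          = fun t => 1 * qNode q (n + 2) t + (q ^ (n + 1) - w) * qNode q (n + 1) t := by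
        funext t
        rw [qNode_succ q (n + 1), qNode, Finset.prod_range_succ']
        ring
      have e2 : (fun t => ∏ i ∈ Finset.range n, (q * t - q ^ (i + 1)))
          = fun t => q ^ n * qNode q n t + 0 * qNode q n t := by
        funext t; rw [qNode_mul_left]; ring
      rw [e1, h2, e2, h3] at h1
      linear_combination h1 - q ^ (n + 1) * ih
  induction n with
  | zero =>
    rw [pow_zero, one_mul]
    congr 1
  | succ n ih => rw [h_succ, ih]; ring

/-- Newton expansion at the nodes 1, q, q², …: multiplying a node polynomial by t gives the next one
plus q^n times itself, which is the q-Pascal rule. -/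
theorem pow_eq_sum_qBinom {q : ℂ} (hq0 : q ≠ 0) (hq : ‖q‖ < 1) (J : ℕ) (t : ℂ) :
    t ^ J = ∑ n ∈ Finset.range (J + 1), qBinom q J n * qNode q n t := by
  induction J with
  | zero => simp [qNode, qBinom_zero_right]
  | succ J ih =>
    rw [Finset.sum_range_succ']
    simp only [qBinom_succ_succ hq0 hq, add_mul, Finset.sum_add_distrib]
    have e1 : ∑ n ∈ Finset.range (J + 1), q ^ (n + 1) * qBinom q J (n + 1) * qNode q (n + 1) t
        + qBinom q (J + 1) 0 * qNode q 0 t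
        = ∑ n ∈ Finset.range (J + 1), q ^ n * qBinom q J n * qNode q n t := by
      rw [Finset.sum_range_succ, qBinom_eq_zero hq0 (Nat.lt_succ_self J), Finset.sum_range_succ' _ J]
      simp [qBinom_zero_right]
    rw [add_assoc, e1, ← Finset.sum_add_distrib, pow_succ, ih, Finset.sum_mul]
    refine Finset.sum_congr rfl fun n _ => ?_
    rw [qNode_succ]
    ring

theorem qMoment_pow {q h w : ℂ} (hq0 : q ≠ 0) (hq : ‖q‖ < 1) (hh : h ≠ 0) (hw : w ≠ 0)
    {ρ : ℝ} (hρ1 : 1 < ρ) (hρw : ‖w‖ < ρ) (J : ℕ) :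
    qMoment q h w ρ (fun t => t ^ J) = qMoment q h w ρ (fun _ => 1) *
      ∑ n ∈ Finset.range (J + 1), qBinom q J n * w ^ n := by
  have : qMoment q h w ρ (fun t => t ^ J) = ∑ n ∈ Finset.range (J + 1),
      qBinom q J n * qMoment q h w ρ (qNode q n) := by
    simp only [qMoment]
    simp only [pow_eq_sum_qBinom hq0 hq J, Finset.sum_mul]
    rw [circleAverage_fun_sum]
    · refine Finset.sum_congr rfl fun n _ => ?_
      rw [← smul_eq_mul (qBinom q J n), ← circleAverage_fun_smul]
      simp only [smul_eq_mul, mul_assoc]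
    · intro n _
      exact circleIntegrable_mul_qKernel hq hh hw hρ1 hρw
        fun t _ => (differentiable_qNode q n t).const_mul _
  rw [this, Finset.mul_sum]
  refine Finset.sum_congr rfl fun n _ => ?_
  rw [qMoment_qNode hq0 hq hh hw hρ1 hρw]
  ring

end


/-! ### The zeroth moment. -/

section

open Filter Topology Real

/-- The node polynomial cancels the first n factors of (1/t;q)_∞, hence the poles of the kernel at
1, q, …, q^{n-1}. -/
theorem qNode_mul_qKernel {q h w t : ℂ} (hq : ‖q‖ < 1) (ht : 1 < ‖t‖) (n : ℕ) :
    qNode q n t * qKernel q h w t = t ^ n * (qTheta (h / t) q * qTheta (h * t / w) q) /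
      (qInf (q ^ n / t) q * qInf (w / t) q) := by
  have h0 : t ≠ 0 := norm_pos_iff.1 (by linarith)
  have h1 : ‖1 / t‖ < 1 := by
    rw [norm_div, norm_one, div_lt_one (by linarith)]; exact ht
  have e1 : qNode q n t = t ^ n * qFac (1 / t) q n := by
    rw [qNode, qFac, Finset.pow_eq_prod_const, ← Finset.prod_mul_distrib]
    exact Finset.prod_congr rfl fun i _ => by field_simp
  have h2 := qFac_ne_zero (mul_pow_ne_one h1 hq) n
  rw [e1, qKernel, qInf_eq_qFac_mul hq (1 / t) n, show 1 / t * q ^ n = q ^ n / t by ring]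
  generalize qFac (1 / t) q n = A at h2
  simp only [div_eq_mul_inv, mul_inv]
  linear_combination t ^ n * (qTheta (h * t⁻¹) q * qTheta (h * t * w⁻¹) q) *
    ((qInf (q ^ n * t⁻¹) q)⁻¹ * (qInf (w * t⁻¹) q)⁻¹) * mul_inv_cancel₀ h2

theorem qInf_div_ne_zero_of_annulus {q w t : ℂ} (hq : ‖q‖ < 1)
    (ht : ‖w‖ * ‖q‖ < ‖t‖) (htw : t ≠ w) : qInf (w / t) q ≠ 0 := by
  have h0 : t ≠ 0 := norm_pos_iff.1 (lt_of_le_of_lt (by positivity) ht)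
  refine qInf_ne_zero hq fun k hk => ?_
  have : t = w * q ^ k := by
    rw [div_mul_eq_mul_div, div_eq_one_iff_eq h0] at hk
    exact hk.symm
  cases k with
  | zero => exact htw (by simpa using this)
  | succ k =>
    rw [this, norm_mul, norm_pow, pow_succ] at ht
    have := pow_le_one₀ (n := k) (norm_nonneg q) hq.le
    have h3 : ‖q‖ ^ k * ‖q‖ ≤ ‖q‖ := mul_le_of_le_one_left (norm_nonneg q) this
    exact absurd ht (not_lt.2 (mul_le_mul_of_nonneg_left h3 (norm_nonneg w)))

/-- The left average is the moment of the n-th node polynomial. Its integrand has no pole at q^k for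
k < n, and the later q^k lie inside radius r, so between r and ρ the only pole is t = w. The right
side is the residue there. -/
theorem pow_mul_qMoment_one_sub {q h w : ℂ} (hq0 : q ≠ 0) (hq : ‖q‖ < 1) (hh : h ≠ 0) (hw : w ≠ 0)
    {ρ r : ℝ} (hρ1 : 1 < ρ) (hρw : ‖w‖ < ρ) (hr1 : ‖w‖ * ‖q‖ < r) (hr2 : r < ‖w‖) {n : ℕ}
    (hn : ‖q ^ n‖ < r) :
    w ^ n * qMoment q h w ρ (fun _ => 1) - circleAverage (fun t => t ^ n *
      (qTheta (h / t) q * qTheta (h * t / w) q) / (qInf (q ^ n / t) q * qInf (w / t) q)) 0 r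
      = w ^ n * (qTheta h q * qTheta (h / w) q / (qInf (q ^ n / w) q * qInf q q)) := by
  have hρ0 : 0 < ρ := by linarith
  have hr0 : 0 < r := lt_of_le_of_lt (by positivity) hr1
  set G : ℂ → ℂ := fun t => t ^ n *
      (qTheta (h / t) q * qTheta (h * t / w) q) / (qInf (q ^ n / t) q * qInf (w / t) q) with hG
  set g : ℂ → ℂ := fun t => t ^ n *
      (qTheta (h / t) q * qTheta (h * t / w) q) / (qInf (q ^ n / t) q * qInf (w / t * q) q) with hg
  have hL : w ^ n * qMoment q h w ρ (fun _ => 1) = circleAverage G 0 ρ := by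
    rw [← qMoment_qNode hq0 hq hh hw hρ1 hρw]
    refine circleAverage_congr_sphere fun t ht => ?_
    have ht' : ‖t‖ = ρ := by simpa [abs_of_pos hρ0] using ht
    exact qNode_mul_qKernel hq (by linarith) n
  have hdn : ∀ t : ℂ, r ≤ ‖t‖ → DifferentiableAt ℂ
      (fun t => t ^ n * (qTheta (h / t) q * qTheta (h * t / w) q)) t := by
    intro t ht
    have h0 : t ≠ 0 := norm_pos_iff.1 (by linarith)
    refine DifferentiableAt.mul (by fun_prop) (DifferentiableAt.mul ?_ ?_)
    · exact differentiableAt_qTheta hq ((differentiableAt_const _).div differentiableAt_id h0)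
        (div_ne_zero hh h0)
    · exact differentiableAt_qTheta hq (by fun_prop) (div_ne_zero (mul_ne_zero hh h0) hw)
  have hdc : ∀ t : ℂ, r ≤ ‖t‖ → ∀ c : ℂ, DifferentiableAt ℂ (fun t => qInf (c / t) q) t := by
    intro t ht c
    have h0 : t ≠ 0 := norm_pos_iff.1 (by linarith)
    exact differentiableAt_qInf hq ((differentiableAt_const _).div differentiableAt_id h0)
  have hdg : ∀ t : ℂ, r ≤ ‖t‖ → DifferentiableAt ℂ g t := by
    intro t ht
    have e : (fun t => qInf (w / t * q) q) = fun t => qInf (w * q / t) q := by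
      funext t; congr 1; ring
    have e' : w / t * q = w * q / t := by ring
    refine (hdn t ht).div ((hdc t ht _).mul (e ▸ hdc t ht _)) (mul_ne_zero ?_ ?_)
    · exact qInf_div_ne_zero hq (by linarith)
    · rw [e']
      exact qInf_div_ne_zero hq (by rw [norm_mul]; linarith)
  have key := circleIntegral_sub_eq_sum_residues hr0 (hr2.trans hρw).le {w}
    (fun _ => g w) (fun t => (t - 0)⁻¹ • G t) ?_ ?_ ?_
  · rw [Finset.sum_singleton] at key
    rw [hL, circleAverage_eq_circleIntegral hρ0.ne', circleAverage_eq_circleIntegral hr0.ne',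
      ← smul_sub, key, smul_eq_mul, inv_mul_cancel_left₀ (by
        simp [Real.pi_ne_zero])]
    simp only [hg]
    rw [div_self hw, one_mul, mul_div_assoc h, div_self hw, mul_one]
    ring
  · intro p hp
    rw [Finset.mem_singleton.1 hp]
    exact ⟨hr2, hρw⟩
  · intro t h1 h2 h3
    have h0 : t ≠ 0 := norm_pos_iff.1 (by linarith)
    simp only [sub_zero, smul_eq_mul]
    refine (differentiableAt_inv h0).mul ((hdn t h1).div ((hdc t h1 _).mul (hdc t h1 _))
      (mul_ne_zero ?_ ?_))
    · exact qInf_div_ne_zero hq (by linarith)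
    · exact qInf_div_ne_zero_of_annulus hq (by linarith) (by simpa using h3)
  · intro p hp
    rw [Finset.mem_singleton.1 hp]
    refine ⟨g, ?_, rfl, ?_⟩
    · filter_upwards [continuous_norm.continuousAt.eventually (lt_mem_nhds hr2)] with t ht
      exact hdg t ht.le
    · filter_upwards [self_mem_nhdsWithin, nhdsWithin_le_nhds
        (continuous_norm.continuousAt.eventually (lt_mem_nhds hr2))] with t ht ht2
      have h0 : t ≠ 0 := norm_pos_iff.1 (by linarith)
      have h1 : t - w ≠ 0 := sub_ne_zero.2 ht
      simp only [hG, hg]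
      rw [qInf_eq_one_sub_mul hq (w / t), show 1 - w / t = (t - w) / t by field_simp]
      simp only [sub_zero, smul_eq_mul, div_eq_mul_inv, mul_inv, inv_inv]
      linear_combination t ^ n * (qTheta (h * t⁻¹) q * qTheta (h * t * w⁻¹) q) *
        ((qInf (q ^ n * t⁻¹) q)⁻¹ * (qInf (w * t⁻¹ * q) q)⁻¹) * (t - w)⁻¹ * mul_inv_cancel₀ h0

/-- The residue formula is divided by w^n and n tends to infinity: on the inner circle the integrand
is O((r/|w|)^n) with r < |w|, and (q^n/w;q)_∞ tends to 1. -/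
theorem qMoment_one {q h w : ℂ} (hq0 : q ≠ 0) (hq : ‖q‖ < 1) (hh : h ≠ 0) (hw : w ≠ 0)
    {ρ : ℝ} (hρ1 : 1 < ρ) (hρw : ‖w‖ < ρ) :
    qMoment q h w ρ (fun _ => 1) = qTheta h q * qTheta (h / w) q / qInf q q := by
  have hwn : 0 < ‖w‖ := norm_pos_iff.2 hw
  obtain ⟨r, hr1, hr2⟩ := exists_between (mul_lt_of_lt_one_right hwn hq)
  have hr0 : 0 < r := lt_of_le_of_lt (by positivity) hr1
  have hqpow : Tendsto (fun n : ℕ => q ^ n) atTop (𝓝 0) :=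
    tendsto_pow_atTop_nhds_zero_of_norm_lt_one hq
  have hcont : Continuous fun x => qInf x q := (differentiable_qInf hq).continuous
  set N : ℂ → ℂ := fun t => qTheta (h / t) q * qTheta (h * t / w) q / qInf (w / t) q with hN
  have hNc : ContinuousOn N (Metric.sphere 0 r) := by
    intro t ht
    have ht' : ‖t‖ = r := by simpa using ht
    have h0 : t ≠ 0 := norm_pos_iff.1 (by linarith)
    have hne : t ≠ w := fun h => by rw [h] at ht'; linarith
    refine ContinuousAt.continuousWithinAt (DifferentiableAt.continuousAt (𝕜 := ℂ) ?_)
    refine DifferentiableAt.div (DifferentiableAt.mul ?_ ?_) ?_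
      (qInf_div_ne_zero_of_annulus hq (by linarith) hne)
    · exact differentiableAt_qTheta hq ((differentiableAt_const _).div differentiableAt_id h0)
        (div_ne_zero hh h0)
    · exact differentiableAt_qTheta hq (by fun_prop) (div_ne_zero (mul_ne_zero hh h0) hw)
    · exact differentiableAt_qInf hq ((differentiableAt_const _).div differentiableAt_id h0)
  obtain ⟨B, hB⟩ := (isCompact_sphere (0 : ℂ) r).exists_bound_of_continuousOn hNc
  obtain ⟨δ, hδ, hδ2⟩ : ∃ δ > 0, ∀ s : ℂ, ‖s‖ < δ → 1 / 2 < ‖qInf s q‖ := by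
    have := hcont.norm.continuousAt.eventually
      (lt_mem_nhds (show (1 / 2 : ℝ) < ‖qInf 0 q‖ by rw [qInf_zero]; norm_num))
    obtain ⟨δ, hδ, h⟩ := Metric.eventually_nhds_iff.1 this
    exact ⟨δ, hδ, fun s hs => h (by simpa using hs)⟩
  have hlim1 : Tendsto (fun n : ℕ => qTheta h q * qTheta (h / w) q /
      (qInf (q ^ n / w) q * qInf q q)) atTop (𝓝 (qTheta h q * qTheta (h / w) q / qInf q q)) := by
    have h1 : Tendsto (fun n : ℕ => qInf (q ^ n / w) q) atTop (𝓝 1) := by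
      have := (hcont.tendsto (0 / w)).comp (hqpow.div_const w)
      rwa [zero_div, qInf_zero] at this
    have := (h1.mul_const (qInf q q))
    rw [one_mul] at this
    exact tendsto_const_nhds.div this (qInf_self_ne_zero hq)
  have hlim2 : Tendsto (fun n : ℕ => w⁻¹ ^ n * circleAverage (fun t => t ^ n *
      (qTheta (h / t) q * qTheta (h * t / w) q) / (qInf (q ^ n / t) q * qInf (w / t) q)) 0 r)
      atTop (𝓝 0) := by
    refine squeeze_zero_norm' (a := fun n => (r / ‖w‖) ^ n * (2 * B)) ?_ ?_
    · filter_upwards [(hqpow.norm).eventually (gt_mem_nhds (show ‖(0 : ℂ)‖ < δ * r by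
        rw [norm_zero]; positivity))] with n hn
      rw [circleAverage_eq_circleIntegral hr0.ne', norm_mul, norm_smul]
      have hI := circleIntegral.norm_integral_le_of_norm_le_const (c := 0) hr0.le
        (C := r⁻¹ * (r ^ n * (2 * B))) (f := fun t => (t - 0)⁻¹ • (t ^ n *
          (qTheta (h / t) q * qTheta (h * t / w) q) / (qInf (q ^ n / t) q * qInf (w / t) q))) ?_
      · have h2 : ‖((2 * π * Complex.I)⁻¹ : ℂ)‖ = (2 * π)⁻¹ := by
          simp [abs_of_pos Real.pi_pos]
        rw [h2, norm_pow, norm_inv]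
        refine (mul_le_mul_of_nonneg_left (mul_le_mul_of_nonneg_left hI (by positivity))
          (by positivity)).trans (le_of_eq ?_)
        rw [div_pow, inv_pow]
        field_simp
      · intro t ht
        have ht' : ‖t‖ = r := by simpa using ht
        rw [norm_smul, sub_zero, norm_inv, ht']
        refine mul_le_mul_of_nonneg_left ?_ (by positivity)
        have e : t ^ n * (qTheta (h / t) q * qTheta (h * t / w) q) /
            (qInf (q ^ n / t) q * qInf (w / t) q) = t ^ n * ((qInf (q ^ n / t) q)⁻¹ * N t) := by
          simp only [hN, div_eq_mul_inv, mul_inv]; ring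
        rw [e, norm_mul, norm_pow, ht', norm_mul, norm_inv]
        have h3 : 1 / 2 < ‖qInf (q ^ n / t) q‖ := hδ2 _ (by
          rw [norm_div, ht', div_lt_iff₀ hr0]; exact hn)
        have h4 : ‖qInf (q ^ n / t) q‖⁻¹ ≤ 2 := by
          rw [inv_le_comm₀ (by linarith) (by norm_num)]; linarith
        have h5 := hB t ht
        gcongr
    · have : r / ‖w‖ < 1 := (div_lt_one hwn).2 hr2
      simpa using (tendsto_pow_atTop_nhds_zero_of_lt_one (by positivity) this).mul_const (2 * B)
  have hev : ∀ᶠ n : ℕ in atTop, qTheta h q * qTheta (h / w) q / (qInf (q ^ n / w) q * qInf q q)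
      + w⁻¹ ^ n * circleAverage (fun t => t ^ n * (qTheta (h / t) q * qTheta (h * t / w) q) /
        (qInf (q ^ n / t) q * qInf (w / t) q)) 0 r = qMoment q h w ρ (fun _ => 1) := by
    filter_upwards [hqpow.norm.eventually (gt_mem_nhds (show ‖(0 : ℂ)‖ < r by
        rw [norm_zero]; exact hr0))] with n hn
    have h1 := pow_mul_qMoment_one_sub hq0 hq hh hw hρ1 hρw hr1 hr2 hn
    have h2 : w⁻¹ ^ n * w ^ n = 1 := by rw [← mul_pow, inv_mul_cancel₀ hw, one_pow]
    linear_combination (-w⁻¹ ^ n) * h1 + (qMoment q h w ρ (fun _ => 1) - qTheta h q *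
      qTheta (h / w) q / (qInf (q ^ n / w) q * qInf q q)) * h2
  have h1 := (hlim1.add hlim2).congr' hev
  rw [add_zero] at h1
  exact tendsto_nhds_unique tendsto_const_nhds h1

end


/-! ### Integrals against the kernel as power series in w. -/

section

open Filter Topology Real

/-- Termwise integration, by domination on the circle. A general index set with exponents e is used
because the expansion in view is a double series. -/
theorem hasSum_qMoment {q h w : ℂ} (hq : ‖q‖ < 1) (hh : h ≠ 0) (hw : w ≠ 0)
    {ρ : ℝ} (hρ1 : 1 < ρ) (hρw : ‖w‖ < ρ) {ι : Type*} [Countable ι] {c : ι → ℂ} {e : ι → ℕ}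
    (hs : Summable fun i => ‖c i‖ * ρ ^ e i) {F : ℂ → ℂ}
    (hF : ∀ t : ℂ, ‖t‖ = ρ → HasSum (fun i => c i * t ^ e i) (F t)) :
    HasSum (fun i => c i * qMoment q h w ρ (fun t => t ^ e i)) (qMoment q h w ρ F) := by
  have hρ0 : 0 < ρ := by linarith
  have hK : ContinuousOn (qKernel q h w) (Metric.sphere 0 ρ) := by
    intro t ht
    have ht' : ‖t‖ = ρ := by simpa using ht
    exact (differentiableAt_qKernel_of_norm_lt hq hh hw (by linarith)
      (by linarith)).continuousAt.continuousWithinAt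
  have hKc : Continuous fun θ => qKernel q h w (circleMap 0 ρ θ) :=
    hK.comp_continuous (continuous_circleMap 0 ρ) fun θ => circleMap_mem_sphere _ hρ0.le θ
  obtain ⟨B, hB⟩ := (isCompact_sphere (0 : ℂ) ρ).exists_bound_of_continuousOn hK
  have hn : ∀ θ, ‖circleMap 0 ρ θ‖ = ρ := fun θ => by
    simpa using circleMap_mem_sphere 0 hρ0.le θ
  have hterm : ∀ i, c i * qMoment q h w ρ (fun t => t ^ e i) = (2 * π)⁻¹ •
      ∫ θ in (0 : ℝ)..2 * π, c i * circleMap 0 ρ θ ^ e i * qKernel q h w (circleMap 0 ρ θ) := by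
    intro i
    rw [qMoment, ← smul_eq_mul (c i), ← circleAverage_fun_smul, circleAverage_def]
    simp only [smul_eq_mul, mul_assoc]
  simp only [hterm]
  rw [qMoment, circleAverage_def]
  refine HasSum.const_smul _ ?_
  refine intervalIntegral.hasSum_integral_of_dominated_convergence
    (fun i _ => ‖c i‖ * ρ ^ e i * B) (fun i => ?_) (fun i => ?_) ?_ ?_ ?_
  · refine Continuous.aestronglyMeasurable ?_
    exact (continuous_const.mul ((continuous_circleMap 0 ρ).pow _)).mul hKc
  · refine Eventually.of_forall fun θ _ => ?_
    rw [norm_mul, norm_mul, norm_pow, hn]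
    exact mul_le_mul_of_nonneg_left (hB _ (circleMap_mem_sphere _ hρ0.le θ)) (by positivity)
  · exact Eventually.of_forall fun _ _ => hs.mul_right B
  · exact intervalIntegrable_const
  · exact Eventually.of_forall fun θ _ => (hF _ (hn θ)).mul_right _

/-- Both sides are sums over triples (m, r, s) with m + r + s = N. For fixed r, the sum over m is
the finite q-binomial theorem for (Dq^{2r};q)_{N-r}. -/
theorem sum_antidiagonal_qBinom_eq {q : ℂ} (hq0 : q ≠ 0) (hq : ‖q‖ < 1) (D : ℂ) (φ : ℕ → ℂ)
    (N : ℕ) :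
    ∑ p ∈ Finset.HasAntidiagonal.antidiagonal N, qExpCoeff q p.1 * D ^ p.1 *
      ∑ s ∈ Finset.HasAntidiagonal.antidiagonal p.2,
        qExpCoeff q s.1 * (q / q ^ p.2) ^ s.1 / qFac q q s.2 * (q ^ (p.1 * s.1) * φ s.1)
    = ∑ p ∈ Finset.HasAntidiagonal.antidiagonal N, qExpCoeff q p.1 * (q / q ^ N) ^ p.1 /
        qFac q q p.2 * (φ p.1 * qFac (D * q ^ (2 * p.1)) q p.2) := by
  set F : ℕ → ℕ → ℕ → ℂ := fun r m s => qExpCoeff q m * D ^ m * (qExpCoeff q r *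
    (q / q ^ (r + s)) ^ r / qFac q q s * (q ^ (m * r) * φ r)) with hF
  have h1 := sum_antidiagonal_triple N (fun m r s => F r m s)
  have h2 := sum_antidiagonal_triple N F
  calc _ = ∑ p ∈ Finset.HasAntidiagonal.antidiagonal N,
        ∑ s ∈ Finset.HasAntidiagonal.antidiagonal p.2, F s.1 p.1 s.2 := by
        refine Finset.sum_congr rfl fun p _ => ?_
        rw [Finset.mul_sum]
        refine Finset.sum_congr rfl fun s hs => ?_
        rw [← Finset.HasAntidiagonal.mem_antidiagonal.1 hs]
    _ = ∑ p ∈ Finset.HasAntidiagonal.antidiagonal N,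
        ∑ s ∈ Finset.HasAntidiagonal.antidiagonal p.2, F p.1 s.1 s.2 := by
        rw [← h1, ← h2]
        exact Finset.sum_congr rfl fun p _ =>
          Finset.Nat.sum_antidiagonal_swap (f := fun r => F r.1 r.2 p.2)
    _ = _ := by
        refine Finset.sum_congr rfl fun p hp => ?_
        rw [← Finset.HasAntidiagonal.mem_antidiagonal.1 hp]
        have h3 := qFac_div_eq_sum hq (D * q ^ (2 * p.1)) p.2
        rw [div_mul_eq_mul_div, mul_div_assoc, mul_div_assoc, h3, Finset.mul_sum,
          Finset.mul_sum]
        refine Finset.sum_congr rfl fun s hs => ?_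
        rw [← Finset.HasAntidiagonal.mem_antidiagonal.1 hs]
        have e : (q / q ^ (p.1 + s.2)) ^ p.1 * q ^ (s.1 * p.1)
            = (q / q ^ (p.1 + (s.1 + s.2))) ^ p.1 * (q ^ (2 * p.1)) ^ s.1 := by
          rw [pow_mul q s.1 p.1, ← pow_mul q (2 * p.1) s.1,
            show 2 * p.1 * s.1 = 2 * s.1 * p.1 by ring, pow_mul q (2 * s.1) p.1, ← mul_pow,
            ← mul_pow]
          congr 1
          field_simp
          ring
        simp only [hF]
        rw [mul_pow]
        linear_combination qExpCoeff q s.1 * D ^ s.1 * qExpCoeff q p.1 * (qFac q q s.2)⁻¹ * φ p.1 * e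

theorem exists_hasSum_mul_pow {R : ℝ} {f : ℂ → ℂ} (hf : DifferentiableOn ℂ f (Metric.ball 0 R)) :
    ∃ a : ℕ → ℂ, ∀ t : ℂ, ‖t‖ < R → HasSum (fun j => a j * t ^ j) (f t) := by
  refine ⟨fun n => (n.factorial : ℂ)⁻¹ * iteratedDeriv n f 0, fun t ht => ?_⟩
  have h := Complex.hasSum_taylorSeries_on_ball hf (z := t) (by simpa using ht)
  refine h.congr_fun fun n => ?_
  simp only [sub_zero, smul_eq_mul]
  ring

/-- With f = ∑ a_j t^j and Euler's series for (Dwt;q)_∞, the moments give a triple series in j, m, n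
with coefficient `qBinom q (j + m) n`. Expanding this coefficient by the finite q-binomial theorem
makes its dependence on j a combination of powers (q^r)^j, so the sum over j restores the values
f(q^r). -/
theorem hasSum_qMoment_mul_qInf {q h w : ℂ} (hq0 : q ≠ 0) (hq : ‖q‖ < 1) (hh : h ≠ 0) (hw : w ≠ 0)
    {ρ R : ℝ} (hρ1 : 1 < ρ) (hρw : ‖w‖ < ρ) (hρR : ρ < R) {f : ℂ → ℂ}
    (hf : DifferentiableOn ℂ f (Metric.ball 0 R)) (D : ℂ) :
    HasSum (fun N => qMoment q h w ρ (fun _ => 1) * (w ^ N *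
      ∑ p ∈ Finset.HasAntidiagonal.antidiagonal N, qExpCoeff q p.1 * (q / q ^ N) ^ p.1 /
        qFac q q p.2 * (f (q ^ p.1) * qFac (D * q ^ (2 * p.1)) q p.2)))
      (qMoment q h w ρ (fun t => f t * qInf (D * w * t) q)) := by
  have hρ0 : 0 < ρ := by linarith
  set L := qMoment q h w ρ (fun _ => 1) with hL
  obtain ⟨a, ha⟩ := exists_hasSum_mul_pow hf
  have has : Summable fun j => ‖a j‖ * ρ ^ j := by
    have := (ha (ρ : ℂ) (by rw [Complex.norm_real, Real.norm_eq_abs, abs_of_pos hρ0]; exact hρR)).summable.norm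
    simpa [abs_of_pos hρ0] using this
  have hbs : Summable fun m => ‖qExpCoeff q m * (D * w) ^ m‖ * ρ ^ m := by
    have := qExpCoeff_summable hq (‖D * w‖ * ρ) (by positivity)
    refine this.congr fun m => ?_
    rw [norm_mul (qExpCoeff q m), norm_pow, mul_pow]; ring
  have hprod : Summable fun i : ℕ × ℕ =>
      ‖a i.1 * (qExpCoeff q i.2 * (D * w) ^ i.2)‖ * ρ ^ (i.1 + i.2) := by
    have := has.mul_of_nonneg hbs (fun _ => by positivity) (fun _ => by positivity)
    refine this.congr fun i => ?_
    rw [norm_mul (a i.1), pow_add]; ring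
  have hF : ∀ t : ℂ, ‖t‖ = ρ → HasSum (fun i : ℕ × ℕ =>
      a i.1 * (qExpCoeff q i.2 * (D * w) ^ i.2) * t ^ (i.1 + i.2)) (f t * qInf (D * w * t) q) := by
    intro t ht
    have h1 := ha t (by linarith)
    have h2 := hasSum_qInf hq (D * w * t)
    have hs := summable_mul_of_summable_norm (f := fun j => a j * t ^ j)
      (g := fun m => qExpCoeff q m * (D * w * t) ^ m) h1.summable.norm h2.summable.norm
    have h3 := h1.mul h2 hs
    have e : (fun i : ℕ × ℕ => a i.1 * (qExpCoeff q i.2 * (D * w) ^ i.2) * t ^ (i.1 + i.2))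
        = fun i => a i.1 * t ^ i.1 * (qExpCoeff q i.2 * (D * w * t) ^ i.2) := by
      funext i
      rw [pow_add, mul_pow (D * w) t]
      ring
    rw [e]
    exact h3
  have H1 := hasSum_qMoment (h := h) hq hh hw hρ1 hρw
    (c := fun i : ℕ × ℕ => a i.1 * (qExpCoeff q i.2 * (D * w) ^ i.2)) (e := fun i => i.1 + i.2)
    hprod hF
  set T : (ℕ × ℕ) × ℕ → ℂ := fun x => L * (a x.1.1 * (qExpCoeff q x.1.2 * (D * w) ^ x.1.2) *
    (qBinom q (x.1.1 + x.1.2) x.2 * w ^ x.2)) with hT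
  obtain ⟨C, hC0, hC⟩ := exists_norm_qBinom_le hq0 hq
  -- The coefficient vanishes unless n ≤ j + m, and there |w|^n ≤ ρ^{j+m} (|w|/ρ)^n because ρ > 1.
  -- The triple series is thus dominated by the double series on the circle times a geometric
  -- series.
  have hTs : Summable T := by
    have hg : Summable fun n : ℕ => (‖w‖ / ρ) ^ n :=
      summable_geometric_of_lt_one (by positivity) ((div_lt_one hρ0).2 hρw)
    have hb := (hprod.mul_of_nonneg hg (fun _ => by positivity) (fun _ => by positivity)).mul_left
      (‖L‖ * C)
    refine Summable.of_norm_bounded hb fun x => ?_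
    rcases lt_or_ge (x.1.1 + x.1.2) x.2 with hlt | hge
    · simp only [hT, qBinom_eq_zero hq0 hlt, zero_mul, mul_zero, norm_zero]
      positivity
    · have h1 := hC _ _ hge
      have h2 : ‖w‖ ^ x.2 ≤ ρ ^ (x.1.1 + x.1.2) * (‖w‖ / ρ) ^ x.2 := by
        rw [div_pow, mul_div_assoc', le_div_iff₀ (by positivity), mul_comm]
        exact mul_le_mul_of_nonneg_right (pow_le_pow_right₀ hρ1.le hge) (by positivity)
      simp only [hT]
      rw [norm_mul, norm_mul, norm_mul (qBinom _ _ _), norm_pow]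
      calc _ ≤ ‖L‖ * (‖a x.1.1 * (qExpCoeff q x.1.2 * (D * w) ^ x.1.2)‖ *
            (C * (ρ ^ (x.1.1 + x.1.2) * (‖w‖ / ρ) ^ x.2))) := by gcongr
        _ = _ := by ring
  have hTsum : HasSum T (qMoment q h w ρ (fun t => f t * qInf (D * w * t) q)) := by
    have h1 := hTs.hasSum.prod_fiberwise (g := fun i : ℕ × ℕ =>
      a i.1 * (qExpCoeff q i.2 * (D * w) ^ i.2) * qMoment q h w ρ (fun t => t ^ (i.1 + i.2)))
      fun i => by
        rw [qMoment_pow hq0 hq hh hw hρ1 hρw]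
        have h2 : HasSum (fun n => T (i, n)) (∑ n ∈ Finset.range (i.1 + i.2 + 1), T (i, n)) := by
          refine hasSum_sum_of_ne_finset_zero fun n hn => ?_
          simp only [hT, qBinom_eq_zero hq0 (show i.1 + i.2 < n by simpa using hn), zero_mul,
            mul_zero]
        convert h2 using 1
        simp only [hT]
        rw [Finset.mul_sum, Finset.mul_sum]
        refine Finset.sum_congr rfl fun n _ => ?_
        ring
    rw [← h1.unique H1]
    exact hTs.hasSum
  -- Reorders ((j, m), n) so that the sum over j is innermost; the pairs (m, n) are later grouped by
  -- N = m + n, the power of w.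
  let σ : (ℕ × ℕ) × ℕ ≃ (ℕ × ℕ) × ℕ :=
    ⟨fun x => ((x.2, x.1.1), x.1.2), fun x => ((x.1.2, x.2), x.1.1), fun _ => rfl, fun _ => rfl⟩
  set V : ℕ × ℕ → ℂ := fun p => L * (w ^ (p.1 + p.2) * (qExpCoeff q p.1 * D ^ p.1 *
      ∑ s ∈ Finset.HasAntidiagonal.antidiagonal p.2,
        qExpCoeff q s.1 * (q / q ^ p.2) ^ s.1 / qFac q q s.2 * (q ^ (p.1 * s.1) * f (q ^ s.1))))
    with hV
  have H2 : HasSum V (qMoment q h w ρ (fun t => f t * qInf (D * w * t) q)) := by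
    refine ((σ.hasSum_iff).2 hTsum).prod_fiberwise fun p => ?_
    have h1 : HasSum (fun j => ∑ s ∈ Finset.HasAntidiagonal.antidiagonal p.2,
        L * (w ^ (p.1 + p.2) * (qExpCoeff q p.1 * D ^ p.1 * (qExpCoeff q s.1 *
          (q / q ^ p.2) ^ s.1 / qFac q q s.2 * (q ^ (p.1 * s.1) * (a j * (q ^ s.1) ^ j))))))
        (∑ s ∈ Finset.HasAntidiagonal.antidiagonal p.2,
        L * (w ^ (p.1 + p.2) * (qExpCoeff q p.1 * D ^ p.1 * (qExpCoeff q s.1 *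
          (q / q ^ p.2) ^ s.1 / qFac q q s.2 * (q ^ (p.1 * s.1) * f (q ^ s.1)))))) := by
      refine hasSum_sum fun s _ => ?_
      refine HasSum.mul_left _ (HasSum.mul_left _ (HasSum.mul_left _ (HasSum.mul_left _
        (HasSum.mul_left _ (ha _ ?_)))))
      rw [norm_pow]
      exact (pow_le_one₀ (norm_nonneg q) hq.le).trans_lt (by linarith)
    simp only [hV, Finset.mul_sum]
    refine HasSum.congr_fun h1 fun j => ?_
    change L * (a j * (qExpCoeff q p.1 * (D * w) ^ p.1) * (qBinom q (j + p.1) p.2 * w ^ p.2)) = _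
    rw [qBinom, qFac_div_eq_sum hq, Finset.sum_mul, Finset.mul_sum, Finset.mul_sum]
    refine Finset.sum_congr rfl fun s _ => ?_
    have e : (q ^ (j + p.1) * q / q ^ p.2) ^ s.1 = (q / q ^ p.2) ^ s.1 * q ^ (p.1 * s.1) *
        (q ^ s.1) ^ j := by
      rw [mul_div_assoc, mul_pow, pow_add, mul_pow, ← pow_mul, ← pow_mul, ← pow_mul, mul_comm j]
      ring
    rw [e, mul_pow, pow_add]
    ring
  have H3 : HasSum (fun N => ∑ p ∈ Finset.HasAntidiagonal.antidiagonal N, V p)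
      (qMoment q h w ρ (fun t => f t * qInf (D * w * t) q)) := by
    refine ((Finset.HasAntidiagonal.sigmaAntidiagonalEquivProd.hasSum_iff).2 H2).sigma fun N => ?_
    exact Finset.hasSum (Finset.HasAntidiagonal.antidiagonal N) V
  refine HasSum.congr_fun H3 fun N => ?_
  rw [← sum_antidiagonal_qBinom_eq hq0 hq D (fun r => f (q ^ r)), Finset.mul_sum, Finset.mul_sum]
  refine Finset.sum_congr rfl fun p hp => ?_
  rw [← Finset.HasAntidiagonal.mem_antidiagonal.1 hp]

end


/-! ### Two evaluations of one contour integral. -/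

section

open Filter Topology Real

/-- The pair ±x supplies the even factors of (x²;q)_∞ and the pair ±sx the odd ones. It holds
already for finite products, with 2n factors on the right. -/
theorem qInf_mul_four {q s : ℂ} (hq : ‖q‖ < 1) (hs : s ^ 2 = q) (x : ℂ) :
    qInf x q * qInf (-x) q * qInf (s * x) q * qInf (-(s * x)) q = qInf (x ^ 2) q := by
  have h1 : ∀ n, qFac x q n * qFac (-x) q n * qFac (s * x) q n * qFac (-(s * x)) q n
      = qFac (x ^ 2) q (2 * n) := by
    intro n
    induction n with
    | zero => simp
    | succ n ih =>
      rw [show 2 * (n + 1) = 2 * n + 1 + 1 by ring, qFac_succ, qFac_succ (-x), qFac_succ (s * x),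
        qFac_succ (-(s * x)), qFac_succ (x ^ 2), qFac_succ (x ^ 2), ← ih, pow_succ q (2 * n),
        pow_mul' q 2 n]
      linear_combination qFac x q n * qFac (-x) q n * qFac (s * x) q n * qFac (-(s * x)) q n *
        (1 - x ^ 2 * (q ^ n) ^ 2) * (-x ^ 2 * (q ^ n) ^ 2) * hs
  have h2 := (((qInf_tendsto hq x).mul (qInf_tendsto hq (-x))).mul
    (qInf_tendsto hq (s * x))).mul (qInf_tendsto hq (-(s * x)))
  have h3 : Tendsto (fun n : ℕ => qFac (x ^ 2) q (2 * n)) atTop (𝓝 (qInf (x ^ 2) q)) :=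
    (qInf_tendsto hq (x ^ 2)).comp (tendsto_id.const_mul_atTop' (by norm_num))
  exact tendsto_nhds_unique (h2.congr h1) h3

theorem qInf_mul_pow_div {q : ℂ} (hq : ‖q‖ < 1) (x : ℂ) (r : ℕ) (hx : ‖x‖ < 1) :
    qInf (x * q ^ r) q = qInf x q / qFac x q r := by
  rw [qInf_eq_qFac_mul hq x r, mul_div_cancel_left₀ _ (qFac_ne_zero (mul_pow_ne_one hx hq) r)]

/-- The function f is designed so that f(q^r) (αβq^{2r};q)_{N-r} is, up to a constant, the r-th
weight on the left of `qSears`. At t = q^r the quotient (αβt;q)_∞ / (αβt²;q)_∞ becomes (αβq^r;q)_r,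
which completes (αβq^{2r};q)_{N-r} to (αβq^r;q)_N. -/
theorem qMoment_eq {q h w α β b : ℂ} (hq0 : q ≠ 0) (hq : ‖q‖ < 1) (hh : h ≠ 0) (hw : w ≠ 0)
    (hα : α ≠ 0) (hβ : β ≠ 0) (hb : b ≠ 0) (h1 : ∀ k : ℕ, β * b * q ^ k ≠ 1)
    (h2 : ∀ k : ℕ, q * α / b * q ^ k ≠ 1)
    {ρ : ℝ} (hρ1 : 1 < ρ) (hρw : ‖w‖ < ρ) (hρα : ρ * ‖α‖ < 1) (hρβ : ρ * ‖β‖ < 1) :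
    qMoment q h w ρ (fun t => qInf (β * b * t) q * qInf (q * α / b * t) q * qInf (α * β * t) q /
      (qInf (α * t) q * qInf (β * t) q * qInf (α * β * t ^ 2) q) * qInf (α * β * w * t) q) =
    qTheta h q * qTheta (h / w) q / qInf q q *
      (qInf (β * b) q * qInf (q * α / b) q / (qInf α q * qInf β q) *
      (qHyp [α, b] [β * b] q (β * w) * qHyp [β, q / b] [q * α / b] q (α * w))) := by
  have hρ0 : 0 < ρ := by linarith
  have hαn : 0 < ‖α‖ := norm_pos_iff.2 hα
  have hβn : 0 < ‖β‖ := norm_pos_iff.2 hβ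
  -- With R below 1/|α| and 1/|β|, the factors (αt;q)_∞, (βt;q)_∞ and (αβt²;q)_∞ have no zero for
  -- |t| < R, so f is holomorphic on a disc strictly larger than the contour.
  obtain ⟨R, hR1, hR2⟩ := exists_between (lt_min ((lt_div_iff₀ hαn).2 hρα) ((lt_div_iff₀ hβn).2 hρβ))
  have hRα := (lt_div_iff₀ hαn).1 (hR2.trans_le (min_le_left _ _))
  have hRβ := (lt_div_iff₀ hβn).1 (hR2.trans_le (min_le_right _ _))
  have hα1 : ‖α‖ < 1 := by nlinarith
  have hβ1 : ‖β‖ < 1 := by nlinarith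
  have hD1 : ‖α * β‖ < 1 := by rw [norm_mul]; nlinarith
  set f : ℂ → ℂ := fun t => qInf (β * b * t) q * qInf (q * α / b * t) q * qInf (α * β * t) q /
      (qInf (α * t) q * qInf (β * t) q * qInf (α * β * t ^ 2) q) with hf
  have hfd : DifferentiableOn ℂ f (Metric.ball 0 R) := by
    intro t ht
    have ht' : ‖t‖ < R := by simpa using ht
    have n1 : ‖α * t‖ < 1 := by rw [norm_mul]; nlinarith
    have n2 : ‖β * t‖ < 1 := by rw [norm_mul]; nlinarith
    have n3 : ‖α * β * t ^ 2‖ < 1 := by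
      rw [show α * β * t ^ 2 = (α * t) * (β * t) by ring, norm_mul]
      nlinarith [norm_nonneg (α * t), norm_nonneg (β * t)]
    refine DifferentiableAt.differentiableWithinAt (DifferentiableAt.div ?_ ?_ ?_)
    · exact ((differentiableAt_qInf hq (by fun_prop)).mul
        (differentiableAt_qInf hq (by fun_prop))).mul (differentiableAt_qInf hq (by fun_prop))
    · exact ((differentiableAt_qInf hq (by fun_prop)).mul
        (differentiableAt_qInf hq (by fun_prop))).mul (differentiableAt_qInf hq (by fun_prop))
    · exact mul_ne_zero (mul_ne_zero (qInf_ne_zero hq (mul_pow_ne_one n1 hq))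
        (qInf_ne_zero hq (mul_pow_ne_one n2 hq))) (qInf_ne_zero hq (mul_pow_ne_one n3 hq))
  have H1 := hasSum_qMoment_mul_qInf (h := h) hq0 hq hh hw hρ1 hρw hR1 hfd (α * β)
  have hβw : ‖β * w‖ < 1 := by rw [norm_mul]; nlinarith
  have hαw : ‖α * w‖ < 1 := by rw [norm_mul]; nlinarith
  have H2 := (hasSum_qHyp_mul (a₁ := α) (a₂ := b) (c₁ := β * b) (b₁ := β) (b₂ := q / b)
    (d₁ := q * α / b) hq hβw hαw).mul_left (qTheta h q * qTheta (h / w) q / qInf q q *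
      (qInf (β * b) q * qInf (q * α / b) q / (qInf α q * qInf β q)))
  rw [mul_assoc] at H2
  refine H1.unique (HasSum.congr_fun H2 fun N => ?_)
  rw [qMoment_one hq0 hq hh hw hρ1 hρw, mul_assoc]
  congr 1
  rw [mul_left_comm]
  congr 1
  rw [← qSears hq0 hq hα hb h1 h2 (mul_pow_ne_one hD1 hq) N, Finset.mul_sum]
  refine Finset.sum_congr rfl fun p hp => ?_
  refine Eq.trans ?_ (mul_left_comm _ _ _)
  congr 1
  set r := p.1
  have hpN : p.2 + r = N := by
    rw [add_comm]; exact Finset.HasAntidiagonal.mem_antidiagonal.1 hp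
  have g1 : qInf (β * b * q ^ r) q = qInf (β * b) q / qFac (β * b) q r := by
    rw [qInf_eq_qFac_mul hq (β * b) r, mul_div_cancel_left₀ _ (qFac_ne_zero h1 r)]
  have g2 : qInf (q * α / b * q ^ r) q = qInf (q * α / b) q / qFac (q * α / b) q r := by
    rw [qInf_eq_qFac_mul hq (q * α / b) r, mul_div_cancel_left₀ _ (qFac_ne_zero h2 r)]
  have hDr : ‖α * β * q ^ r‖ < 1 := by
    rw [norm_mul, norm_pow]
    have := pow_le_one₀ (n := r) (norm_nonneg q) hq.le
    nlinarith [norm_nonneg (α * β)]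
  have g3 : qInf (α * β * q ^ r) q = qFac (α * β * q ^ r) q r * qInf (α * β * (q ^ r) ^ 2) q := by
    rw [qInf_eq_qFac_mul hq (α * β * q ^ r) r]
    congr 2
    ring
  have g4 : qInf (α * β * (q ^ r) ^ 2) q ≠ 0 := by
    refine qInf_ne_zero hq (mul_pow_ne_one ?_ hq)
    rw [pow_two, ← mul_assoc, norm_mul, norm_pow]
    have := pow_le_one₀ (n := r) (norm_nonneg q) hq.le
    nlinarith [norm_nonneg (α * β * q ^ r)]
  have g5 : qFac (α * β * q ^ r) q N
      = qFac (α * β * q ^ r) q r * qFac (α * β * q ^ (2 * r)) q p.2 := by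
    rw [← hpN, add_comm, qFac_add]
    congr 2
    ring
  simp only [hf]
  rw [g1, g2, g3, g5, qInf_mul_pow_div hq α r hα1, qInf_mul_pow_div hq β r hβ1]
  generalize qInf (α * β * (q ^ r) ^ 2) q = X at g4
  simp only [div_eq_mul_inv, mul_inv, inv_inv]
  linear_combination qInf (β * b) q * (qFac (β * b) q r)⁻¹ * (qInf (q * α * b⁻¹) q *
    (qFac (q * α * b⁻¹) q r)⁻¹) * qFac (α * β * q ^ r) q r * ((qInf α q)⁻¹ * qFac α q r *
    ((qInf β q)⁻¹ * qFac β q r)) * qFac (α * β * q ^ (2 * r)) q p.2 * mul_inv_cancel₀ g4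

/-- The balanced series attached to the pole family of `x i`. -/
noncomputable def qResSeries (q w : ℂ) (x : Fin 6 → ℂ) (y : Fin 4 → ℂ) (i : Fin 6) : ℂ :=
  ∑' k : ℕ, qFac (x i) q k * qFac (x i * w) q k * (∏ j, qFac (q * x i / y j) q k) /
    (qFac q q k * ∏ l ∈ Finset.univ.erase i, qFac (q * x i / x l) q k) * q ^ k

theorem qResSeries_summable {q w : ℂ} (hq : ‖q‖ < 1) (x : Fin 6 → ℂ) (y : Fin 4 → ℂ) (i : Fin 6) :
    Summable fun k : ℕ => qFac (x i) q k * qFac (x i * w) q k * (∏ j, qFac (q * x i / y j) q k) /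
      (qFac q q k * ∏ l ∈ Finset.univ.erase i, qFac (q * x i / x l) q k) * q ^ k := by
  have h := qHypTerm_summable (x i :: x i * w :: (Finset.univ : Finset (Fin 4)).toList.map
    (fun j => q * x i / y j)) ((Finset.univ.erase i).toList.map (fun l => q * x i / x l)) q q
    (by simp) hq hq
  refine h.congr fun k => ?_
  simp [qHypTerm, qFacs, Finset.prod_map_toList, Function.comp_def, mul_assoc]

/-- The bounds on ρ leave a nonempty open interval, and the radii for which some circle meets a pole
are countable. -/
theorem exists_radius {q w : ℂ} (hq0 : q ≠ 0) {x : Fin 6 → ℂ} (hx : ∀ i, x i ≠ 0)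
    (h1 : ∀ i, ‖x i‖ < 1) (h2 : ∀ i, ‖x i * w‖ < 1) :
    ∃ ρ : ℝ, 1 < ρ ∧ ‖w‖ < ρ ∧ (∀ i, ρ * ‖x i‖ < 1) ∧
      ∀ i, ∀ k N : ℕ, ρ * ‖x i‖ * ‖q‖ ^ k ≠ ‖q‖ ^ N := by
  have hxn : ∀ i, 0 < ‖x i‖ := fun i => norm_pos_iff.2 (hx i)
  have hqn : 0 < ‖q‖ := norm_pos_iff.2 hq0
  obtain ⟨i0, hi0⟩ := Finite.exists_max fun i => ‖x i‖
  have hlt : max 1 ‖w‖ < 1 / ‖x i0‖ := by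
    refine max_lt ?_ ?_
    · rw [lt_div_iff₀ (hxn i0), one_mul]; exact h1 i0
    · rw [lt_div_iff₀ (hxn i0), ← norm_mul, mul_comm]; exact h2 i0
  set S : Set ℝ := Set.range fun p : Fin 6 × ℕ × ℕ => ‖q‖ ^ p.2.2 / (‖x p.1‖ * ‖q‖ ^ p.2.1)
  have hS : S.Countable := Set.countable_range _
  have hne : (Set.Ioo (max 1 ‖w‖) (1 / ‖x i0‖) \ S).Nonempty := by
    rw [Set.nonempty_iff_ne_empty, Ne, Set.sdiff_eq_empty]
    intro hsub
    exact (Cardinal.Real.Ioo_countable_iff.1 (hS.mono hsub)).not_gt hlt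
  obtain ⟨ρ, ⟨hρ1, hρ2⟩, hρS⟩ := hne
  have hρ1' := max_lt_iff.1 hρ1
  refine ⟨ρ, hρ1'.1, hρ1'.2, fun i => ?_, fun i k N h => hρS ⟨(i, k, N), ?_⟩⟩
  · have := (lt_div_iff₀ (hxn i0)).1 hρ2
    exact (mul_le_mul_of_nonneg_left (hi0 i) (by linarith)).trans_lt this
  · have := hxn i
    simp only
    rw [div_eq_iff (by positivity), ← h]
    ring

/-- `circleIntegral_qIntegrand` and `qMoment_eq` evaluate the same integral. The condition that α/β
is not an integral power of q keeps the six pole families disjoint, and |α|, |β|, |αw|, |βw| < 1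
leaves room for a radius. -/
theorem sum_qResCoeff_mul_qResSeries {q h w α β b A s : ℂ} (hq0 : q ≠ 0) (hq : ‖q‖ < 1)
    (hh : h ≠ 0) (hw : w ≠ 0) (hs : s ^ 2 = q) (hA : A ^ 2 = α * β)
    (hα : α ≠ 0) (hβ : β ≠ 0) (hb : b ≠ 0) (h1 : ∀ k : ℕ, β * b * q ^ k ≠ 1)
    (h2 : ∀ k : ℕ, q * α / b * q ^ k ≠ 1) (hαβ : ∀ k : ℤ, α / β ≠ q ^ k)
    (hα1 : ‖α‖ < 1) (hβ1 : ‖β‖ < 1) (hαw : ‖α * w‖ < 1) (hβw : ‖β * w‖ < 1) :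
    ∑ i, qResCoeff q h w ![α, β, A, -A, s * A, -(s * A)] ![β * b, q * α / b, α * β, α * β * w] i *
      qResSeries q w ![α, β, A, -A, s * A, -(s * A)] ![β * b, q * α / b, α * β, α * β * w] i =
    qTheta h q * qTheta (h / w) q *
      (qInf (β * b) q * qInf (q * α / b) q / (qInf α q * qInf β q) *
      (qHyp [α, b] [β * b] q (β * w) * qHyp [β, q / b] [q * α / b] q (α * w))) := by
  have hs0 : s ≠ 0 := by rintro rfl; simp at hs; exact hq0 hs.symm
  have hA0 : A ≠ 0 := by
    rintro rfl
    rw [zero_pow two_ne_zero] at hA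
    exact mul_ne_zero hα hβ hA.symm
  set x : Fin 6 → ℂ := ![α, β, A, -A, s * A, -(s * A)] with hxdef
  set y : Fin 4 → ℂ := ![β * b, q * α / b, α * β, α * β * w] with hydef
  have hx : ∀ i, x i ≠ 0 := by
    intro i
    fin_cases i <;> simp [hxdef, hα, hβ, hA0, hs0]
  have hy : ∀ i, y i ≠ 0 := by
    intro i
    fin_cases i <;> simp [hydef, hα, hβ, hb, hw, hq0]
  have hqn : 0 < ‖q‖ := norm_pos_iff.2 hq0
  have hzpow : ∀ k : ℤ, q ^ k = -1 → False := by
    intro k hk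
    have h3 := congrArg norm hk
    rw [norm_zpow, norm_neg, norm_one] at h3
    have hk0 : k = 0 := by
      by_contra hne
      exact hne ((zpow_eq_one_iff_right₀ hqn.le hq.ne).1 h3)
    rw [hk0] at hk
    norm_num at hk
  -- squares of quotients of distinct parameters
  have hsq : ∀ k : ℤ, (q ^ k) ^ 2 = q ^ (2 * k) := fun k => by
    rw [mul_comm, zpow_mul]; rfl
  -- An equality q^k = ±s would give q^{2k} = q, impossible by parity since |q| is neither 0 nor 1.
  have hodd : ∀ k : ℤ, q ^ k ≠ s ∧ q ^ k ≠ -s := by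
    have : ∀ k : ℤ, (q ^ k) ^ 2 ≠ q := by
      intro k hk
      rw [hsq] at hk
      have h3 := congrArg norm hk
      rw [norm_zpow] at h3
      have := zpow_right_injective₀ hqn hq.ne (a₂ := 1) (by simpa using h3)
      omega
    exact fun k => ⟨fun h => this k (by rw [h, hs]), fun h => this k (by rw [h, neg_sq, hs])⟩
  have hinv : ∀ u v : ℂ, (∀ k : ℤ, u ≠ v * q ^ k) → ∀ k : ℤ, v ≠ u * q ^ k := by
    intro u v huv k hk
    refine huv (-k) ?_
    rw [hk, mul_assoc, ← zpow_add₀ hq0]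
    simp
  have hab : ∀ k : ℤ, α ≠ β * q ^ k := fun k hk => hαβ k (by rw [hk, mul_div_cancel_left₀ _ hβ])
  -- The squared quotient of α or β by ±A or ±sA is α/β or its inverse up to a factor q^{±1}, so the
  -- hypothesis on α/β excludes these coincidences too.
  have key : ∀ u v : ℂ, u ^ 2 = v ^ 2 * (α / β) → v ≠ 0 → ∀ k : ℤ, u ≠ v * q ^ k := by
    intro u v huv hv k hk
    refine hαβ (2 * k) ?_
    rw [hk, mul_pow, hsq] at huv
    exact (mul_left_cancel₀ (pow_ne_zero 2 hv) huv).symm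
  have key' : ∀ u v : ℂ, q * u ^ 2 = v ^ 2 * (α / β) → v ≠ 0 → ∀ k : ℤ, u ≠ v * q ^ k := by
    intro u v huv hv k hk
    refine hαβ (2 * k + 1) ?_
    rw [hk, mul_pow, hsq] at huv
    rw [zpow_add₀ hq0, zpow_one]
    refine (mul_left_cancel₀ (pow_ne_zero 2 hv) ?_).symm
    rw [← huv]; ring
  have key2 : ∀ u v : ℂ, u ^ 2 = q * (v ^ 2 * (α / β)) → v ≠ 0 → ∀ k : ℤ, u ≠ v * q ^ k := by
    intro u v huv hv k hk
    refine hαβ (2 * k - 1) ?_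
    rw [hk, mul_pow, hsq] at huv
    rw [zpow_sub₀ hq0, zpow_one, eq_div_iff hq0]
    refine (mul_left_cancel₀ (pow_ne_zero 2 hv) ?_).symm
    rw [huv]; ring
  have hneg : ∀ u : ℂ, u ≠ 0 → ∀ k : ℤ, u ≠ -u * q ^ k := by
    intro u hu k hk
    refine hzpow k (mul_left_cancel₀ hu ?_)
    linear_combination hk
  have hs1 : ∀ k : ℤ, s * A ≠ A * q ^ k := fun k hk =>
    (hodd k).1 (mul_left_cancel₀ hA0 (by linear_combination -hk))
  have hs2 : ∀ k : ℤ, s * A ≠ -A * q ^ k := fun k hk =>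
    (hodd k).2 (mul_left_cancel₀ hA0 (by linear_combination hk))
  have hs3 : ∀ k : ℤ, -(s * A) ≠ A * q ^ k := fun k hk =>
    (hodd k).2 (mul_left_cancel₀ hA0 (by linear_combination -hk))
  have hs4 : ∀ k : ℤ, -(s * A) ≠ -A * q ^ k := fun k hk =>
    (hodd k).1 (mul_left_cancel₀ hA0 (by linear_combination hk))
  have hsA : s * A ≠ 0 := mul_ne_zero hs0 hA0
  have e1 : α ^ 2 = A ^ 2 * (α / β) := by rw [hA]; field_simp
  have e2 : A ^ 2 = β ^ 2 * (α / β) := by rw [hA]; field_simp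
  have e3 : q * α ^ 2 = (s * A) ^ 2 * (α / β) := by rw [mul_pow, hs, hA]; field_simp
  have e4 : (s * A) ^ 2 = q * (β ^ 2 * (α / β)) := by rw [mul_pow, hs, hA]; field_simp
  have e1n : α ^ 2 = (-A) ^ 2 * (α / β) := by rw [neg_sq]; exact e1
  have e2n : (-A) ^ 2 = β ^ 2 * (α / β) := by rw [neg_sq]; exact e2
  have e3n : q * α ^ 2 = (-(s * A)) ^ 2 * (α / β) := by rw [neg_sq]; exact e3
  have e4n : (-(s * A)) ^ 2 = q * (β ^ 2 * (α / β)) := by rw [neg_sq]; exact e4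
  have hlt : ∀ i l : Fin 6, i < l → ∀ k : ℤ, x i ≠ x l * q ^ k := by
    intro i l hil
    fin_cases i <;> fin_cases l <;> first | exact absurd hil (by decide) | skip
    · exact hab
    · exact key _ _ e1 hA0
    · exact key _ _ e1n (neg_ne_zero.2 hA0)
    · exact key' _ _ e3 hsA
    · exact key' _ _ e3n (neg_ne_zero.2 hsA)
    · exact hinv _ _ (key _ _ e2 hβ)
    · exact hinv _ _ (key _ _ e2n hβ)
    · exact hinv _ _ (key2 _ _ e4 hβ)
    · exact hinv _ _ (key2 _ _ e4n hβ)
    · exact hneg _ hA0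
    · exact hinv _ _ hs1
    · exact hinv _ _ hs3
    · exact hinv _ _ hs2
    · exact hinv _ _ hs4
    · exact hneg _ hsA
  have hxx : ∀ i l, i ≠ l → ∀ k : ℤ, x i ≠ x l * q ^ k := by
    intro i l hil
    rcases lt_or_gt_of_ne hil with h3 | h3
    · exact hlt i l h3
    · exact hinv _ _ (hlt l i h3)
  -- Both sides equal q α³ β³ w; this is the balancing condition needed for decay at infinity.
  have hxy : ∏ j, y j = w * ∏ i, x i := by
    simp only [Fin.prod_univ_four, Fin.prod_univ_six]
    simp only [hxdef, hydef, Matrix.cons_val]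
    have : β * b * (q * α / b) * (α * β) * (α * β * w) = q * α ^ 3 * β ^ 3 * w := by field_simp
    rw [this]
    linear_combination -(w * α * β * A ^ 4) * hs - w * α * β * q * (A ^ 2 + α * β) * hA
  have hsn : ‖s‖ < 1 := by
    have := congrArg norm hs
    rw [norm_pow] at this
    nlinarith [norm_nonneg s]
  have hAn : ‖A‖ < 1 := by
    have := congrArg norm hA
    rw [norm_pow, norm_mul] at this
    nlinarith [norm_nonneg A, norm_nonneg α, norm_nonneg β]
  have hAw : ‖A * w‖ < 1 := by
    have : (A * w) ^ 2 = (α * w) * (β * w) := by rw [mul_pow, hA]; ring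
    have := congrArg norm this
    rw [norm_pow, norm_mul (α * w)] at this
    nlinarith [norm_nonneg (A * w), norm_nonneg (α * w), norm_nonneg (β * w)]
  have hsAn : ‖s * A‖ < 1 := by
    rw [norm_mul]; nlinarith [norm_nonneg s, norm_nonneg A]
  have hsAw : ‖s * A * w‖ < 1 := by
    rw [mul_assoc, norm_mul]; nlinarith [norm_nonneg s, norm_nonneg (A * w)]
  have hxi : ∀ i, ‖x i‖ < 1 := by
    intro i
    fin_cases i <;> simp only [hxdef] <;> simp [hα1, hβ1, hAn] <;> simpa using hsAn
  have hxw : ∀ i, ‖x i * w‖ < 1 := by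
    intro i
    fin_cases i
    · exact hαw
    · exact hβw
    · exact hAw
    · change ‖-A * w‖ < 1
      rw [neg_mul, norm_neg]; exact hAw
    · exact hsAw
    · change ‖-(s * A) * w‖ < 1
      rw [neg_mul, norm_neg]; exact hsAw
  obtain ⟨ρ, hρ1, hρw, hρx, hav⟩ := exists_radius hq0 hx hxi hxw
  have hρ0 : 0 < ρ := by linarith
  have hres : ∀ i k, qResidue q h w x y i k = qResCoeff q h w x y i / qInf q q *
      (qFac (x i) q k * qFac (x i * w) q k * (∏ j, qFac (q * x i / y j) q k) /
        (qFac q q k * ∏ l ∈ Finset.univ.erase i, qFac (q * x i / x l) q k) * q ^ k) :=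
    fun i k => qResidue_eq hq0 hq hh hw hx hy hxy i (hxi i) (hxw i) k
  have hsum : ∀ i, Summable (qResidue q h w x y i) := fun i =>
    ((qResSeries_summable hq x y i).mul_left (qResCoeff q h w x y i / qInf q q)).congr
      fun k => (hres i k).symm
  have H1 := circleIntegral_qIntegrand hq0 hq hh hw hx hxx hxy hρ1 hρw hρx hav hsum
  have H2 := qMoment_eq (h := h) hq0 hq hh hw hα hβ hb h1 h2 hρ1 hρw (hρx 0) (hρx 1)
  have hI : ∀ t, qIntegrand q h w x y t = qInf (β * b * t) q * qInf (q * α / b * t) q *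
      qInf (α * β * t) q / (qInf (α * t) q * qInf (β * t) q * qInf (α * β * t ^ 2) q) *
      qInf (α * β * w * t) q * qKernel q h w t := by
    intro t
    have h4 := qInf_mul_four hq hs (A * t)
    rw [mul_pow, hA] at h4
    rw [qIntegrand, Fin.prod_univ_four, Fin.prod_univ_six, ← h4]
    simp only [hxdef, hydef, Matrix.cons_val, neg_mul, mul_assoc s A t, div_eq_mul_inv, mul_inv]
    ring
  rw [qMoment, circleAverage_eq_circleIntegral hρ0.ne'] at H2
  have hII : (∮ t in C(0, ρ), qIntegrand q h w x y t / t) = ∮ t in C(0, ρ), (t - 0)⁻¹ •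
      (qInf (β * b * t) q * qInf (q * α / b * t) q * qInf (α * β * t) q / (qInf (α * t) q *
      qInf (β * t) q * qInf (α * β * t ^ 2) q) * qInf (α * β * w * t) q * qKernel q h w t) := by
    congr 1
    funext t
    rw [hI, sub_zero, smul_eq_mul, div_eq_inv_mul]
  rw [← hII, H1, smul_eq_mul, inv_mul_cancel_left₀ (by simp [Real.pi_ne_zero])] at H2
  have hq1 := qInf_self_ne_zero hq
  have h5 : ∑ i, ∑' k, qResidue q h w x y i k
      = (qInf q q)⁻¹ * ∑ i, qResCoeff q h w x y i * qResSeries q w x y i := by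
    rw [Finset.mul_sum]
    refine Finset.sum_congr rfl fun i _ => ?_
    rw [qResSeries, tsum_congr (hres i), tsum_mul_left]
    ring
  rw [h5, inv_mul_eq_iff_eq_mul₀ hq1] at H2
  rw [H2]
  field_simp

end


/-! ### Specialisation: the six pole families become the terms T₁ to T₄. -/

/-- The first term of the product formula, with `a = u²`, `b = v²`, `c = t²`. -/
noncomputable def qProdTerm₁ (q z h s u v t : ℂ) : ℂ :=
  qThetas [h * u ^ 2, h * (t ^ 2 / (u ^ 2 * v ^ 2 * z))] q
      * qInfs [q / v ^ 2, t ^ 2 / u ^ 2, t ^ 2 / v ^ 2, t ^ 2 / v ^ 2] q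
    / qInfs [t ^ 2, t ^ 2 / (u ^ 2 * v ^ 2), t ^ 2 / (u ^ 2 * v ^ 2), q * u ^ 2 / v ^ 2] q
    * qHyp [u ^ 2, v ^ 2, q * u ^ 2 / t ^ 2, q * v ^ 2 / t ^ 2, u ^ 2 * v ^ 2 * z / t ^ 2, q / z]
        [q * u ^ 2 * v ^ 2 / t ^ 2, s * u * v / t, -(s * u * v / t),
          q * (u * v / t), -(q * (u * v / t))] q q

/-- The second term of the product formula, with `a = u²`, `b = v²`, `c = t²`. -/
noncomputable def qProdTerm₂ (q z h s u v t : ℂ) : ℂ :=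
  qThetas [h * (t ^ 2 / v ^ 2), h / z] q
      * qInfs [u ^ 2, u ^ 2, v ^ 2, q * u ^ 2 / t ^ 2, u ^ 2 * v ^ 2 * z / t ^ 2,
          u ^ 2 * v ^ 2 * z / t ^ 2] q
    / qInfs [z, z, t ^ 2, q * u ^ 2 / v ^ 2, u ^ 2 * v ^ 2 / t ^ 2, u ^ 2 * v ^ 2 / t ^ 2] q
    * qHyp [q / u ^ 2, q / v ^ 2, t ^ 2 / u ^ 2, t ^ 2 / v ^ 2, z,
          q * t ^ 2 / (u ^ 2 * v ^ 2 * z)]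
        [q * t ^ 2 / (u ^ 2 * v ^ 2), s * t / (u * v), -(s * t / (u * v)),
          q * (t / (u * v)), -(q * (t / (u * v)))] q q

/-- The third term of the product formula, with `a = u²`, `b = v²`, `c = t²`. -/
noncomputable def qProdTerm₃ (q z h s u v t : ℂ) : ℂ :=
  qThetas [h * (u * t / v), h / z * (t / (u * v)), v * t / u] q
      * qInfs [u ^ 2, t ^ 2 / v ^ 2, u ^ 2 * v ^ 2 * z / t ^ 2] q
    / qInfs [-1, s, -s, z, t ^ 2, q * u ^ 2 / v ^ 2, t / (u * v), u * v / t] q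
    * qHyp [u * t / v, v * t / u, q * (u / (v * t)), q * (v / (u * t)),
          z * (u * v / t), q / z * (t / (u * v))]
        [-q, s, -s, q * (u * v / t), q * (t / (u * v))] q q

/-- The fourth term of the product formula, with `a = u²`, `b = v²`, `c = t²`. -/
noncomputable def qProdTerm₄ (q z h s u v t : ℂ) : ℂ :=
  qThetas [h * (s * u * t / v), h / z * (t / (s * u * v))] q
      * qInfs [u ^ 2, t ^ 2 / v ^ 2, u ^ 2 * v ^ 2 * z / t ^ 2, u * t / (s * v), v * t / (s * u),
          s * u / (v * t), z * (u * v / (s * t))] q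
    / qInfs [-1, 1 / s, -(1 / s), z, t ^ 2, q * u ^ 2 / v ^ 2, s * u * t / v,
          t / (s * u * v), u * v / (s * t), z * (s * u * v / t)] q
    * qHyp [s * u * t / v, s * v * t / u, s ^ 3 * u / (v * t), s ^ 3 * v / (u * t),
          z * (s * u * v / t), 1 / z * (s ^ 3 * t / (u * v))]
        [-q, s ^ 3, -s ^ 3, s ^ 3 * u * v / t, s ^ 3 * t / (u * v)] q q

theorem prod_erase_zero (f : Fin 6 → ℂ) :
    ∏ l ∈ Finset.univ.erase 0, f l = f 1 * f 2 * f 3 * f 4 * f 5 := by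
  rw [show (Finset.univ.erase 0 : Finset (Fin 6)) = {1, 2, 3, 4, 5} by decide]
  simp [mul_assoc]

theorem prod_erase_one (f : Fin 6 → ℂ) :
    ∏ l ∈ Finset.univ.erase 1, f l = f 0 * f 2 * f 3 * f 4 * f 5 := by
  rw [show (Finset.univ.erase 1 : Finset (Fin 6)) = {0, 2, 3, 4, 5} by decide]
  simp [mul_assoc]

theorem prod_erase_two (f : Fin 6 → ℂ) :
    ∏ l ∈ Finset.univ.erase 2, f l = f 0 * f 1 * f 3 * f 4 * f 5 := by
  rw [show (Finset.univ.erase 2 : Finset (Fin 6)) = {0, 1, 3, 4, 5} by decide]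
  simp [mul_assoc]

theorem prod_erase_three (f : Fin 6 → ℂ) :
    ∏ l ∈ Finset.univ.erase 3, f l = f 0 * f 1 * f 2 * f 4 * f 5 := by
  rw [show (Finset.univ.erase 3 : Finset (Fin 6)) = {0, 1, 2, 4, 5} by decide]
  simp [mul_assoc]

theorem prod_erase_four (f : Fin 6 → ℂ) :
    ∏ l ∈ Finset.univ.erase 4, f l = f 0 * f 1 * f 2 * f 3 * f 5 := by
  rw [show (Finset.univ.erase 4 : Finset (Fin 6)) = {0, 1, 2, 3, 5} by decide]
  simp [mul_assoc]

theorem prod_erase_five (f : Fin 6 → ℂ) :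
    ∏ l ∈ Finset.univ.erase 5, f l = f 0 * f 1 * f 2 * f 3 * f 4 := by
  rw [show (Finset.univ.erase 5 : Finset (Fin 6)) = {0, 1, 2, 3, 4} by decide]
  simp [mul_assoc]

theorem qHyp_six_five (q a₁ a₂ a₃ a₄ a₅ a₆ b₁ b₂ b₃ b₄ b₅ : ℂ) :
    qHyp [a₁, a₂, a₃, a₄, a₅, a₆] [b₁, b₂, b₃, b₄, b₅] q q = ∑' k : ℕ,
      qFac a₁ q k * qFac a₂ q k * qFac a₃ q k * qFac a₄ q k * qFac a₅ q k * qFac a₆ q k /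
      (qFac q q k * (qFac b₁ q k * qFac b₂ q k * qFac b₃ q k * qFac b₄ q k * qFac b₅ q k)) *
      q ^ k := by
  refine tsum_congr fun k => ?_
  simp [qHypTerm, qFacs, mul_assoc]

/-- The parameters `x_i` of the contour integral. -/
noncomputable def qPoles (s u v t : ℂ) : Fin 6 → ℂ :=
  ![u ^ 2, t ^ 2 / v ^ 2, u * t / v, -(u * t / v), s * (u * t / v), -(s * (u * t / v))]

/-- The parameters `y_j` of the contour integral. -/
noncomputable def qZeros (q z u v t : ℂ) : Fin 4 → ℂ :=
  ![t ^ 2 / v ^ 2 * v ^ 2, q * u ^ 2 / v ^ 2, u ^ 2 * (t ^ 2 / v ^ 2),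
    u ^ 2 * (t ^ 2 / v ^ 2) * (z * v ^ 2 / t ^ 2)]

/-- The factor by which `qResCoeff` is multiplied in the product formula. -/
noncomputable def qProdFactor (q z u v t : ℂ) : ℂ :=
  qInf (u ^ 2) q * qInf (t ^ 2 / v ^ 2) q * qInf (u ^ 2 * (z * v ^ 2 / t ^ 2)) q /
    (qInf (t ^ 2) q * qInf (q * u ^ 2 / v ^ 2) q * qInf z q)

/-- Family of α = a. The four products with ±A/α and ±sA/α merge by `qInf_mul_four` into a second
copy of (c/(ab);q)_∞, which explains the repeated factor in the denominator of T₁. -/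
theorem qProdTerm₁_eq {q z h s u v t : ℂ} (hq : ‖q‖ < 1) (hs : s ^ 2 = q) (hs0 : s ≠ 0)
    (hz : z ≠ 0) (hu : u ≠ 0) (hv : v ≠ 0) (ht : t ≠ 0) (hu1 : qInf (u ^ 2) q ≠ 0)
    (hz1 : qInf z q ≠ 0) (hl : qInf (u ^ 2 * (z * v ^ 2 / t ^ 2)) q ≠ 0) :
    qProdTerm₁ q z h s u v t = qProdFactor q z u v t *
      (qResCoeff q h (z * v ^ 2 / t ^ 2) (qPoles s u v t) (qZeros q z u v t) 0 *
      qResSeries q (z * v ^ 2 / t ^ 2) (qPoles s u v t) (qZeros q z u v t) 0) := by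
  have p1 : q * u ^ 2 / (t ^ 2 / v ^ 2 * v ^ 2) = q * u ^ 2 / t ^ 2 := by field_simp
  have p2 : q * u ^ 2 / (q * u ^ 2 / v ^ 2) = v ^ 2 := by rw [← hs]; field_simp
  have p3 : q * u ^ 2 / (u ^ 2 * (t ^ 2 / v ^ 2)) = q * v ^ 2 / t ^ 2 := by field_simp
  have p4 : q * u ^ 2 / (u ^ 2 * (t ^ 2 / v ^ 2) * (z * v ^ 2 / t ^ 2)) = q / z := by field_simp
  have p5 : u ^ 2 * (z * v ^ 2 / t ^ 2) = u ^ 2 * v ^ 2 * z / t ^ 2 := by ring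
  have r1 : q * u ^ 2 / (t ^ 2 / v ^ 2) = q * u ^ 2 * v ^ 2 / t ^ 2 := by field_simp
  have r2 : q * u ^ 2 / (u * t / v) = q * (u * v / t) := by field_simp
  have r3 : q * u ^ 2 / -(u * t / v) = -(q * (u * v / t)) := by rw [div_neg, r2]
  have r4 : q * u ^ 2 / (s * (u * t / v)) = s * u * v / t := by rw [← hs]; field_simp
  have r5 : q * u ^ 2 / -(s * (u * t / v)) = -(s * u * v / t) := by rw [div_neg, r4]
  have hS : qResSeries q (z * v ^ 2 / t ^ 2) (qPoles s u v t) (qZeros q z u v t) 0 =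
      qHyp [u ^ 2, v ^ 2, q * u ^ 2 / t ^ 2, q * v ^ 2 / t ^ 2, u ^ 2 * v ^ 2 * z / t ^ 2, q / z]
        [q * u ^ 2 * v ^ 2 / t ^ 2, s * u * v / t, -(s * u * v / t),
          q * (u * v / t), -(q * (u * v / t))] q q := by
    rw [qHyp_six_five]
    refine tsum_congr fun k => ?_
    rw [Fin.prod_univ_four, prod_erase_zero]
    simp only [qPoles, qZeros, Matrix.cons_val]
    rw [p1, p2, p3, p4, p5, r1, r2, r3, r4, r5]
    simp only [div_eq_mul_inv, mul_inv]
    ring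
  have f1 : t ^ 2 / v ^ 2 * v ^ 2 / u ^ 2 = t ^ 2 / u ^ 2 := by field_simp
  have f2 : q * u ^ 2 / v ^ 2 / u ^ 2 = q / v ^ 2 := by field_simp
  have f3 : u ^ 2 * (t ^ 2 / v ^ 2) / u ^ 2 = t ^ 2 / v ^ 2 := by field_simp
  have f4 : u ^ 2 * (t ^ 2 / v ^ 2) * (z * v ^ 2 / t ^ 2) / u ^ 2 = z := by field_simp
  have g0 : h / (u ^ 2 * (z * v ^ 2 / t ^ 2)) = h * (t ^ 2 / (u ^ 2 * v ^ 2 * z)) := by field_simp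
  have g1 : t ^ 2 / v ^ 2 / u ^ 2 = t ^ 2 / (u ^ 2 * v ^ 2) := by field_simp
  have g2 := qInf_mul_four hq hs (u * t / v / u ^ 2)
  rw [show (u * t / v / u ^ 2) ^ 2 = t ^ 2 / (u ^ 2 * v ^ 2) by field_simp, ← neg_div,
    show s * (u * t / v / u ^ 2) = s * (u * t / v) / u ^ 2 by ring,
    ← neg_div (u ^ 2) (s * (u * t / v))] at g2
  have g3 : ∀ X, X * qInf (u * t / v / u ^ 2) q * qInf (-(u * t / v) / u ^ 2) q *
      qInf (s * (u * t / v) / u ^ 2) q * qInf (-(s * (u * t / v)) / u ^ 2) q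
      = X * qInf (t ^ 2 / (u ^ 2 * v ^ 2)) q := fun X => by linear_combination X * g2
  rw [hS, qProdTerm₁, ← mul_assoc, qProdFactor, qResCoeff, Fin.prod_univ_four, prod_erase_zero]
  congr 1
  simp only [qPoles, qZeros, Matrix.cons_val, qThetas, qInfs, List.map_cons, List.map_nil,
    List.prod_cons, List.prod_nil, mul_one]
  rw [f1, f2, f3, f4, g0, g1, g3]
  simp only [div_eq_mul_inv, mul_inv] at hl ⊢
  generalize qInf (u ^ 2) q = A at *
  generalize qInf z q = B at *
  generalize qInf (u ^ 2 * (z * v ^ 2 * (t ^ 2)⁻¹)) q = C at *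
  -- Factors common to `qProdFactor` and `qResCoeff` are absent from T₁; they are reinserted as a
  -- product equal to 1.
  have e : A * A⁻¹ * (B * B⁻¹) * (C * C⁻¹) = 1 := by
    rw [mul_inv_cancel₀ hu1, mul_inv_cancel₀ hz1, mul_inv_cancel₀ hl]; norm_num
  refine (mul_one _).symm.trans (Eq.trans (congrArg _ e.symm) ?_)
  ring

/-- Family of β = c/b. The same merging yields the repeated (ab/c;q)_∞. -/
theorem qProdTerm₂_eq {q z h s u v t : ℂ} (hq : ‖q‖ < 1) (hs : s ^ 2 = q) (hs0 : s ≠ 0)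
    (hz : z ≠ 0) (hu : u ≠ 0) (hv : v ≠ 0) (ht : t ≠ 0) (ht1 : qInf (t ^ 2 / v ^ 2) q ≠ 0) :
    qProdTerm₂ q z h s u v t = qProdFactor q z u v t *
      (qResCoeff q h (z * v ^ 2 / t ^ 2) (qPoles s u v t) (qZeros q z u v t) 1 *
      qResSeries q (z * v ^ 2 / t ^ 2) (qPoles s u v t) (qZeros q z u v t) 1) := by
  have p1 : q * (t ^ 2 / v ^ 2) / (t ^ 2 / v ^ 2 * v ^ 2) = q / v ^ 2 := by field_simp
  have p2 : q * (t ^ 2 / v ^ 2) / (q * u ^ 2 / v ^ 2) = t ^ 2 / u ^ 2 := by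
    rw [← hs]; field_simp
  have p3 : q * (t ^ 2 / v ^ 2) / (u ^ 2 * (t ^ 2 / v ^ 2)) = q / u ^ 2 := by field_simp
  have p4 : q * (t ^ 2 / v ^ 2) / (u ^ 2 * (t ^ 2 / v ^ 2) * (z * v ^ 2 / t ^ 2))
      = q * t ^ 2 / (u ^ 2 * v ^ 2 * z) := by field_simp
  have p5 : t ^ 2 / v ^ 2 * (z * v ^ 2 / t ^ 2) = z := by field_simp
  have r1 : q * (t ^ 2 / v ^ 2) / u ^ 2 = q * t ^ 2 / (u ^ 2 * v ^ 2) := by field_simp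
  have r2 : q * (t ^ 2 / v ^ 2) / (u * t / v) = q * (t / (u * v)) := by field_simp
  have r3 : q * (t ^ 2 / v ^ 2) / -(u * t / v) = -(q * (t / (u * v))) := by rw [div_neg, r2]
  have r4 : q * (t ^ 2 / v ^ 2) / (s * (u * t / v)) = s * t / (u * v) := by rw [← hs]; field_simp
  have r5 : q * (t ^ 2 / v ^ 2) / -(s * (u * t / v)) = -(s * t / (u * v)) := by rw [div_neg, r4]
  have hS : qResSeries q (z * v ^ 2 / t ^ 2) (qPoles s u v t) (qZeros q z u v t) 1 =
      qHyp [q / u ^ 2, q / v ^ 2, t ^ 2 / u ^ 2, t ^ 2 / v ^ 2, z,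
          q * t ^ 2 / (u ^ 2 * v ^ 2 * z)]
        [q * t ^ 2 / (u ^ 2 * v ^ 2), s * t / (u * v), -(s * t / (u * v)),
          q * (t / (u * v)), -(q * (t / (u * v)))] q q := by
    rw [qHyp_six_five]
    refine tsum_congr fun k => ?_
    rw [Fin.prod_univ_four, prod_erase_one]
    simp only [qPoles, qZeros, Matrix.cons_val]
    rw [p1, p2, p3, p4, p5, r1, r2, r3, r4, r5]
    simp only [div_eq_mul_inv, mul_inv]
    ring
  have f1 : t ^ 2 / v ^ 2 * v ^ 2 / (t ^ 2 / v ^ 2) = v ^ 2 := by field_simp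
  have f2 : q * u ^ 2 / v ^ 2 / (t ^ 2 / v ^ 2) = q * u ^ 2 / t ^ 2 := by field_simp
  have f3 : u ^ 2 * (t ^ 2 / v ^ 2) / (t ^ 2 / v ^ 2) = u ^ 2 := by field_simp
  have f4 : u ^ 2 * (t ^ 2 / v ^ 2) * (z * v ^ 2 / t ^ 2) / (t ^ 2 / v ^ 2)
      = u ^ 2 * v ^ 2 * z / t ^ 2 := by field_simp
  have f5 : u ^ 2 * (z * v ^ 2 / t ^ 2) = u ^ 2 * v ^ 2 * z / t ^ 2 := by ring
  have g1 : u ^ 2 / (t ^ 2 / v ^ 2) = u ^ 2 * v ^ 2 / t ^ 2 := by field_simp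
  have g2 := qInf_mul_four hq hs (u * t / v / (t ^ 2 / v ^ 2))
  rw [show (u * t / v / (t ^ 2 / v ^ 2)) ^ 2 = u ^ 2 * v ^ 2 / t ^ 2 by field_simp, ← neg_div,
    show s * (u * t / v / (t ^ 2 / v ^ 2)) = s * (u * t / v) / (t ^ 2 / v ^ 2) by ring,
    ← neg_div (t ^ 2 / v ^ 2) (s * (u * t / v))] at g2
  have g3 : ∀ X, X * qInf (u * t / v / (t ^ 2 / v ^ 2)) q * qInf (-(u * t / v) / (t ^ 2 / v ^ 2)) q *
      qInf (s * (u * t / v) / (t ^ 2 / v ^ 2)) q * qInf (-(s * (u * t / v)) / (t ^ 2 / v ^ 2)) q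
      = X * qInf (u ^ 2 * v ^ 2 / t ^ 2) q := fun X => by linear_combination X * g2
  rw [hS, qProdTerm₂, ← mul_assoc, qProdFactor, qResCoeff, Fin.prod_univ_four, prod_erase_one]
  congr 1
  simp only [qPoles, qZeros, Matrix.cons_val, qThetas, qInfs, List.map_cons, List.map_nil,
    List.prod_cons, List.prod_nil, mul_one]
  rw [f1, f2, f3, f4, f5, p5, g1, g3]
  simp only [div_eq_mul_inv, mul_inv] at ht1 ⊢
  refine (mul_one _).symm.trans (Eq.trans (congrArg _ (mul_inv_cancel₀ ht1).symm) ?_)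
  ring

/-- Family of A. Here the numerator parameters y₀/A and y₁/A have product q, so their infinite
products form the theta factor ϑ(√(bc/a);q). -/
theorem qProdTerm₃_eq {q z h s u v t : ℂ} (hs : s ^ 2 = q) (hs0 : s ≠ 0)
    (hz : z ≠ 0) (hu : u ≠ 0) (hv : v ≠ 0) (ht : t ≠ 0) (hA : qInf (u * t / v) q ≠ 0)
    (hAw : qInf (z * (u * v / t)) q ≠ 0) :
    qProdTerm₃ q z h s u v t = qProdFactor q z u v t *
      (qResCoeff q h (z * v ^ 2 / t ^ 2) (qPoles s u v t) (qZeros q z u v t) 2 *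
      qResSeries q (z * v ^ 2 / t ^ 2) (qPoles s u v t) (qZeros q z u v t) 2) := by
  have p1 : q * (u * t / v) / (t ^ 2 / v ^ 2 * v ^ 2) = q * (u / (v * t)) := by field_simp
  have p2 : q * (u * t / v) / (q * u ^ 2 / v ^ 2) = v * t / u := by rw [← hs]; field_simp
  have p3 : q * (u * t / v) / (u ^ 2 * (t ^ 2 / v ^ 2)) = q * (v / (u * t)) := by field_simp
  have p4 : q * (u * t / v) / (u ^ 2 * (t ^ 2 / v ^ 2) * (z * v ^ 2 / t ^ 2))
      = q / z * (t / (u * v)) := by field_simp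
  have p5 : u * t / v * (z * v ^ 2 / t ^ 2) = z * (u * v / t) := by field_simp
  have r1 : q * (u * t / v) / u ^ 2 = q * (t / (u * v)) := by field_simp
  have r2 : q * (u * t / v) / (t ^ 2 / v ^ 2) = q * (u * v / t) := by field_simp
  have r3 : q * (u * t / v) / -(u * t / v) = -q := by field_simp
  have r4 : q * (u * t / v) / (s * (u * t / v)) = s := by rw [← hs]; field_simp
  have r5 : q * (u * t / v) / -(s * (u * t / v)) = -s := by rw [div_neg, r4]
  have hS : qResSeries q (z * v ^ 2 / t ^ 2) (qPoles s u v t) (qZeros q z u v t) 2 =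
      qHyp [u * t / v, v * t / u, q * (u / (v * t)), q * (v / (u * t)),
          z * (u * v / t), q / z * (t / (u * v))]
        [-q, s, -s, q * (u * v / t), q * (t / (u * v))] q q := by
    rw [qHyp_six_five]
    refine tsum_congr fun k => ?_
    rw [Fin.prod_univ_four, prod_erase_two]
    simp only [qPoles, qZeros, Matrix.cons_val]
    rw [p1, p2, p3, p4, p5, r1, r2, r3, r4, r5]
    simp only [div_eq_mul_inv, mul_inv]
    ring
  have f1 : t ^ 2 / v ^ 2 * v ^ 2 / (u * t / v) = v * t / u := by field_simp
  have f2 : q * u ^ 2 / v ^ 2 / (u * t / v) = q / (v * t / u) := by field_simp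
  have f3 : u ^ 2 * (t ^ 2 / v ^ 2) / (u * t / v) = u * t / v := by field_simp
  have f4 : u ^ 2 * (t ^ 2 / v ^ 2) * (z * v ^ 2 / t ^ 2) / (u * t / v)
      = z * (u * v / t) := by field_simp
  have f5 : u ^ 2 * (z * v ^ 2 / t ^ 2) = u ^ 2 * v ^ 2 * z / t ^ 2 := by ring
  have f6 : h / (z * (u * v / t)) = h / z * (t / (u * v)) := by field_simp
  have g1 : u ^ 2 / (u * t / v) = u * v / t := by field_simp
  have g2 : t ^ 2 / v ^ 2 / (u * t / v) = t / (u * v) := by field_simp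
  have g3 : -(u * t / v) / (u * t / v) = -1 := by field_simp
  have g4 : s * (u * t / v) / (u * t / v) = s := by field_simp
  have g5 : -(s * (u * t / v)) / (u * t / v) = -s := by rw [neg_div, g4]
  rw [hS, qProdTerm₃, ← mul_assoc, qProdFactor, qResCoeff, Fin.prod_univ_four, prod_erase_two]
  congr 1
  simp only [qPoles, qZeros, Matrix.cons_val, qThetas, qInfs, List.map_cons, List.map_nil,
    List.prod_cons, List.prod_nil, mul_one]
  rw [p5, f1, f2, f3, f4, f5, f6, g1, g2, g3, g4, g5, qTheta_eq (v * t / u)]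
  simp only [div_eq_mul_inv, mul_inv] at hA hAw ⊢
  refine (mul_one _).symm.trans (Eq.trans (congrArg _ (show qInf (u * t * v⁻¹) q *
    (qInf (u * t * v⁻¹) q)⁻¹ * (qInf (z * (u * v * t⁻¹)) q * (qInf (z * (u * v * t⁻¹)) q)⁻¹) = 1 by
    rw [mul_inv_cancel₀ hA, mul_inv_cancel₀ hAw, one_mul]).symm) ?_)
  ring

theorem qProdTerm₄_eq {q z h s u v t : ℂ} (hs : s ^ 2 = q) (hs0 : s ≠ 0)
    (hz : z ≠ 0) (hu : u ≠ 0) (hv : v ≠ 0) (ht : t ≠ 0) :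
    qProdTerm₄ q z h s u v t = qProdFactor q z u v t *
      (qResCoeff q h (z * v ^ 2 / t ^ 2) (qPoles s u v t) (qZeros q z u v t) 4 *
      qResSeries q (z * v ^ 2 / t ^ 2) (qPoles s u v t) (qZeros q z u v t) 4) := by
  have p1 : q * (s * (u * t / v)) / (t ^ 2 / v ^ 2 * v ^ 2) = s ^ 3 * u / (v * t) := by
    rw [← hs]; field_simp
  have p2 : q * (s * (u * t / v)) / (q * u ^ 2 / v ^ 2) = s * v * t / u := by
    rw [← hs]; field_simp
  have p3 : q * (s * (u * t / v)) / (u ^ 2 * (t ^ 2 / v ^ 2)) = s ^ 3 * v / (u * t) := by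
    rw [← hs]; field_simp
  have p4 : q * (s * (u * t / v)) / (u ^ 2 * (t ^ 2 / v ^ 2) * (z * v ^ 2 / t ^ 2))
      = 1 / z * (s ^ 3 * t / (u * v)) := by rw [← hs]; field_simp
  have p5 : s * (u * t / v) * (z * v ^ 2 / t ^ 2) = z * (s * u * v / t) := by field_simp
  have p6 : s * (u * t / v) = s * u * t / v := by ring
  have r1 : q * (s * (u * t / v)) / u ^ 2 = s ^ 3 * t / (u * v) := by rw [← hs]; field_simp
  have r2 : q * (s * (u * t / v)) / (t ^ 2 / v ^ 2) = s ^ 3 * u * v / t := by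
    rw [← hs]; field_simp
  have r3 : q * (s * (u * t / v)) / (u * t / v) = s ^ 3 := by rw [← hs]; field_simp
  have r4 : q * (s * (u * t / v)) / -(u * t / v) = -s ^ 3 := by rw [div_neg, r3]
  have r5 : q * (s * (u * t / v)) / -(s * (u * t / v)) = -q := by field_simp
  have hS : qResSeries q (z * v ^ 2 / t ^ 2) (qPoles s u v t) (qZeros q z u v t) 4 =
      qHyp [s * u * t / v, s * v * t / u, s ^ 3 * u / (v * t), s ^ 3 * v / (u * t),
          z * (s * u * v / t), 1 / z * (s ^ 3 * t / (u * v))]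
        [-q, s ^ 3, -s ^ 3, s ^ 3 * u * v / t, s ^ 3 * t / (u * v)] q q := by
    rw [qHyp_six_five]
    refine tsum_congr fun k => ?_
    rw [Fin.prod_univ_four, prod_erase_four]
    simp only [qPoles, qZeros, Matrix.cons_val]
    rw [p1, p2, p3, p4, p5, r1, r2, r3, r4, r5, p6]
    simp only [div_eq_mul_inv, mul_inv]
    ring
  have f1 : t ^ 2 / v ^ 2 * v ^ 2 / (s * (u * t / v)) = v * t / (s * u) := by field_simp
  have f2 : q * u ^ 2 / v ^ 2 / (s * (u * t / v)) = s * u / (v * t) := by rw [← hs]; field_simp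
  have f3 : u ^ 2 * (t ^ 2 / v ^ 2) / (s * (u * t / v)) = u * t / (s * v) := by field_simp
  have f4 : u ^ 2 * (t ^ 2 / v ^ 2) * (z * v ^ 2 / t ^ 2) / (s * (u * t / v))
      = z * (u * v / (s * t)) := by field_simp
  have f5 : u ^ 2 * (z * v ^ 2 / t ^ 2) = u ^ 2 * v ^ 2 * z / t ^ 2 := by ring
  have f6 : h / (z * (s * u * v / t)) = h / z * (t / (s * u * v)) := by field_simp
  have g1 : u ^ 2 / (s * (u * t / v)) = u * v / (s * t) := by field_simp
  have g2 : t ^ 2 / v ^ 2 / (s * (u * t / v)) = t / (s * u * v) := by field_simp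
  have g3 : u * t / v / (s * (u * t / v)) = 1 / s := by field_simp
  have g4 : -(u * t / v) / (s * (u * t / v)) = -(1 / s) := by rw [neg_div, g3]
  have g5 : -(s * (u * t / v)) / (s * (u * t / v)) = -1 := by field_simp
  rw [hS, qProdTerm₄, ← mul_assoc, qProdFactor, qResCoeff, Fin.prod_univ_four, prod_erase_four]
  congr 1
  simp only [qPoles, qZeros, Matrix.cons_val, qThetas, qInfs, List.map_cons, List.map_nil,
    List.prod_cons, List.prod_nil, mul_one]
  rw [p5, f1, f2, f3, f4, f5, f6, g1, g2, g3, g4, g5, p6]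
  simp only [div_eq_mul_inv, mul_inv]
  ring

/-- Changing the sign of u = √a exchanges A with -A and sA with -sA and leaves α, β alone, so the ε
= -1 terms need no separate computation. -/
theorem qResCoeff_mul_qResSeries_three (q h w s u v t : ℂ) (y : Fin 4 → ℂ) :
    qResCoeff q h w (qPoles s u v t) y 3 * qResSeries q w (qPoles s u v t) y 3 =
    qResCoeff q h w (qPoles s (-u) v t) y 2 * qResSeries q w (qPoles s (-u) v t) y 2 := by
  congr 1
  · rw [qResCoeff, qResCoeff, prod_erase_two, prod_erase_three]
    simp only [qPoles, Matrix.cons_val, neg_mul, neg_div, mul_neg, neg_neg, neg_sq]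
    ring
  · refine tsum_congr fun k => ?_
    rw [prod_erase_two, prod_erase_three]
    simp only [qPoles, Matrix.cons_val, neg_mul, neg_div, mul_neg, neg_neg, neg_sq]
    ring

theorem qResCoeff_mul_qResSeries_five (q h w s u v t : ℂ) (y : Fin 4 → ℂ) :
    qResCoeff q h w (qPoles s u v t) y 5 * qResSeries q w (qPoles s u v t) y 5 =
    qResCoeff q h w (qPoles s (-u) v t) y 4 * qResSeries q w (qPoles s (-u) v t) y 4 := by
  congr 1
  · rw [qResCoeff, qResCoeff, prod_erase_four, prod_erase_five]
    simp only [qPoles, Matrix.cons_val, neg_mul, neg_div, mul_neg, neg_neg, neg_sq]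
    ring
  · refine tsum_congr fun k => ?_
    rw [prod_erase_four, prod_erase_five]
    simp only [qPoles, Matrix.cons_val, neg_mul, neg_div, mul_neg, neg_neg, neg_sq]
    ring


theorem qHyp_two_one (q a₁ a₂ b₁ z : ℂ) : qHyp [a₁, a₂] [b₁] q z = ∑' k : ℕ,
    qFac a₁ q k * qFac a₂ q k / (qFac q q k * qFac b₁ q k) * z ^ k := by
  refine tsum_congr fun k => ?_
  simp [qHypTerm, qFacs]

theorem qHyp_two_one_swap (q a₁ a₂ b₁ z : ℂ) :
    qHyp [a₁, a₂] [b₁] q z = qHyp [a₂, a₁] [b₁] q z := by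
  simp only [qHyp_two_one, mul_comm (qFac a₁ q _)]

/-- The contour integral gives the second factor as ₂φ₁(c/b, q/b; qa/b; abz/c); Euler's
transformation brings it to argument z. The last three hypotheses say |α|, |β|, |αw| < 1, while βw =
z. -/
theorem qHyp_mul_qHyp_of_small {q z h s u v t : ℂ} (hq0 : q ≠ 0) (hq : ‖q‖ < 1) (hs : s ^ 2 = q)
    (hz : z ≠ 0) (hz1 : ‖z‖ < 1) (hh : h ≠ 0) (hu : u ≠ 0) (hv : v ≠ 0) (ht : t ≠ 0)
    (h1 : ∀ k : ℕ, t ^ 2 * q ^ k ≠ 1) (h2 : ∀ k : ℕ, q * u ^ 2 / v ^ 2 * q ^ k ≠ 1)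
    (h3 : ∀ k : ℤ, u ^ 2 * v ^ 2 / t ^ 2 ≠ q ^ k)
    (hu1 : ‖u ^ 2‖ < 1) (ht1 : ‖t ^ 2 / v ^ 2‖ < 1) (hl : ‖u ^ 2 * v ^ 2 / t ^ 2 * z‖ < 1) :
    qTheta h q * qTheta (h * (t ^ 2 / (v ^ 2 * z))) q *
      (qHyp [u ^ 2, v ^ 2] [t ^ 2] q z * qHyp [u ^ 2, q * u ^ 2 / t ^ 2] [q * u ^ 2 / v ^ 2] q z) =
    qProdTerm₁ q z h s u v t + qProdTerm₂ q z h s u v t + qProdTerm₃ q z h s u v t +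
      qProdTerm₃ q z h s (-u) v t + qProdTerm₄ q z h s u v t + qProdTerm₄ q z h s (-u) v t := by
  have hs0 : s ≠ 0 := by rintro rfl; simp at hs; exact hq0 hs.symm
  have hne : ∀ {c : ℂ}, ‖c‖ < 1 → qInf c q ≠ 0 := fun hc => qInf_ne_zero hq (mul_pow_ne_one hc hq)
  have hw : z * v ^ 2 / t ^ 2 ≠ 0 := by
    simp [hz, hv, ht]
  have e1 : t ^ 2 / v ^ 2 * v ^ 2 = t ^ 2 := by field_simp
  have e2 : u ^ 2 / (t ^ 2 / v ^ 2) = u ^ 2 * v ^ 2 / t ^ 2 := by field_simp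
  have e3 : t ^ 2 / v ^ 2 * (z * v ^ 2 / t ^ 2) = z := by field_simp
  have e4 : u ^ 2 * (z * v ^ 2 / t ^ 2) = u ^ 2 * v ^ 2 / t ^ 2 * z := by ring
  have e5 : h / (z * v ^ 2 / t ^ 2) = h * (t ^ 2 / (v ^ 2 * z)) := by field_simp
  have key := sum_qResCoeff_mul_qResSeries (q := q) (h := h) (w := z * v ^ 2 / t ^ 2) (α := u ^ 2)
    (β := t ^ 2 / v ^ 2) (b := v ^ 2) (A := u * t / v) (s := s) hq0 hq hh hw hs (by ring)
    (pow_ne_zero 2 hu) (div_ne_zero (pow_ne_zero 2 ht) (pow_ne_zero 2 hv)) (pow_ne_zero 2 hv)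
    (by rw [e1]; exact h1) h2 (by rw [e2]; exact h3) hu1 ht1 (by rw [e4]; exact hl)
    (by rw [e3]; exact hz1)
  change ∑ i, qResCoeff q h (z * v ^ 2 / t ^ 2) (qPoles s u v t) (qZeros q z u v t) i *
    qResSeries q (z * v ^ 2 / t ^ 2) (qPoles s u v t) (qZeros q z u v t) i = _ at key
  have hA : ‖u * t / v‖ < 1 := by
    have := congrArg norm (show (u * t / v) ^ 2 = u ^ 2 * (t ^ 2 / v ^ 2) by ring)
    rw [norm_pow, norm_mul (u ^ 2)] at this
    nlinarith [norm_nonneg (u * t / v), norm_nonneg (u ^ 2), norm_nonneg (t ^ 2 / v ^ 2)]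
  have hAw : ‖z * (u * v / t)‖ < 1 := by
    have := congrArg norm (show (z * (u * v / t)) ^ 2 = u ^ 2 * v ^ 2 / t ^ 2 * z * z by ring)
    rw [norm_pow, norm_mul _ z] at this
    nlinarith [norm_nonneg (z * (u * v / t)), norm_nonneg (u ^ 2 * v ^ 2 / t ^ 2 * z), norm_nonneg z]
  have hf : qProdFactor q z (-u) v t = qProdFactor q z u v t := by simp only [qProdFactor, neg_sq]
  have hy : qZeros q z (-u) v t = qZeros q z u v t := by simp only [qZeros, neg_sq]
  have t3 := qProdTerm₃_eq (h := h) hs hs0 hz (neg_ne_zero.2 hu) hv ht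
    (hne (by rw [neg_mul, neg_div, norm_neg]; exact hA))
    (hne (by rw [neg_mul, neg_div, mul_neg, norm_neg]; exact hAw))
  have t4 := qProdTerm₄_eq (h := h) hs hs0 hz (neg_ne_zero.2 hu) hv ht
  rw [hf, hy] at t3 t4
  rw [qProdTerm₁_eq hq hs hs0 hz hu hv ht (hne hu1) (hne hz1) (hne (by rw [e4]; exact hl)),
    qProdTerm₂_eq hq hs hs0 hz hu hv ht (hne ht1),
    qProdTerm₃_eq hs hs0 hz hu hv ht (hne hA) (hne hAw), t3, qProdTerm₄_eq hs hs0 hz hu hv ht, t4,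
    ← qResCoeff_mul_qResSeries_three, ← qResCoeff_mul_qResSeries_five]
  rw [Fin.sum_univ_six, e5, e1, e3, e4] at key
  have e6 : q / v ^ 2 * (u ^ 2 / (t ^ 2 / v ^ 2)) = q * u ^ 2 / t ^ 2 := by field_simp
  have e7 : t ^ 2 / v ^ 2 * (u ^ 2 / (t ^ 2 / v ^ 2)) = u ^ 2 := by field_simp
  have e8 : q / v ^ 2 * (t ^ 2 / v ^ 2) * (u ^ 2 / (t ^ 2 / v ^ 2)) = q * u ^ 2 / v ^ 2 := by
    field_simp
  have E := qEuler_transformation hq0 hq (q / v ^ 2) (t ^ 2 / v ^ 2) (u ^ 2 / (t ^ 2 / v ^ 2)) hz1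
    (by rw [e2]; exact hl) (by rw [e8]; exact h2)
  rw [e6, e7, e8, e2, qHyp_two_one_swap, qHyp_two_one_swap q (q / v ^ 2)] at E
  rw [E, ← mul_add, ← mul_add, ← mul_add, ← mul_add, ← mul_add]
  rw [key, qProdFactor, e4]
  have n1 := hne hu1
  have n2 := hne ht1
  have n3 := qInf_ne_zero hq h1
  have n4 := qInf_ne_zero hq h2
  have n5 := hne hz1
  generalize qInf (u ^ 2) q = A1 at *
  generalize qInf (t ^ 2 / v ^ 2) q = A2 at *
  generalize qInf (t ^ 2) q = A3 at *
  generalize qInf (q * u ^ 2 / v ^ 2) q = A4 at *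
  generalize qInf z q = A5 at *
  field_simp

/-! ### Holomorphic dependence of both sides on the parameters. -/

/-- Multiplying by ∏ (b_j;q)_∞ replaces 1/(b_j;q)_k by (b_j q^k;q)_∞. The terms are then holomorphic
near the point and bounded by a constant times ‖z‖^k; the quotient is taken at the end. -/
theorem differentiableAt_tsum_qFac {m n : ℕ} {q z x₀ : ℂ} (hq : ‖q‖ < 1) (hz : ‖z‖ < 1)
    (hx₀ : x₀ ≠ 0) {a : Fin m → ℂ → ℂ} {b : Fin n → ℂ → ℂ}
    (ha : ∀ i x, x ≠ 0 → DifferentiableAt ℂ (a i) x)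
    (hb : ∀ j x, x ≠ 0 → DifferentiableAt ℂ (b j) x) (hb0 : ∀ j, ∀ k : ℕ, b j x₀ * q ^ k ≠ 1) :
    DifferentiableAt ℂ (fun x => ∑' k : ℕ, (∏ i, qFac (a i x) q k) /
      (qFac q q k * ∏ j, qFac (b j x) q k) * z ^ k) x₀ := by
  have hq1 : 0 < 1 - ‖q‖ := by linarith
  have hbd : ∀ f : ℂ → ℂ, (∀ x, x ≠ 0 → DifferentiableAt ℂ f x) →
      ∀ᶠ x in nhds x₀, ‖f x‖ < ‖f x₀‖ + 1 := fun f hf =>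
    (hf x₀ hx₀).continuousAt.norm.eventually (gt_mem_nhds (lt_add_one _))
  have hev : ∀ᶠ x in nhds x₀, x ≠ 0 ∧ (∀ i, ‖a i x‖ < ‖a i x₀‖ + 1) ∧
      (∀ j, ‖b j x‖ < ‖b j x₀‖ + 1) ∧ ∀ j, qInf (b j x) q ≠ 0 := by
    refine (eventually_ne_nhds hx₀).and (Filter.Eventually.and ?_ (Filter.Eventually.and ?_ ?_))
    · exact Filter.eventually_all.2 fun i => hbd _ (ha i)
    · exact Filter.eventually_all.2 fun j => hbd _ (hb j)
    · refine Filter.eventually_all.2 fun j => ?_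
      exact (differentiableAt_qInf hq (hb j x₀ hx₀)).continuousAt.eventually_ne
        (qInf_ne_zero hq (hb0 j))
  obtain ⟨ε, hε, hball⟩ := Metric.eventually_nhds_iff_ball.1 hev
  obtain ⟨C, hC0, hC⟩ := exists_norm_qFac_self_inv_le hq
  have hS : DifferentiableOn ℂ (fun x => ∑' k : ℕ, (∏ i, qFac (a i x) q k) *
      (∏ j, qInf (b j x * q ^ k) q) * (qFac q q k)⁻¹ * z ^ k) (Metric.ball x₀ ε) := by
    refine Complex.differentiableOn_tsum_of_summable_norm
      (u := fun k => (∏ i, Real.exp ((‖a i x₀‖ + 1) / (1 - ‖q‖))) *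
        (∏ j, Real.exp ((‖b j x₀‖ + 1) / (1 - ‖q‖))) * C * ‖z‖ ^ k) ?_ (fun k x hx => ?_)
      Metric.isOpen_ball fun k x hx => ?_
    · exact (summable_geometric_of_lt_one (norm_nonneg z) hz).mul_left _
    · obtain ⟨h0, -⟩ := hball x hx
      refine DifferentiableAt.differentiableWithinAt (DifferentiableAt.mul_const
        (DifferentiableAt.mul_const (DifferentiableAt.mul ?_ ?_) _) _)
      · refine DifferentiableAt.fun_finsetProd fun i _ => ?_
        unfold qFac
        exact DifferentiableAt.fun_finsetProd fun l _ => ((ha i x h0).mul_const _).const_sub 1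
      · exact DifferentiableAt.fun_finsetProd fun j _ =>
          differentiableAt_qInf hq ((hb j x h0).mul_const _)
    · obtain ⟨h0, h1, h2, -⟩ := hball x hx
      rw [norm_mul, norm_mul, norm_mul, norm_prod, norm_prod, norm_pow]
      have g1 : ∏ i, ‖qFac (a i x) q k‖ ≤ ∏ i, Real.exp ((‖a i x₀‖ + 1) / (1 - ‖q‖)) := by
        refine Finset.prod_le_prod (fun _ _ => norm_nonneg _) fun i _ => ?_
        refine (norm_qFac_le hq _ _).trans (Real.exp_le_exp.2 ?_)
        exact div_le_div_of_nonneg_right (h1 i).le hq1.le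
      have g2 : ∏ j, ‖qInf (b j x * q ^ k) q‖ ≤ ∏ j, Real.exp ((‖b j x₀‖ + 1) / (1 - ‖q‖)) := by
        refine Finset.prod_le_prod (fun _ _ => norm_nonneg _) fun j _ => ?_
        refine (norm_qInf_le hq _).trans (Real.exp_le_exp.2 ?_)
        refine div_le_div_of_nonneg_right (le_trans ?_ (h2 j).le) hq1.le
        rw [norm_mul, norm_pow]
        exact mul_le_of_le_one_right (norm_nonneg _) (pow_le_one₀ (norm_nonneg q) hq.le)
      have g3 := hC k
      gcongr
  have hmem : Metric.ball x₀ ε ∈ nhds x₀ := Metric.ball_mem_nhds x₀ hε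
  have hD : DifferentiableAt ℂ (fun x => ∏ j, qInf (b j x) q) x₀ :=
    DifferentiableAt.fun_finsetProd fun j _ => differentiableAt_qInf hq (hb j x₀ hx₀)
  have hD0 : ∏ j, qInf (b j x₀) q ≠ 0 :=
    Finset.prod_ne_zero_iff.2 fun j _ => qInf_ne_zero hq (hb0 j)
  refine ((hS.differentiableAt hmem).div hD hD0).congr_of_eventuallyEq ?_
  filter_upwards [hmem] with x hx
  obtain ⟨-, -, -, h3⟩ := hball x hx
  change _ = (∑' k : ℕ, _) / (∏ j, qInf (b j x) q)
  rw [← tsum_div_const]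
  refine tsum_congr fun k => ?_
  have e : ∏ j, qInf (b j x) q = (∏ j, qFac (b j x) q k) * ∏ j, qInf (b j x * q ^ k) q := by
    rw [← Finset.prod_mul_distrib]
    exact Finset.prod_congr rfl fun j _ => qInf_eq_qFac_mul hq _ _
  have e0 : (∏ j, qFac (b j x) q k) * ∏ j, qInf (b j x * q ^ k) q ≠ 0 :=
    e ▸ Finset.prod_ne_zero_iff.2 fun j _ => h3 j
  rw [e]
  have h5 := right_ne_zero_of_mul e0
  generalize (∏ j, qInf (b j x * q ^ k) q) = X at h5
  simp only [div_eq_mul_inv, mul_inv]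
  refine (mul_one _).symm.trans (Eq.trans (congrArg _ (mul_inv_cancel₀ h5).symm) ?_)
  ring

theorem differentiableAt_qHyp_two_one {q z x₀ : ℂ} (hq : ‖q‖ < 1) (hz : ‖z‖ < 1)
    (hx₀ : x₀ ≠ 0) {a₁ a₂ b₁ : ℂ → ℂ} (h1 : ∀ x, x ≠ 0 → DifferentiableAt ℂ a₁ x)
    (h2 : ∀ x, x ≠ 0 → DifferentiableAt ℂ a₂ x) (h3 : ∀ x, x ≠ 0 → DifferentiableAt ℂ b₁ x)
    (hb : ∀ k : ℕ, b₁ x₀ * q ^ k ≠ 1) :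
    DifferentiableAt ℂ (fun x => qHyp [a₁ x, a₂ x] [b₁ x] q z) x₀ := by
  have := differentiableAt_tsum_qFac (a := ![a₁, a₂]) (b := ![b₁]) hq hz hx₀
    (by simp [Fin.forall_fin_two]; exact ⟨h1, h2⟩) (by simpa using h3) (by simpa using hb)
  simp only [qHyp_two_one]
  simpa [Fin.prod_univ_two] using this

theorem differentiableAt_qHyp_six_five {q x₀ : ℂ} (hq : ‖q‖ < 1)
    (hx₀ : x₀ ≠ 0) {a₁ a₂ a₃ a₄ a₅ a₆ b₁ b₂ b₃ b₄ b₅ : ℂ → ℂ}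
    (h1 : ∀ x, x ≠ 0 → DifferentiableAt ℂ a₁ x) (h2 : ∀ x, x ≠ 0 → DifferentiableAt ℂ a₂ x)
    (h3 : ∀ x, x ≠ 0 → DifferentiableAt ℂ a₃ x) (h4 : ∀ x, x ≠ 0 → DifferentiableAt ℂ a₄ x)
    (h5 : ∀ x, x ≠ 0 → DifferentiableAt ℂ a₅ x) (h6 : ∀ x, x ≠ 0 → DifferentiableAt ℂ a₆ x)
    (g1 : ∀ x, x ≠ 0 → DifferentiableAt ℂ b₁ x) (g2 : ∀ x, x ≠ 0 → DifferentiableAt ℂ b₂ x)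
    (g3 : ∀ x, x ≠ 0 → DifferentiableAt ℂ b₃ x) (g4 : ∀ x, x ≠ 0 → DifferentiableAt ℂ b₄ x)
    (g5 : ∀ x, x ≠ 0 → DifferentiableAt ℂ b₅ x)
    (k1 : ∀ k : ℕ, b₁ x₀ * q ^ k ≠ 1) (k2 : ∀ k : ℕ, b₂ x₀ * q ^ k ≠ 1)
    (k3 : ∀ k : ℕ, b₃ x₀ * q ^ k ≠ 1) (k4 : ∀ k : ℕ, b₄ x₀ * q ^ k ≠ 1)
    (k5 : ∀ k : ℕ, b₅ x₀ * q ^ k ≠ 1) :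
    DifferentiableAt ℂ (fun x => qHyp [a₁ x, a₂ x, a₃ x, a₄ x, a₅ x, a₆ x]
      [b₁ x, b₂ x, b₃ x, b₄ x, b₅ x] q q) x₀ := by
  have := differentiableAt_tsum_qFac (a := ![a₁, a₂, a₃, a₄, a₅, a₆]) (b := ![b₁, b₂, b₃, b₄, b₅])
    hq hq hx₀ (by intro i; fin_cases i <;> assumption) (by intro i; fin_cases i <;> assumption)
    (by intro i; fin_cases i <;> assumption)
  simp only [qHyp_six_five]
  simpa [Fin.prod_univ_six, Fin.prod_univ_five] using this


attribute [fun_prop] differentiableAt_qInf differentiableAt_qTheta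

theorem mul_pow_ne_one_of_eq {q M X : ℂ} (hq0 : q ≠ 0) (hM : ∀ k : ℤ, M ≠ q ^ k) {i j : ℕ}
    (hX : X * q ^ i = M * q ^ j) (k : ℕ) : X * q ^ k ≠ 1 := by
  intro h
  refine hM (i - j - k) ?_
  rw [zpow_sub₀ hq0, zpow_sub₀ hq0, zpow_natCast, zpow_natCast, zpow_natCast, div_div,
    eq_div_iff (mul_ne_zero (pow_ne_zero _ hq0) (pow_ne_zero _ hq0)), ← mul_assoc, ← hX]
  linear_combination q ^ i * h

/-- Through squares, the single condition ab/c ∉ Υ_q covers all denominators built from ±√(ab/c),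
±√(qab/c) and their inverses. -/
theorem mul_pow_ne_one_of_sq_eq {q M X : ℂ} (hq0 : q ≠ 0) (hM : ∀ k : ℤ, M ≠ q ^ k) {i j : ℕ}
    (hX : X ^ 2 * q ^ i = M * q ^ j) (k : ℕ) : X * q ^ k ≠ 1 := by
  intro h
  refine mul_pow_ne_one_of_eq hq0 hM hX (2 * k) ?_
  rw [mul_comm 2, pow_mul, ← mul_pow, h, one_pow]

theorem neg_one_mul_pow_ne_one {q : ℂ} (hq : ‖q‖ < 1) (k : ℕ) : -1 * q ^ k ≠ 1 := by
  cases k with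
  | zero => norm_num
  | succ k =>
    rw [pow_succ', ← mul_assoc]
    exact mul_pow_ne_one (by simpa using hq) hq k

theorem one_div_mul_pow_ne_one {q s : ℂ} (hq : ‖q‖ < 1) (hs : s ^ 2 = q) (hs0 : s ≠ 0)
    (hs1 : ‖s‖ < 1) (k : ℕ) : 1 / s * q ^ k ≠ 1 := by
  cases k with
  | zero =>
    intro h
    rw [pow_zero, mul_one, one_div, inv_eq_one] at h
    simp [h] at hs1
  | succ k =>
    rw [pow_succ', ← mul_assoc, show 1 / s * q = s by rw [← hs]; field_simp]
    exact mul_pow_ne_one hs1 hq k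

section

variable {q z h s v x₀ : ℂ} {u t : ℂ → ℂ}

theorem differentiableAt_qProdTerm₁ (hq0 : q ≠ 0) (hq : ‖q‖ < 1)
    (hs : s ^ 2 = q) (hz : z ≠ 0) (hh : h ≠ 0) (hv : v ≠ 0) (hx₀ : x₀ ≠ 0)
    (hu : ∀ x, x ≠ 0 → DifferentiableAt ℂ u x) (ht : ∀ x, x ≠ 0 → DifferentiableAt ℂ t x)
    (hu0 : ∀ x, x ≠ 0 → u x ≠ 0) (ht0 : ∀ x, x ≠ 0 → t x ≠ 0)
    (h1 : ∀ k : ℕ, t x₀ ^ 2 * q ^ k ≠ 1) (h2 : ∀ k : ℕ, q * u x₀ ^ 2 / v ^ 2 * q ^ k ≠ 1)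
    (h3 : ∀ k : ℤ, u x₀ ^ 2 * v ^ 2 / t x₀ ^ 2 ≠ q ^ k) :
    DifferentiableAt ℂ (fun x => qProdTerm₁ q z h s (u x) v (t x)) x₀ := by
  have hu₀ := hu0 x₀ hx₀
  have ht₀ := ht0 x₀ hx₀
  have du := hu x₀ hx₀
  have dt := ht x₀ hx₀
  have hs0 : s ≠ 0 := by rintro rfl; simp at hs; exact hq0 hs.symm
  have h4 : ∀ k : ℤ, t x₀ ^ 2 / (u x₀ ^ 2 * v ^ 2) ≠ q ^ k := fun k hk => h3 (-k) (by
    rw [zpow_neg, ← hk, inv_div])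
  have hne : ∀ {c : ℂ}, (∀ k : ℕ, c * q ^ k ≠ 1) → qInf c q ≠ 0 := fun hc => qInf_ne_zero hq hc
  simp only [qProdTerm₁, qThetas, qInfs, List.map_cons, List.map_nil, List.prod_cons,
    List.prod_nil, mul_one]
  refine DifferentiableAt.mul (DifferentiableAt.div ?_ ?_ ?_)
    (differentiableAt_qHyp_six_five hq hx₀ ?_ ?_ ?_ ?_ ?_ ?_ ?_ ?_ ?_ ?_ ?_ ?_ ?_ ?_ ?_ ?_)
  · fun_prop (disch := first | assumption | simp [*])
  · fun_prop (disch := first | assumption | simp [*])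
  · simp only [ne_eq, mul_eq_zero, not_or]
    exact ⟨hne (h1),
      hne (mul_pow_ne_one_of_eq (i := 0) (j := 0) hq0 h4 (by field_simp)),
      hne (mul_pow_ne_one_of_eq (i := 0) (j := 0) hq0 h4 (by field_simp)),
      hne (h2)⟩
  -- The six upper and five lower parameters of the ₆φ₅, as functions of x.
  iterate 11
    · intro x hx
      have := hu x hx
      have := ht x hx
      have := hu0 x hx
      have := ht0 x hx
      fun_prop (disch := first | assumption | simp [*])
  · exact mul_pow_ne_one_of_eq (i := 0) (j := 1) hq0 h3 (by field_simp)
  · exact mul_pow_ne_one_of_sq_eq (i := 0) (j := 1) hq0 h3 (by rw [← hs]; field_simp)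
  · exact mul_pow_ne_one_of_sq_eq (i := 0) (j := 1) hq0 h3 (by rw [neg_sq, ← hs]; field_simp)
  · exact mul_pow_ne_one_of_sq_eq (i := 0) (j := 2) hq0 h3 (by rw [← hs]; field_simp)
  · exact mul_pow_ne_one_of_sq_eq (i := 0) (j := 2) hq0 h3 (by rw [neg_sq, ← hs]; field_simp)

theorem differentiableAt_qProdTerm₂ (hq0 : q ≠ 0) (hq : ‖q‖ < 1)
    (hs : s ^ 2 = q) (hz : z ≠ 0) (hz1 : ‖z‖ < 1) (hh : h ≠ 0) (hv : v ≠ 0) (hx₀ : x₀ ≠ 0)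
    (hu : ∀ x, x ≠ 0 → DifferentiableAt ℂ u x) (ht : ∀ x, x ≠ 0 → DifferentiableAt ℂ t x)
    (hu0 : ∀ x, x ≠ 0 → u x ≠ 0) (ht0 : ∀ x, x ≠ 0 → t x ≠ 0)
    (h1 : ∀ k : ℕ, t x₀ ^ 2 * q ^ k ≠ 1) (h2 : ∀ k : ℕ, q * u x₀ ^ 2 / v ^ 2 * q ^ k ≠ 1)
    (h3 : ∀ k : ℤ, u x₀ ^ 2 * v ^ 2 / t x₀ ^ 2 ≠ q ^ k) :
    DifferentiableAt ℂ (fun x => qProdTerm₂ q z h s (u x) v (t x)) x₀ := by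
  have hu₀ := hu0 x₀ hx₀
  have ht₀ := ht0 x₀ hx₀
  have du := hu x₀ hx₀
  have dt := ht x₀ hx₀
  have hs0 : s ≠ 0 := by rintro rfl; simp at hs; exact hq0 hs.symm
  have h4 : ∀ k : ℤ, t x₀ ^ 2 / (u x₀ ^ 2 * v ^ 2) ≠ q ^ k := fun k hk => h3 (-k) (by
    rw [zpow_neg, ← hk, inv_div])
  have hne : ∀ {c : ℂ}, (∀ k : ℕ, c * q ^ k ≠ 1) → qInf c q ≠ 0 := fun hc => qInf_ne_zero hq hc
  simp only [qProdTerm₂, qThetas, qInfs, List.map_cons, List.map_nil, List.prod_cons,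
    List.prod_nil, mul_one]
  refine DifferentiableAt.mul (DifferentiableAt.div ?_ ?_ ?_)
    (differentiableAt_qHyp_six_five hq hx₀ ?_ ?_ ?_ ?_ ?_ ?_ ?_ ?_ ?_ ?_ ?_ ?_ ?_ ?_ ?_ ?_)
  · fun_prop (disch := first | assumption | simp [*])
  · fun_prop (disch := first | assumption | simp [*])
  · simp only [ne_eq, mul_eq_zero, not_or]
    exact ⟨hne (mul_pow_ne_one (by simpa using hz1) hq),
      hne (mul_pow_ne_one (by simpa using hz1) hq),
      hne (h1),
      hne (h2),
      hne (mul_pow_ne_one_of_eq (i := 0) (j := 0) hq0 h3 (by field_simp)),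
      hne (mul_pow_ne_one_of_eq (i := 0) (j := 0) hq0 h3 (by field_simp))⟩
  iterate 11
    · intro x hx
      have := hu x hx
      have := ht x hx
      have := hu0 x hx
      have := ht0 x hx
      fun_prop (disch := first | assumption | simp [*])
  · exact mul_pow_ne_one_of_eq (i := 0) (j := 1) hq0 h4 (by field_simp)
  · exact mul_pow_ne_one_of_sq_eq (i := 0) (j := 1) hq0 h4 (by rw [← hs]; field_simp)
  · exact mul_pow_ne_one_of_sq_eq (i := 0) (j := 1) hq0 h4 (by rw [neg_sq, ← hs]; field_simp)
  · exact mul_pow_ne_one_of_sq_eq (i := 0) (j := 2) hq0 h4 (by rw [← hs]; field_simp)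
  · exact mul_pow_ne_one_of_sq_eq (i := 0) (j := 2) hq0 h4 (by rw [neg_sq, ← hs]; field_simp)

theorem differentiableAt_qProdTerm₃ (hq0 : q ≠ 0) (hq : ‖q‖ < 1)
    (hs : s ^ 2 = q) (hz : z ≠ 0) (hz1 : ‖z‖ < 1) (hh : h ≠ 0) (hv : v ≠ 0) (hx₀ : x₀ ≠ 0)
    (hu : ∀ x, x ≠ 0 → DifferentiableAt ℂ u x) (ht : ∀ x, x ≠ 0 → DifferentiableAt ℂ t x)
    (hu0 : ∀ x, x ≠ 0 → u x ≠ 0) (ht0 : ∀ x, x ≠ 0 → t x ≠ 0)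
    (h1 : ∀ k : ℕ, t x₀ ^ 2 * q ^ k ≠ 1) (h2 : ∀ k : ℕ, q * u x₀ ^ 2 / v ^ 2 * q ^ k ≠ 1)
    (h3 : ∀ k : ℤ, u x₀ ^ 2 * v ^ 2 / t x₀ ^ 2 ≠ q ^ k) :
    DifferentiableAt ℂ (fun x => qProdTerm₃ q z h s (u x) v (t x)) x₀ := by
  have hu₀ := hu0 x₀ hx₀
  have ht₀ := ht0 x₀ hx₀
  have du := hu x₀ hx₀
  have dt := ht x₀ hx₀
  have hs0 : s ≠ 0 := by rintro rfl; simp at hs; exact hq0 hs.symm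
  have h4 : ∀ k : ℤ, t x₀ ^ 2 / (u x₀ ^ 2 * v ^ 2) ≠ q ^ k := fun k hk => h3 (-k) (by
    rw [zpow_neg, ← hk, inv_div])
  have hne : ∀ {c : ℂ}, (∀ k : ℕ, c * q ^ k ≠ 1) → qInf c q ≠ 0 := fun hc => qInf_ne_zero hq hc
  have hs1 : ‖s‖ < 1 := by
    have := congrArg norm hs
    rw [norm_pow] at this
    nlinarith [norm_nonneg s]
  simp only [qProdTerm₃, qThetas, qInfs, List.map_cons, List.map_nil, List.prod_cons,
    List.prod_nil, mul_one]
  refine DifferentiableAt.mul (DifferentiableAt.div ?_ ?_ ?_)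
    (differentiableAt_qHyp_six_five hq hx₀ ?_ ?_ ?_ ?_ ?_ ?_ ?_ ?_ ?_ ?_ ?_ ?_ ?_ ?_ ?_ ?_)
  · fun_prop (disch := first | assumption | simp [*])
  · fun_prop (disch := first | assumption | simp [*])
  · simp only [ne_eq, mul_eq_zero, not_or]
    exact ⟨hne (neg_one_mul_pow_ne_one hq),
      hne (mul_pow_ne_one (by simpa using hs1) hq),
      hne (mul_pow_ne_one (by simpa using hs1) hq),
      hne (mul_pow_ne_one (by simpa using hz1) hq),
      hne (h1),
      hne (h2),
      hne (mul_pow_ne_one_of_sq_eq (i := 0) (j := 0) hq0 h4 (by rw [← hs]; field_simp)),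
      hne (mul_pow_ne_one_of_sq_eq (i := 0) (j := 0) hq0 h3 (by rw [← hs]; field_simp))⟩
  iterate 11
    · intro x hx
      have := hu x hx
      have := ht x hx
      have := hu0 x hx
      have := ht0 x hx
      fun_prop (disch := first | assumption | simp [*])
  · exact mul_pow_ne_one (by simpa using hq) hq
  · exact mul_pow_ne_one (by simpa using hs1) hq
  · exact mul_pow_ne_one (by simpa using hs1) hq
  · exact mul_pow_ne_one_of_sq_eq (i := 0) (j := 2) hq0 h3 (by rw [← hs]; field_simp)
  · exact mul_pow_ne_one_of_sq_eq (i := 0) (j := 2) hq0 h4 (by rw [← hs]; field_simp)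

/-- The denominators √(qac/b) and z√(qab/c) are not controlled by ab/c, hence the separate
conditions `h5` and `h6`. -/
theorem differentiableAt_qProdTerm₄ (hq0 : q ≠ 0) (hq : ‖q‖ < 1)
    (hs : s ^ 2 = q) (hz : z ≠ 0) (hz1 : ‖z‖ < 1) (hh : h ≠ 0) (hv : v ≠ 0) (hx₀ : x₀ ≠ 0)
    (hu : ∀ x, x ≠ 0 → DifferentiableAt ℂ u x) (ht : ∀ x, x ≠ 0 → DifferentiableAt ℂ t x)
    (hu0 : ∀ x, x ≠ 0 → u x ≠ 0) (ht0 : ∀ x, x ≠ 0 → t x ≠ 0)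
    (h1 : ∀ k : ℕ, t x₀ ^ 2 * q ^ k ≠ 1) (h2 : ∀ k : ℕ, q * u x₀ ^ 2 / v ^ 2 * q ^ k ≠ 1)
    (h3 : ∀ k : ℤ, u x₀ ^ 2 * v ^ 2 / t x₀ ^ 2 ≠ q ^ k)
    (h5 : ∀ k : ℕ, s * u x₀ * t x₀ / v * q ^ k ≠ 1)
    (h6 : ∀ k : ℕ, z * (s * u x₀ * v / t x₀) * q ^ k ≠ 1) :
    DifferentiableAt ℂ (fun x => qProdTerm₄ q z h s (u x) v (t x)) x₀ := by
  have hu₀ := hu0 x₀ hx₀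
  have ht₀ := ht0 x₀ hx₀
  have du := hu x₀ hx₀
  have dt := ht x₀ hx₀
  have hs0 : s ≠ 0 := by rintro rfl; simp at hs; exact hq0 hs.symm
  have h4 : ∀ k : ℤ, t x₀ ^ 2 / (u x₀ ^ 2 * v ^ 2) ≠ q ^ k := fun k hk => h3 (-k) (by
    rw [zpow_neg, ← hk, inv_div])
  have hne : ∀ {c : ℂ}, (∀ k : ℕ, c * q ^ k ≠ 1) → qInf c q ≠ 0 := fun hc => qInf_ne_zero hq hc
  have hs1 : ‖s‖ < 1 := by
    have := congrArg norm hs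
    rw [norm_pow] at this
    nlinarith [norm_nonneg s]
  have hs3 : ‖s ^ 3‖ < 1 := by
    rw [norm_pow]
    exact pow_lt_one₀ (norm_nonneg s) hs1 (by norm_num)
  have hs4 : ∀ k : ℕ, -(1 / s) * q ^ k ≠ 1 := by
    rw [← div_neg]
    exact one_div_mul_pow_ne_one hq (by rw [neg_sq, hs]) (neg_ne_zero.2 hs0) (by rwa [norm_neg])
  simp only [qProdTerm₄, qThetas, qInfs, List.map_cons, List.map_nil, List.prod_cons,
    List.prod_nil, mul_one]
  refine DifferentiableAt.mul (DifferentiableAt.div ?_ ?_ ?_)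
    (differentiableAt_qHyp_six_five hq hx₀ ?_ ?_ ?_ ?_ ?_ ?_ ?_ ?_ ?_ ?_ ?_ ?_ ?_ ?_ ?_ ?_)
  · fun_prop (disch := first | assumption | simp [*])
  · fun_prop (disch := first | assumption | simp [*])
  · simp only [ne_eq, mul_eq_zero, not_or]
    exact ⟨hne (neg_one_mul_pow_ne_one hq),
      hne (one_div_mul_pow_ne_one hq hs hs0 hs1),
      hne (hs4),
      hne (mul_pow_ne_one (by simpa using hz1) hq),
      hne (h1),
      hne (h2),
      hne (h5),
      hne (mul_pow_ne_one_of_sq_eq (i := 1) (j := 0) hq0 h4 (by rw [← hs]; field_simp)),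
      hne (mul_pow_ne_one_of_sq_eq (i := 1) (j := 0) hq0 h3 (by rw [← hs]; field_simp)),
      hne (h6)⟩
  iterate 11
    · intro x hx
      have := hu x hx
      have := ht x hx
      have := hu0 x hx
      have := ht0 x hx
      fun_prop (disch := first | assumption | simp [*])
  · exact mul_pow_ne_one (by simpa using hq) hq
  · exact mul_pow_ne_one (by simpa using hs3) hq
  · exact mul_pow_ne_one (by simpa using hs3) hq
  · exact mul_pow_ne_one_of_sq_eq (i := 0) (j := 3) hq0 h3 (by rw [← hs]; field_simp)
  · exact mul_pow_ne_one_of_sq_eq (i := 0) (j := 3) hq0 h4 (by rw [← hs]; field_simp)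

end


/-! ### Analytic continuation and the final identity. -/

theorem countable_setOf_pow_mul_eq {ι : Type*} [Countable ι] {n : ℕ} (hn : 0 < n) {C : ℂ}
    (hC : C ≠ 0) (d : ι → ℂ) : {x : ℂ | ∃ k, x ^ n * C = d k}.Countable := by
  rw [Set.ofPred_exists]
  refine Set.countable_iUnion fun k => Set.Finite.countable ?_
  refine (Polynomial.nthRoots n (d k / C)).toFinset.finite_toSet.subset fun x hx => ?_
  rw [Finset.mem_coe, Multiset.mem_toFinset, Polynomial.mem_nthRoots hn, eq_div_iff hC]
  exact hx

theorem countable_setOf_qInf_eq_zero {q : ℂ} (hq : ‖q‖ < 1) {n : ℕ} (hn : 0 < n)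
    {C : ℂ} (hC : C ≠ 0) {f : ℂ → ℂ} (hf : ∀ x, x ≠ 0 → f x = x ^ n * C) :
    {x : ℂ | x ≠ 0 ∧ qInf (f x) q = 0}.Countable := by
  refine (countable_setOf_pow_mul_eq hn hC fun k : ℕ => (q ^ k)⁻¹).mono ?_
  rintro x ⟨hx, h⟩
  by_contra hcon
  refine qInf_ne_zero hq (fun k hk => hcon ⟨k, ?_⟩) h
  rw [← hf x hx]
  exact eq_inv_of_mul_eq_one_left hk

theorem countable_setOf_qTheta_eq_zero {q : ℂ} (hq0 : q ≠ 0) (hq : ‖q‖ < 1) {n : ℕ} (hn : 0 < n)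
    {C : ℂ} (hC : C ≠ 0) {f : ℂ → ℂ} (hf : ∀ x, x ≠ 0 → f x = x ^ n * C) :
    {x : ℂ | x ≠ 0 ∧ qTheta (f x) q = 0}.Countable := by
  refine (countable_setOf_pow_mul_eq hn hC fun k : ℤ => q ^ k).mono ?_
  rintro x ⟨hx, h⟩
  by_contra hcon
  refine (qTheta_ne_zero_iff hq0 hq ?_).2 (fun k hk => hcon ⟨k, ?_⟩) h
  · rw [hf x hx]
    exact mul_ne_zero (pow_ne_zero n hx) hC
  · rw [← hf x hx, hk]

/-- The condition that no denominator of the product formula vanishes, apart from those that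
depend on `h`. -/
def QAdmissible (q z s u v t : ℂ) : Prop :=
  qInf (t ^ 2) q ≠ 0 ∧ qInf (q * u ^ 2 / v ^ 2) q ≠ 0 ∧ qTheta (u ^ 2 * v ^ 2 / t ^ 2) q ≠ 0 ∧
    qInf (s * u * t / v) q ≠ 0 ∧ qInf (-(s * u * t / v)) q ≠ 0 ∧
    qInf (z * (s * u * v / t)) q ≠ 0 ∧ qInf (-(z * (s * u * v / t))) q ≠ 0

/-- Under u ↦ x²u, t ↦ xt every argument in `QAdmissible` becomes a nonzero constant times x^n with
n among 1, 2, 3, 4. A denominator then vanishes only for countably many x. -/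
theorem countable_setOf_not_qAdmissible {q z s u v t : ℂ} (hq0 : q ≠ 0) (hq : ‖q‖ < 1)
    (hz : z ≠ 0) (hs : s ≠ 0) (hu : u ≠ 0) (hv : v ≠ 0) (ht : t ≠ 0) :
    {x : ℂ | ¬ (x ≠ 0 ∧ QAdmissible q z s (x ^ 2 * u) v (x * t))}.Countable := by
  have c1 := countable_setOf_qInf_eq_zero hq (n := 2) (by norm_num) (C := t ^ 2)
    (f := fun x => (x * t) ^ 2) (by simp [ht]) (fun x hx => by ring)
  have c2 := countable_setOf_qInf_eq_zero hq (n := 4) (by norm_num) (C := q * u ^ 2 / v ^ 2)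
    (f := fun x => q * (x ^ 2 * u) ^ 2 / v ^ 2) (by simp [*]) (fun x hx => by ring)
  have c3 := countable_setOf_qTheta_eq_zero hq0 hq (n := 2) (by norm_num) (C := u ^ 2 * v ^ 2 / t ^ 2)
    (f := fun x => (x ^ 2 * u) ^ 2 * v ^ 2 / (x * t) ^ 2) (by simp [*])
    (fun x hx => by field_simp)
  have c4 := countable_setOf_qInf_eq_zero hq (n := 3) (by norm_num) (C := s * u * t / v)
    (f := fun x => s * (x ^ 2 * u) * (x * t) / v) (by simp [*]) (fun x hx => by ring)
  have c5 := countable_setOf_qInf_eq_zero hq (n := 3) (by norm_num) (C := -(s * u * t / v))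
    (f := fun x => -(s * (x ^ 2 * u) * (x * t) / v)) (by simp [*]) (fun x hx => by ring)
  have c6 := countable_setOf_qInf_eq_zero hq (n := 1) (by norm_num) (C := z * (s * u * v / t))
    (f := fun x => z * (s * (x ^ 2 * u) * v / (x * t))) (by simp [*])
    (fun x hx => by field_simp)
  have c7 := countable_setOf_qInf_eq_zero hq (n := 1) (by norm_num)
    (C := -(z * (s * u * v / t))) (f := fun x => -(z * (s * (x ^ 2 * u) * v / (x * t))))
    (by simp [*]) (fun x hx => by field_simp)
  refine ((Set.countable_singleton (0 : ℂ)).union (c1.union (c2.union (c3.union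
    (c4.union (c5.union (c6.union c7))))))).mono fun x hx => ?_
  simp only [QAdmissible, Set.mem_union, Set.mem_ofPred_eq, Set.mem_singleton_iff] at hx ⊢
  tauto

theorem isOpen_setOf_qAdmissible {q z s u v t : ℂ} (hq : ‖q‖ < 1)
    (hu : u ≠ 0) (hv : v ≠ 0) (ht : t ≠ 0) :
    IsOpen {x : ℂ | x ≠ 0 ∧ QAdmissible q z s (x ^ 2 * u) v (x * t)} := by
  rw [isOpen_iff_mem_nhds]
  rintro x ⟨hx, h1, h2, h3, h4, h5, h6, h7⟩
  have d1 : DifferentiableAt ℂ (fun x => qInf ((x * t) ^ 2) q) x := by fun_prop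
  have d2 : DifferentiableAt ℂ (fun x => qInf (q * (x ^ 2 * u) ^ 2 / v ^ 2) q) x := by
    fun_prop
  have d3 : DifferentiableAt ℂ (fun x => qTheta ((x ^ 2 * u) ^ 2 * v ^ 2 / (x * t) ^ 2) q) x := by
    fun_prop (disch := first | assumption | simp [*])
  have d4 : DifferentiableAt ℂ (fun x => qInf (s * (x ^ 2 * u) * (x * t) / v) q) x := by
    fun_prop
  have d5 : DifferentiableAt ℂ (fun x => qInf (-(s * (x ^ 2 * u) * (x * t) / v)) q) x := by
    fun_prop
  have d6 : DifferentiableAt ℂ (fun x => qInf (z * (s * (x ^ 2 * u) * v / (x * t))) q) x := by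
    fun_prop (disch := first | assumption | simp [*])
  have d7 : DifferentiableAt ℂ (fun x => qInf (-(z * (s * (x ^ 2 * u) * v / (x * t)))) q) x := by
    fun_prop (disch := first | assumption | simp [*])
  filter_upwards [eventually_ne_nhds hx, d1.continuousAt.eventually_ne h1,
    d2.continuousAt.eventually_ne h2, d3.continuousAt.eventually_ne h3,
    d4.continuousAt.eventually_ne h4, d5.continuousAt.eventually_ne h5,
    d6.continuousAt.eventually_ne h6, d7.continuousAt.eventually_ne h7] with y g0 g1 g2 g3 g4 g5 g6 g7
  exact ⟨g0, g1, g2, g3, g4, g5, g6, g7⟩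

/-- Along (x²u, v, xt) the quantities a, c/b and abz/c scale as x⁴, x² and x², so
`qHyp_mul_qHyp_of_small` applies for x near 0, while x = 1 is the case wanted. The admissible x form
an open set with countable complement, hence dense and connected, and the identity theorem applies.
-/
theorem qHyp_mul_qHyp_eq {q z h s u v t : ℂ} (hq0 : q ≠ 0) (hq : ‖q‖ < 1) (hs : s ^ 2 = q)
    (hz : z ≠ 0) (hz1 : ‖z‖ < 1) (hh : h ≠ 0) (hu : u ≠ 0) (hv : v ≠ 0) (ht : t ≠ 0)
    (hadm : QAdmissible q z s u v t) :
    qTheta h q * qTheta (h * (t ^ 2 / (v ^ 2 * z))) q *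
      (qHyp [u ^ 2, v ^ 2] [t ^ 2] q z * qHyp [u ^ 2, q * u ^ 2 / t ^ 2] [q * u ^ 2 / v ^ 2] q z) =
    qProdTerm₁ q z h s u v t + qProdTerm₂ q z h s u v t + qProdTerm₃ q z h s u v t +
      qProdTerm₃ q z h s (-u) v t + qProdTerm₄ q z h s u v t + qProdTerm₄ q z h s (-u) v t := by
  have hs0 : s ≠ 0 := by rintro rfl; simp at hs; exact hq0 hs.symm
  set U : Set ℂ := {x : ℂ | x ≠ 0 ∧ QAdmissible q z s (x ^ 2 * u) v (x * t)} with hU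
  have hUo : IsOpen U := isOpen_setOf_qAdmissible hq hu hv ht
  have hUc : Uᶜ.Countable := countable_setOf_not_qAdmissible hq0 hq hz hs0 hu hv ht
  have hUp : IsPreconnected U := by
    have := (hUc.isPathConnected_compl_of_one_lt_rank (by
      rw [Complex.rank_real_complex]; norm_num)).isConnected.isPreconnected
    rwa [compl_compl] at this
  have hUd : Dense U := by
    have := hUc.dense_compl ℝ
    rwa [compl_compl] at this
  set F : ℂ → ℂ := fun x => qTheta h q * qTheta (h * ((x * t) ^ 2 / (v ^ 2 * z))) q *
      (qHyp [(x ^ 2 * u) ^ 2, v ^ 2] [(x * t) ^ 2] q z *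
        qHyp [(x ^ 2 * u) ^ 2, q * (x ^ 2 * u) ^ 2 / (x * t) ^ 2] [q * (x ^ 2 * u) ^ 2 / v ^ 2] q z)
    with hF
  set G : ℂ → ℂ := fun x => qProdTerm₁ q z h s (x ^ 2 * u) v (x * t) +
      qProdTerm₂ q z h s (x ^ 2 * u) v (x * t) + qProdTerm₃ q z h s (x ^ 2 * u) v (x * t) +
      qProdTerm₃ q z h s (-(x ^ 2 * u)) v (x * t) + qProdTerm₄ q z h s (x ^ 2 * u) v (x * t) +
      qProdTerm₄ q z h s (-(x ^ 2 * u)) v (x * t) with hG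
  have du : ∀ x : ℂ, x ≠ 0 → DifferentiableAt ℂ (fun x => x ^ 2 * u) x := fun x _ => by fun_prop
  have du' : ∀ x : ℂ, x ≠ 0 → DifferentiableAt ℂ (fun x => -(x ^ 2 * u)) x := fun x _ => by fun_prop
  have dt : ∀ x : ℂ, x ≠ 0 → DifferentiableAt ℂ (fun x => x * t) x := fun x _ => by fun_prop
  have nu : ∀ x : ℂ, x ≠ 0 → x ^ 2 * u ≠ 0 := fun x hx => mul_ne_zero (pow_ne_zero 2 hx) hu
  have nu' : ∀ x : ℂ, x ≠ 0 → -(x ^ 2 * u) ≠ 0 := fun x hx => neg_ne_zero.2 (nu x hx)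
  have nt : ∀ x : ℂ, x ≠ 0 → x * t ≠ 0 := fun x hx => mul_ne_zero hx ht
  have hθ : ∀ x ∈ U, ∀ k : ℤ, (x ^ 2 * u) ^ 2 * v ^ 2 / (x * t) ^ 2 ≠ q ^ k := by
    rintro x ⟨hx, -, -, h3, -⟩
    refine (qTheta_ne_zero_iff hq0 hq ?_).1 h3
    exact div_ne_zero (mul_ne_zero (pow_ne_zero 2 (nu x hx)) (pow_ne_zero 2 hv))
      (pow_ne_zero 2 (nt x hx))
  have hFd : DifferentiableOn ℂ F U := by
    rintro x ⟨hx, h1, h2, -⟩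
    rw [qInf_ne_zero_iff hq] at h1 h2
    refine DifferentiableAt.differentiableWithinAt ?_
    refine DifferentiableAt.mul (DifferentiableAt.const_mul ?_ _) (DifferentiableAt.mul
      (differentiableAt_qHyp_two_one hq hz1 hx ?_ ?_ ?_ h1)
      (differentiableAt_qHyp_two_one hq hz1 hx ?_ ?_ ?_ h2))
    · fun_prop (disch := first | assumption | simp [*])
    all_goals
      intro y hy
      fun_prop (disch := first | assumption | simp [*])
  have hGd : DifferentiableOn ℂ G U := by
    intro x hxU
    have h3 := hθ x hxU
    obtain ⟨hx, h1, h2, -, h4, h5, h6, h7⟩ := hxU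
    rw [qInf_ne_zero_iff hq] at h1 h2 h4 h5 h6 h7
    refine DifferentiableAt.differentiableWithinAt ?_
    refine DifferentiableAt.add (DifferentiableAt.add (DifferentiableAt.add (DifferentiableAt.add
      (DifferentiableAt.add ?_ ?_) ?_) ?_) ?_) ?_
    · exact differentiableAt_qProdTerm₁ hq0 hq hs hz hh hv hx du dt nu nt h1 h2 h3
    · exact differentiableAt_qProdTerm₂ hq0 hq hs hz hz1 hh hv hx du dt nu nt h1 h2 h3
    · exact differentiableAt_qProdTerm₃ hq0 hq hs hz hz1 hh hv hx du dt nu nt h1 h2 h3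
    · exact differentiableAt_qProdTerm₃ hq0 hq hs hz hz1 hh hv hx du' dt nu' nt h1
        (by simpa only [neg_sq] using h2) (by simpa only [neg_sq] using h3)
    · exact differentiableAt_qProdTerm₄ hq0 hq hs hz hz1 hh hv hx du dt nu nt h1 h2 h3 h4 h6
    · exact differentiableAt_qProdTerm₄ hq0 hq hs hz hz1 hh hv hx du' dt nu' nt h1
        (by simpa only [neg_sq] using h2) (by simpa only [neg_sq] using h3)
        (by simpa only [mul_neg, neg_mul, neg_div] using h5)
        (by simpa only [mul_neg, neg_mul, neg_div] using h7)
  have hsmall : ∀ K : ℂ, ∀ n : ℕ, n ≠ 0 → ∀ᶠ x : ℂ in nhds 0, ‖x ^ n * K‖ < 1 := by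
    intro K n hn
    have : Continuous fun x : ℂ => ‖x ^ n * K‖ := by fun_prop
    exact this.continuousAt.eventually (gt_mem_nhds (by simp [hn]))
  have hev := (hsmall (u ^ 2) 4 (by norm_num)).and ((hsmall (t ^ 2 / v ^ 2) 2 (by norm_num)).and
    (hsmall (u ^ 2 * v ^ 2 / t ^ 2 * z) 2 (by norm_num)))
  obtain ⟨ε, hε, hball⟩ := Metric.eventually_nhds_iff_ball.1 hev
  -- Since 0 itself is not admissible, density supplies a nearby base point where both admissibility
  -- and smallness hold on a neighbourhood.
  obtain ⟨x₀, hx₀ε, hx₀U⟩ := hUd.inter_open_nonempty (Metric.ball 0 ε) Metric.isOpen_ball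
    ⟨0, Metric.mem_ball_self hε⟩
  have hFG : F =ᶠ[nhds x₀] G := by
    filter_upwards [hUo.mem_nhds hx₀U, Metric.isOpen_ball.mem_nhds hx₀ε] with x hxU hxε
    obtain ⟨b1, b2, b3⟩ := hball x hxε
    have h3 := hθ x hxU
    obtain ⟨hx, h1, h2, -⟩ := hxU
    rw [qInf_ne_zero_iff hq] at h1 h2
    refine qHyp_mul_qHyp_of_small hq0 hq hs hz hz1 hh (nu x hx) hv (nt x hx) h1 h2 h3 ?_ ?_ ?_
    · rwa [show (x ^ 2 * u) ^ 2 = x ^ 4 * u ^ 2 by ring]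
    · rwa [show (x * t) ^ 2 / v ^ 2 = x ^ 2 * (t ^ 2 / v ^ 2) by ring]
    · rwa [show (x ^ 2 * u) ^ 2 * v ^ 2 / (x * t) ^ 2 * z = x ^ 2 * (u ^ 2 * v ^ 2 / t ^ 2 * z) by
        field_simp]
  have h1U : (1 : ℂ) ∈ U := ⟨one_ne_zero, by simpa only [one_pow, one_mul] using hadm⟩
  have := (hFd.analyticOnNhd hUo).eqOn_of_preconnected_of_eventuallyEq (hGd.analyticOnNhd hUo) hUp
    hx₀U hFG h1U
  simpa only [hF, hG, one_pow, one_mul] using this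

theorem mul_pow_ne_one_of_notMem_qOmega {q x : ℂ} (h : x ∉ qOmega q) (k : ℕ) :
    x * q ^ k ≠ 1 := fun hk => h ⟨k, by
  rw [zpow_neg, zpow_natCast]
  exact eq_inv_of_mul_eq_one_left hk⟩

theorem ne_zpow_of_notMem_qUpsilon {q x : ℂ} (h : x ∉ qUpsilon q) (k : ℤ) : x ≠ q ^ k :=
  fun hk => h ⟨k, hk⟩

/-- Here `sq`, `sa`, `sb`, `sc` are arbitrary square roots of `q`, `a`, `b`, `c`, and every square
root of a monomial in `q, a, b, c` is the corresponding monomial in `sq, sa, sb, sc`. The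
hypotheses with `∉` say that no denominator of the identity vanishes. -/
theorem mainTheorem8 (q z a b c h : ℂ)
    (hq : q ≠ 0) (hq1 : ‖q‖ < 1) (hz : z ≠ 0) (hz1 : ‖z‖ < 1)
    (ha : a ≠ 0) (hb : b ≠ 0) (hc : c ≠ 0) (hh : h ≠ 0)
    (sq sa sb sc : ℂ) (hsq : sq ^ 2 = q) (hsa : sa ^ 2 = a) (hsb : sb ^ 2 = b) (hsc : sc ^ 2 = c)
    (hh1 : h ∉ qUpsilon q) (hh2 : h * (c / (b * z)) ∉ qUpsilon q)
    (hc1 : c ∉ qOmega q) (hab : q * a / b ∉ qOmega q) (habc : a * b / c ∉ qUpsilon q)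
    (hac1 : sq * sa * sc / sb ∉ qOmega q) (hac2 : -(sq * sa * sc / sb) ∉ qOmega q)
    (hz2 : z * (sq * sa * sb / sc) ∉ qOmega q) (hz3 : -(z * (sq * sa * sb / sc)) ∉ qOmega q) :
    qHyp [a, b] [c] q z * qHyp [a, q * a / c] [q * a / b] q z =
      1 / qThetas [h, h * (c / (b * z))] q *
      ( qThetas [h * a, h * (c / (a * b * z))] q
            * qInfs [q / b, c / a, c / b, c / b] q
          / qInfs [c, c / (a * b), c / (a * b), q * a / b] q
          * qHyp [a, b, q * a / c, q * b / c, a * b * z / c, q / z]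
              [q * a * b / c, sq * sa * sb / sc, -(sq * sa * sb / sc),
                q * (sa * sb / sc), -(q * (sa * sb / sc))] q q
      + qThetas [h * (c / b), h / z] q
            * qInfs [a, a, b, q * a / c, a * b * z / c, a * b * z / c] q
          / qInfs [z, z, c, q * a / b, a * b / c, a * b / c] q
          * qHyp [q / a, q / b, c / a, c / b, z, q * c / (a * b * z)]
              [q * c / (a * b), sq * sc / (sa * sb), -(sq * sc / (sa * sb)),
                q * (sc / (sa * sb)), -(q * (sc / (sa * sb)))] q q
      + qThetas [h * (sa * sc / sb), h / z * (sc / (sa * sb)), sb * sc / sa] q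
            * qInfs [a, c / b, a * b * z / c] q
          / qInfs [-1, sq, -sq, z, c, q * a / b, sc / (sa * sb), sa * sb / sc] q
          * qHyp [sa * sc / sb, sb * sc / sa, q * (sa / (sb * sc)), q * (sb / (sa * sc)),
                z * (sa * sb / sc), q / z * (sc / (sa * sb))]
              [-q, sq, -sq, q * (sa * sb / sc), q * (sc / (sa * sb))] q q
      + qThetas [-(h * (sa * sc / sb)), -(h / z * (sc / (sa * sb))), -(sb * sc / sa)] q
            * qInfs [a, c / b, a * b * z / c] q
          / qInfs [-1, sq, -sq, z, c, q * a / b, -(sc / (sa * sb)), -(sa * sb / sc)] q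
          * qHyp [-(sa * sc / sb), -(sb * sc / sa), -(q * (sa / (sb * sc))),
                -(q * (sb / (sa * sc))), -(z * (sa * sb / sc)), -(q / z * (sc / (sa * sb)))]
              [-q, sq, -sq, -(q * (sa * sb / sc)), -(q * (sc / (sa * sb)))] q q
      + qThetas [h * (sq * sa * sc / sb), h / z * (sc / (sq * sa * sb))] q
            * qInfs [a, c / b, a * b * z / c, sa * sc / (sq * sb), sb * sc / (sq * sa),
                sq * sa / (sb * sc), z * (sa * sb / (sq * sc))] q
          / qInfs [-1, 1 / sq, -(1 / sq), z, c, q * a / b, sq * sa * sc / sb,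
                sc / (sq * sa * sb), sa * sb / (sq * sc), z * (sq * sa * sb / sc)] q
          * qHyp [sq * sa * sc / sb, sq * sb * sc / sa, sq ^ 3 * sa / (sb * sc),
                sq ^ 3 * sb / (sa * sc), z * (sq * sa * sb / sc),
                1 / z * (sq ^ 3 * sc / (sa * sb))]
              [-q, sq ^ 3, -sq ^ 3, sq ^ 3 * sa * sb / sc, sq ^ 3 * sc / (sa * sb)] q q
      + qThetas [-(h * (sq * sa * sc / sb)), -(h / z * (sc / (sq * sa * sb)))] q
            * qInfs [a, c / b, a * b * z / c, -(sa * sc / (sq * sb)), -(sb * sc / (sq * sa)),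
                -(sq * sa / (sb * sc)), -(z * (sa * sb / (sq * sc)))] q
          / qInfs [-1, 1 / sq, -(1 / sq), z, c, q * a / b, -(sq * sa * sc / sb),
                -(sc / (sq * sa * sb)), -(sa * sb / (sq * sc)), -(z * (sq * sa * sb / sc))] q
          * qHyp [-(sq * sa * sc / sb), -(sq * sb * sc / sa), -(sq ^ 3 * sa / (sb * sc)),
                -(sq ^ 3 * sb / (sa * sc)), -(z * (sq * sa * sb / sc)),
                -(1 / z * (sq ^ 3 * sc / (sa * sb)))]
              [-q, sq ^ 3, -sq ^ 3, -(sq ^ 3 * sa * sb / sc), -(sq ^ 3 * sc / (sa * sb))] q q ) := by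
  subst hsa hsb hsc
  have hu : sa ≠ 0 := fun h0 => ha (by rw [h0]; ring)
  have hv : sb ≠ 0 := fun h0 => hb (by rw [h0]; ring)
  have ht : sc ≠ 0 := fun h0 => hc (by rw [h0]; ring)
  have hΩ : ∀ {x : ℂ}, x ∉ qOmega q → qInf x q ≠ 0 := fun hx =>
    qInf_ne_zero hq1 (mul_pow_ne_one_of_notMem_qOmega hx)
  have hΥ : ∀ {x : ℂ}, x ≠ 0 → x ∉ qUpsilon q → qTheta x q ≠ 0 := fun h0 hx =>
    (qTheta_ne_zero_iff hq hq1 h0).2 (ne_zpow_of_notMem_qUpsilon hx)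
  have key := qHyp_mul_qHyp_eq hq hq1 hsq hz hz1 hh hu hv ht ⟨hΩ hc1, hΩ hab,
    hΥ (div_ne_zero (mul_ne_zero ha hb) hc) habc, hΩ hac1, hΩ hac2, hΩ hz2, hΩ hz3⟩
  have hne : qThetas [h, h * (sc ^ 2 / (sb ^ 2 * z))] q ≠ 0 := by
    simp only [qThetas, List.map_cons, List.map_nil, List.prod_cons, List.prod_nil, mul_one]
    exact mul_ne_zero (hΥ hh hh1)
      (hΥ (mul_ne_zero hh (div_ne_zero hc (mul_ne_zero hb hz))) hh2)
  have hθ : qThetas [h, h * (sc ^ 2 / (sb ^ 2 * z))] q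
      = qTheta h q * qTheta (h * (sc ^ 2 / (sb ^ 2 * z))) q := by
    simp [qThetas]
  rw [one_div, eq_inv_mul_iff_mul_eq₀ hne, hθ, key]
  -- The ε = -1 terms are `qProdTerm₃` and `qProdTerm₄` at -√a; pulling the signs out gives the
  -- stated form.
  simp only [qProdTerm₁, qProdTerm₂, qProdTerm₃, qProdTerm₄, neg_mul, mul_neg, neg_div, div_neg,
    neg_sq]
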